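/- **Theorem.** Let $X$ be a metric space and $n\ge 0$ an integer. Then $X$ is a coarse $PD(n)$ space if and only if $X$ has an orientation pair of degree $n$. The terms are defined as follows; all coefficients are integral. *Coarse containment.* For subsets $A,B,C$ of a metric space let $N_R(A)$ be the set of points at distance less than $R$ from some point of $A$. Write $A\subset_c B$ if $A\subset N_R(B)$ for some $R$; bounded sets are also declared to be coarsely contained in the empty set. Write $A\cap_c B\subset_c C$ if $N_R(A)\cap N_R(B)\subset_c C$ for every $R$. *Supports.* A $k$-simplex of $X$ is a point of $X^{k+1}$. Let $X^\infty$ be the set of eventually constant sequences in $X$ with the sup metric; a simplex $(x_0,\dots,x_k)$ is viewed as the point $(x_0,\dots,x_k,x_k,x_k,\dots)$ of $X^\infty$. The support $|c|\subset X^\infty$ of a function $c:X^{k+1}\to\mathbb Z$ is the set of the simplices on which it is non-zero. For $A\subset X$ let $\Delta_A\subset X^\infty$ be the set of constant sequences with value in $A$, and put $\Delta=\Delta_X$. *Complexes.* $C^k(X)$ is the group of all functions $X^{k+1}\to\mathbb Z$, with the coboundary $d\phi(x_0,\dots,x_{k+1})=\sum_i(-1)^i\phi(x_0,\dots,\hat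 x_i,\dots,x_{k+1})$. $CX_k(X)$ is the group of the integral $k$-chains $c=\sum c_\sigma\sigma$ (infinite sums allowed) such that for every bounded $B\subset X$ only finitely many simplices $\sigma$ with $c_\sigma\ne0$ have a vertex in $B$, and such that $|c|\subset_c\Delta$; it has the usual boundary $\partial$. All these groups are zero for $k<0$. $HX_k(X)$ is the homology of $CX_*(X)$. For $A\subset X$, $CX^*(X-A)=\{\phi\in C^*(X): |\phi|\cap_c\Delta\subset_c\Delta_A\}$, with cohomology $HX^*(X-A)$. Let $C^n(X\otimes X)$ be the group of integral functions on the products $\sigma^k\otimes\tau^l$ of simplices of $X$ with $k+l=n$, with the coboundary dual to $\partial(\sigma^k\otimes\tau^l)=\partial\sigma\otimes\tau+(-1)^k\sigma\otimes\partial\tau$. The support $|\sigma\otimes\tau|$ of a product of $\sigma=(x_0,\dots,x_k)$ and $\tau=(y_0,\dots,y_l)$ is the element of $(X\times X)^{(k+1)(l+1)}$ with $(i,j)$ coordinate $(x_i,y_j)$, viewed as a point of $(X\times X)^\infty$ ($X\times X$ has the sup metric); $|\phi|$ is the set of the $|\sigma\otimes\tau|$ with $\phi(\sigma\otimes\tau)\neq0$.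 With $\delta(x)=(x,x)$, let $CX^*(X\otimes X-\delta(X))=\{\phi\in C^*(X\otimes X): |\phi|\cap_c\Delta_{X\times X}\subset_c\Delta_{\delta(X)}\}$, with cohomology $HX^*(X\otimes X-\delta(X))$. *Coarse $PD(n)$ spaces.* $X$ is a coarse $PD(n)$ space if there are chain maps $p:C^*(X)\to CX_{n-*}(X)$ and $q:CX_{n-*}(X)\to C^*(X)$ and chain homotopies $G:CX_*(X)\to CX_{*+1}(X)$ from $pq$ to the identity and $F:C^*(X)\to C^{*-1}(X)$ from $qp$ to the identity (that is, $pq-\mathrm{id}=\partial G+G\partial$ and $qp-\mathrm{id}=dF+Fd$), such that for all homogeneous $\phi\in C^*(X)$ and $c\in CX_*(X)$ $$|p(\phi)|\subset_c|\phi|,\qquad |F(\phi)|\cap_c\Delta\subset_c|\phi|,\qquad |q(c)|\cap_c\Delta\subset_c|c|,\qquad |G(c)|\subset_c|c|.$$ *Orientation pairs.* For $\phi\in CX^n(X\otimes X-\delta(X))$ and $c=\sum c_\sigma\sigma\in CX_k(X)$ the slant product $\phi/c\in C^{n-k}(X)=CX^{n-k}(X-X)$ is given by the finite sums $(\phi/c)(\tau)=\sum_\sigma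 c_\sigma\,\phi(\sigma\otimes\tau)$; it induces a slant product $HX^n(X\otimes X-\delta(X))\times HX_k(X)\to HX^{n-k}(X-X)$. An orientation pair of degree $n$ consists of classes $U\in HX^n(X\otimes X-\delta(X))$ (the diagonal class) and $[X]\in HX_n(X)$ (the fundamental class) with $U/[X]=1\in HX^0(X-X)$, where $1$ is the class of the constant function $1$ on $X$. -/

import Mathlib

namespace CoarsePD

open Metric Bornology

/-! ## Coarse containment -/

section Coarse

variable {M : Type*} [PseudoMetricSpace M]

/-- Coarse containment of subsets of a metric space: `A` lies in some metric neighbourhood of `B`.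
The empty set is declared to be coarsely equal to the bounded sets, whence the first alternative
(it is implied by the second one as soon as `B` is non-empty). -/
def CoarselyContained (A B : Set M) : Prop :=
  IsBounded A ∨ ∃ R : ℝ, A ⊆ thickening R B

/-- The coarse intersection of `A` and `B` is coarsely contained in `C`: for every `R`, the
intersection of the `R`-neighbourhoods of `A` and `B` is coarsely contained in `C`. -/
def CoarseInterContained (A B C : Set M) : Prop :=
  ∀ R : ℝ, CoarselyContained (thickening R A ∩ thickening R B) C

theorem CoarselyContained.mono {A A' B : Set M} (h : CoarselyContained A B) (hA : A' ⊆ A) :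
    CoarselyContained A' B := by
  rcases h with h | ⟨R, h⟩
  · exact Or.inl (h.subset hA)
  · exact Or.inr ⟨R, hA.trans h⟩

theorem CoarselyContained.exists_thickening {A B : Set M} (h : CoarselyContained A B)
    (hB : B.Nonempty) : ∃ R : ℝ, A ⊆ thickening R B := by
  rcases h with h | h
  · obtain ⟨b, hb⟩ := hB
    obtain ⟨R, hR⟩ := h.subset_ball b
    exact ⟨R, fun a ha => mem_thickening_iff.2 ⟨b, hb, hR ha⟩⟩
  · exact h

theorem CoarselyContained.union {A A' B : Set M} (h : CoarselyContained A B)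
    (h' : CoarselyContained A' B) : CoarselyContained (A ∪ A') B := by
  rcases B.eq_empty_or_nonempty with rfl | hB
  · left
    have key : ∀ S : Set M, CoarselyContained S ∅ → IsBounded S := by
      rintro S (hS | ⟨R, hS⟩)
      · exact hS
      · exact (isBounded_empty).subset (by simpa using hS)
    exact (key A h).union (key A' h')
  · obtain ⟨R, hR⟩ := h.exists_thickening hB
    obtain ⟨R', hR'⟩ := h'.exists_thickening hB
    exact Or.inr ⟨max R R', Set.union_subset
      (hR.trans (thickening_mono (le_max_left _ _) _))
      (hR'.trans (thickening_mono (le_max_right _ _) _))⟩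

theorem coarselyContained_empty (B : Set M) : CoarselyContained ∅ B :=
  Or.inl isBounded_empty

theorem CoarseInterContained.union {A A' B C : Set M} (h : CoarseInterContained A B C)
    (h' : CoarseInterContained A' B C) : CoarseInterContained (A ∪ A') B C := by
  intro R
  refine ((h R).union (h' R)).mono ?_
  rw [thickening_union, Set.union_inter_distrib_right]

theorem CoarseInterContained.mono {A A' B C : Set M} (h : CoarseInterContained A B C)
    (hA : A' ⊆ A) : CoarseInterContained A' B C := fun R =>
  (h R).mono (Set.inter_subset_inter_left _ (thickening_subset_of_subset R hA))

theorem coarseInterContained_empty (B C : Set M) : CoarseInterContained ∅ B C := by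
  intro R
  refine (coarselyContained_empty C).mono ?_
  simp

end Coarse

/-! ## Eventually constant sequences -/

/-- `X^∞`: the eventually constant sequences of points of `X`. -/
def EvConst (X : Type*) : Type _ := {s : ℕ → X // ∃ N, ∀ m, N ≤ m → s m = s N}

section EvConst

variable {X : Type*} [MetricSpace X]

theorem EvConst.bddAbove (s t : EvConst X) :
    BddAbove (Set.range fun m => dist (s.1 m) (t.1 m)) := by
  obtain ⟨N, hN⟩ := s.2
  obtain ⟨N', hN'⟩ := t.2
  refine (((Set.finite_Iic (max N N')).image fun m => dist (s.1 m) (t.1 m)).subset ?_).bddAbove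
  rintro _ ⟨m, rfl⟩
  rcases le_total m (max N N') with h | h
  · exact ⟨m, h, rfl⟩
  · refine ⟨max N N', Set.mem_Iic.2 le_rfl, ?_⟩
    simp only
    rw [hN m ((le_max_left _ _).trans h), hN' m ((le_max_right _ _).trans h),
      hN _ (le_max_left N N'), hN' _ (le_max_right N N')]

/-- The sup metric on `X^∞`. -/
noncomputable instance : MetricSpace (EvConst X) where
  dist s t := ⨆ m, dist (s.1 m) (t.1 m)
  dist_self s := by simp
  dist_comm s t := by simp [dist_comm]
  dist_triangle s t u := by
    refine ciSup_le fun m => (dist_triangle _ (t.1 m) _).trans ?_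
    exact add_le_add (le_ciSup (EvConst.bddAbove s t) m) (le_ciSup (EvConst.bddAbove t u) m)
  eq_of_dist_eq_zero := by
    intro s t h
    refine Subtype.ext (funext fun m => ?_)
    have h1 := le_ciSup (EvConst.bddAbove s t) m
    exact dist_le_zero.1 (h1.trans h.le)

theorem EvConst.dist_le_iff {s t : EvConst X} {R : ℝ} :
    dist s t ≤ R ↔ ∀ m, dist (s.1 m) (t.1 m) ≤ R :=
  ciSup_le_iff (EvConst.bddAbove s t)

/-- The constant sequence at `x`. -/
def EvConst.const (x : X) : EvConst X := ⟨fun _ => x, 0, fun _ _ => rfl⟩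

/-- For `A ⊆ X`, the part of the diagonal of `X^∞` lying over `A`. -/
def diag (A : Set X) : Set (EvConst X) := EvConst.const '' A

end EvConst

/-! ## Simplices, chains and cochains -/

/-- The simplices of all dimensions of `X`: a `k`-simplex is a `(k+1)`-tuple of points. -/
abbrev Simplex (X : Type*) : Type _ := Σ k : ℕ, (Fin (k + 1) → X)

/-- The `i`-th face of a `(k+1)`-simplex (the `i`-th vertex is omitted). -/
def face {X : Type*} {k : ℕ} (i : Fin (k + 2)) (σ : Fin (k + 2) → X) : Simplex X :=
  ⟨k, i.removeNth σ⟩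

/-- The `(k+1)`-simplex obtained from a `k`-simplex by inserting `x` as the `i`-th vertex. -/
def insertVertex {X : Type*} {k : ℕ} (i : Fin (k + 2)) (x : X) (τ : Fin (k + 1) → X) : Simplex X :=
  ⟨k + 1, i.insertNth (α := fun _ => X) x τ⟩

/-- The stabilization of a simplex: its last vertex is repeated for ever. -/
def stab {X : Type*} (σ : Simplex X) : EvConst X :=
  ⟨fun m => σ.2 ⟨min m σ.1, Nat.lt_succ_of_le (min_le_right _ _)⟩, σ.1, fun m hm => by
    simp [min_eq_right hm]⟩

/-- The stabilized support of an integral chain or cochain. -/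
def supp {X : Type*} (c : Simplex X → ℤ) : Set (EvConst X) := stab '' {σ | c σ ≠ 0}

/-- The Alexander--Spanier coboundary
`(dφ)(x₀, …, x_k) = ∑ i, (-1)^i φ(x₀, …, x̂_i, …, x_k)`, which is zero on `0`-simplices. -/
def coboundary {X : Type*} (φ : Simplex X → ℤ) : Simplex X → ℤ
  | ⟨0, _⟩ => 0
  | ⟨k + 1, σ⟩ => ∑ i : Fin (k + 2), (-1) ^ (i : ℕ) * φ (face i σ)

/-- The boundary of a (locally finite) chain, `∂(x₀, …, x_k) = ∑ i, (-1)^i (x₀, …, x̂_i, …, x_k)`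
on simplices. The coefficient of `τ` in `∂c` is the sum of `(-1)^i c_σ` over the pairs `(i, σ)`
such that `τ` is the `i`-th face of `σ`, that is, such that `σ` is `τ` with some `x` inserted as
the `i`-th vertex; for locally finite `c` only finitely many of these terms are non-zero. -/
noncomputable def boundary {X : Type*} (c : Simplex X → ℤ) : Simplex X → ℤ :=
  fun τ => ∑ i : Fin (τ.1 + 2), (-1) ^ (i : ℕ) * ∑ᶠ x : X, c (insertVertex i x τ.2)

/-- The set of vertices of a simplex. -/
def verts {X : Type*} (σ : Simplex X) : Set X := Set.range σ.2

theorem coboundary_ne_zero {X : Type*} {φ : Simplex X → ℤ} {σ : Simplex X}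
    (h : coboundary φ σ ≠ 0) :
    ∃ ρ, φ ρ ≠ 0 ∧ verts ρ ⊆ verts σ ∧ ρ.1 + 1 = σ.1 := by
  obtain ⟨_ | k, σ⟩ := σ
  · exact absurd rfl h
  · obtain ⟨i, -, hi⟩ := Finset.exists_ne_zero_of_sum_ne_zero h
    refine ⟨face i σ, fun h0 => hi (by rw [h0, mul_zero]), ?_, rfl⟩
    rintro _ ⟨j, rfl⟩
    exact ⟨i.succAbove j, rfl⟩

theorem face_insertVertex {X : Type*} {k : ℕ} (i : Fin (k + 2)) (x : X) (τ : Fin (k + 1) → X) :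
    face i (insertVertex i x τ).2 = ⟨k, τ⟩ := by
  simp [face, insertVertex]

theorem boundary_ne_zero {X : Type*} {c : Simplex X → ℤ} {τ : Simplex X}
    (h : boundary c τ ≠ 0) : ∃ i : Fin (τ.1 + 2), ∃ x : X, c (insertVertex i x τ.2) ≠ 0 := by
  obtain ⟨i, -, hi⟩ := Finset.exists_ne_zero_of_sum_ne_zero h
  have h2 : ∑ᶠ x : X, c (insertVertex i x τ.2) ≠ 0 := fun h0 => hi (by rw [h0, mul_zero])
  by_contra! h3
  exact h2 (by rw [finsum_congr (fun x => h3 i x), finsum_zero])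

theorem verts_subset_insertVertex {X : Type*} {k : ℕ} (i : Fin (k + 2)) (x : X) (τ : Fin (k + 1) → X) :
    verts ⟨k, τ⟩ ⊆ verts (insertVertex i x τ) := by
  rintro _ ⟨j, rfl⟩
  exact ⟨i.succAbove j, by simp [insertVertex]⟩

theorem coboundary_add {X : Type*} (φ ψ : Simplex X → ℤ) :
    coboundary (φ + ψ) = coboundary φ + coboundary ψ := by
  funext ⟨k, σ⟩
  cases k with
  | zero => simp [coboundary]
  | succ k => simp [coboundary, mul_add, Finset.sum_add_distrib]

theorem coboundary_zero {X : Type*} : coboundary (0 : Simplex X → ℤ) = 0 := by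
  simpa using coboundary_add (0 : Simplex X → ℤ) 0

/-! ### Supports -/

section Supp

variable {X : Type*}

theorem supp_zero : supp (0 : Simplex X → ℤ) = ∅ := by simp [supp]

theorem supp_add (c c' : Simplex X → ℤ) : supp (c + c') ⊆ supp c ∪ supp c' := by
  rintro _ ⟨σ, hσ, rfl⟩
  by_cases h : c σ = 0
  · exact Or.inr ⟨σ, fun h' => hσ (by simp [h, h']), rfl⟩
  · exact Or.inl ⟨σ, h, rfl⟩

theorem supp_neg (c : Simplex X → ℤ) : supp (-c) = supp c := by simp [supp]

variable [MetricSpace X]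

theorem dist_stab_const_le {σ : Simplex X} {x : X} {R : ℝ} :
    dist (stab σ) (EvConst.const x) ≤ R ↔ ∀ v ∈ verts σ, dist v x ≤ R := by
  rw [EvConst.dist_le_iff]
  constructor
  · rintro h _ ⟨i, rfl⟩
    have h1 := h i
    have h2 : (⟨min (i : ℕ) σ.1, Nat.lt_succ_of_le (min_le_right _ _)⟩ : Fin (σ.1 + 1)) = i :=
      Fin.ext (min_eq_left (Nat.le_of_lt_succ i.2))
    simp only [stab, EvConst.const, h2] at h1
    exact h1
  · intro h m
    exact h _ ⟨_, rfl⟩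

/-- A simplex whose vertices are among those of `σ` is close to `σ`, if `σ` is close to the
diagonal. -/
theorem exists_near {Y : Type*} [MetricSpace Y] {S S' : Set (Simplex Y)} {C : Set (EvConst Y)}
    (h : CoarseInterContained (stab '' S) (diag Set.univ) C)
    (hS : ∀ σ ∈ S', ∃ ρ ∈ S, verts ρ ⊆ verts σ) :
    CoarseInterContained (stab '' S') (diag Set.univ) C := by
  intro R
  refine (h (3 * R)).mono ?_
  rintro z ⟨hz1, hz2⟩
  obtain ⟨_, ⟨σ, hσ, rfl⟩, h1⟩ := mem_thickening_iff.1 hz1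
  obtain ⟨_, ⟨x, -, rfl⟩, h2⟩ := mem_thickening_iff.1 hz2
  obtain ⟨ρ, hρ, hv⟩ := hS σ hσ
  have hR : 0 < R := dist_nonneg.trans_lt h1
  have h3 : dist (stab σ) (EvConst.const x) ≤ 2 * R := by
    linarith [dist_triangle_left (stab σ) (EvConst.const x) z]
  have h4 : dist (stab ρ) (EvConst.const x) ≤ 2 * R :=
    dist_stab_const_le.2 fun v hvρ => dist_stab_const_le.1 h3 v (hv hvρ)
  refine ⟨mem_thickening_iff.2 ⟨_, ⟨ρ, hρ, rfl⟩, ?_⟩,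
    mem_thickening_iff.2 ⟨_, ⟨x, trivial, rfl⟩, by linarith⟩⟩
  linarith [dist_triangle_right z (stab ρ) (EvConst.const x)]

end Supp

/-! ## The complexes -/

/-- `C^k(X)`: all integral Alexander--Spanier `k`-cochains, that is, the functions supported on
the `k`-simplices (it is zero for `k < 0`). -/
def Cochain (X : Type*) (k : ℤ) : AddSubgroup (Simplex X → ℤ) where
  carrier := {φ | ∀ σ, φ σ ≠ 0 → (σ.1 : ℤ) = k}
  zero_mem' := fun _ h => absurd rfl h
  add_mem' := by
    intro a b ha hb σ h
    by_cases h0 : a σ = 0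
    · exact hb σ fun h' => h (by simp [h0, h'])
    · exact ha σ h0
  neg_mem' := by
    intro a ha σ h
    exact ha σ (by simpa using h)

theorem coboundary_mem {X : Type*} {k l : ℤ} (h : k + 1 = l) {φ : Simplex X → ℤ}
    (hφ : φ ∈ Cochain X k) : coboundary φ ∈ Cochain X l := by
  intro σ hσ
  obtain ⟨ρ, hρ, -, hd⟩ := coboundary_ne_zero hσ
  have := hφ ρ hρ
  omega

/-- The coboundary operator `d : C^k(X) → C^(k+1)(X)`. -/
def Cochain.d {X : Type*} (k l : ℤ) (h : k + 1 = l) : Cochain X k →+ Cochain X l where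
  toFun φ := ⟨coboundary φ.1, coboundary_mem h φ.2⟩
  map_zero' := Subtype.ext coboundary_zero
  map_add' _ _ := Subtype.ext (coboundary_add _ _)

section Complexes

variable (X : Type*) [MetricSpace X]

/-- `CX_k(X)`: the coarse `k`-chains, that is, the integral `k`-chains `c` such that
only finitely many simplices of `c` have a vertex in any given bounded set, and whose support is
coarsely contained in the diagonal. -/
def CoarseChain (k : ℤ) : AddSubgroup (Simplex X → ℤ) where
  carrier := {c | (∀ σ, c σ ≠ 0 → (σ.1 : ℤ) = k) ∧
    (∀ B : Set X, IsBounded B → {σ : Simplex X | c σ ≠ 0 ∧ ∃ i, σ.2 i ∈ B}.Finite) ∧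
    CoarselyContained (supp c) (diag Set.univ)}
  zero_mem' := ⟨(Cochain X k).zero_mem, fun B _ => by simp,
    by rw [supp_zero]; exact coarselyContained_empty _⟩
  add_mem' := by
    rintro a b ⟨ha1, ha2, ha3⟩ ⟨hb1, hb2, hb3⟩
    refine ⟨(Cochain X k).add_mem ha1 hb1, fun B hB => ?_, (ha3.union hb3).mono (supp_add a b)⟩
    refine ((ha2 B hB).union (hb2 B hB)).subset ?_
    rintro σ ⟨h, hi⟩
    by_cases h0 : a σ = 0
    · exact Or.inr ⟨fun h' => h (by simp [h0, h']), hi⟩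
    · exact Or.inl ⟨h0, hi⟩
  neg_mem' := by
    rintro a ⟨ha1, ha2, ha3⟩
    refine ⟨(Cochain X k).neg_mem ha1, fun B hB => ?_, by rwa [supp_neg]⟩
    simpa using ha2 B hB

variable {X}

theorem CoarseChain.finite_insertVertex {k : ℤ} {c : Simplex X → ℤ} (hc : c ∈ CoarseChain X k)
    {m : ℕ} (i : Fin (m + 2)) (τ : Fin (m + 1) → X) :
    (Function.support fun x => c (insertVertex i x τ)).Finite := by
  have h := hc.2.1 {τ 0} isBounded_singleton
  refine Set.Finite.of_finite_image (f := fun x => insertVertex i x τ) (h.subset ?_) ?_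
  · rintro _ ⟨x, hx, rfl⟩
    exact ⟨hx, i.succAbove 0, by simp [insertVertex]⟩
  · intro x _ y _ hxy
    have h1 : (i.insertNth (α := fun _ => X) x τ) = i.insertNth (α := fun _ => X) y τ := by
      simpa [insertVertex] using hxy
    simpa using congrFun h1 i

theorem boundary_add {k l : ℤ} {a b : Simplex X → ℤ} (ha : a ∈ CoarseChain X k)
    (hb : b ∈ CoarseChain X l) : boundary (a + b) = boundary a + boundary b := by
  funext τ
  simp only [boundary, Pi.add_apply]
  rw [← Finset.sum_add_distrib]
  refine Finset.sum_congr rfl fun i _ => ?_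
  rw [finsum_add_distrib (CoarseChain.finite_insertVertex ha i τ.2) (CoarseChain.finite_insertVertex hb i τ.2),
    mul_add]

theorem boundary_mem {k l : ℤ} (h : l + 1 = k) {c : Simplex X → ℤ}
    (hc : c ∈ CoarseChain X k) : boundary c ∈ CoarseChain X l := by
  refine ⟨fun τ hτ => ?_, fun B hB => ?_, ?_⟩
  · obtain ⟨i, x, hx⟩ := boundary_ne_zero hτ
    have h1 := hc.1 _ hx
    simp only [insertVertex] at h1
    push_cast at h1
    omega
  · have hfin := hc.2.1 B hB
    let f : Simplex X → Set (Simplex X) := fun σ =>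
      match σ with
      | ⟨0, _⟩ => ∅
      | ⟨_ + 1, s⟩ => Set.range fun i => face i s
    have hf : ∀ σ, (f σ).Finite := by
      rintro ⟨_ | m, s⟩
      · exact Set.finite_empty
      · exact Set.finite_range _
    refine (hfin.biUnion fun σ _ => hf σ).subset ?_
    rintro τ ⟨hτ, j, hj⟩
    obtain ⟨i, x, hx⟩ := boundary_ne_zero hτ
    refine Set.mem_biUnion (x := insertVertex i x τ.2) ⟨hx, ?_⟩ ⟨i, face_insertVertex i x τ.2⟩
    exact ⟨i.succAbove j, by simpa [insertVertex] using hj⟩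
  · rcases (supp c).eq_empty_or_nonempty with he | ⟨_, ⟨σ₀, hσ₀, rfl⟩⟩
    · refine (coarselyContained_empty _).mono ?_
      rintro _ ⟨τ, hτ, rfl⟩
      obtain ⟨i, x, hx⟩ := boundary_ne_zero hτ
      have : stab (insertVertex i x τ.2) ∈ supp c := ⟨_, hx, rfl⟩
      rw [he] at this
      exact this.elim
    · obtain ⟨R, hR⟩ := hc.2.2.exists_thickening ⟨_, σ₀.2 0, trivial, rfl⟩
      refine Or.inr ⟨R + 1, ?_⟩
      rintro _ ⟨τ, hτ, rfl⟩
      obtain ⟨i, x, hx⟩ := boundary_ne_zero hτ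
      obtain ⟨_, ⟨y, -, rfl⟩, hy⟩ := mem_thickening_iff.1 (hR ⟨_, hx, rfl⟩)
      refine mem_thickening_iff.2 ⟨_, ⟨y, trivial, rfl⟩, ?_⟩
      refine lt_of_le_of_lt (dist_stab_const_le.2 fun v hv => ?_) (lt_add_one R)
      exact dist_stab_const_le.1 hy.le v (verts_subset_insertVertex i x τ.2 hv)

/-- The boundary operator `∂ : CX_(k+1)(X) → CX_k(X)`. -/
noncomputable def CoarseChain.d (k l : ℤ) (h : l + 1 = k) :
    CoarseChain X k →+ CoarseChain X l where
  toFun c := ⟨boundary c.1, boundary_mem h c.2⟩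
  map_zero' := Subtype.ext (by funext τ; simp [boundary])
  map_add' a b := Subtype.ext (boundary_add a.2 b.2)

/-- `CX^k(X - A)`: the coarse `k`-cochains of the complement of `A` in `X`, that is, the
`k`-cochains for which the coarse intersection of the support with the diagonal is coarsely
contained in the part of the diagonal over `A`. -/
def ComplCochain (A : Set X) (k : ℤ) : AddSubgroup (Simplex X → ℤ) where
  carrier := {φ | (∀ σ, φ σ ≠ 0 → (σ.1 : ℤ) = k) ∧
    CoarseInterContained (supp φ) (diag Set.univ) (diag A)}
  zero_mem' := ⟨(Cochain X k).zero_mem, by rw [supp_zero]; exact coarseInterContained_empty _ _⟩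
  add_mem' := fun {a b} ha hb =>
    ⟨(Cochain X k).add_mem ha.1 hb.1, (ha.2.union hb.2).mono (supp_add a b)⟩
  neg_mem' := fun {a} ha => ⟨(Cochain X k).neg_mem ha.1, by rw [supp_neg]; exact ha.2⟩

/-- The coboundary operator `d : CX^k(X - A) → CX^(k+1)(X - A)`. -/
def ComplCochain.d (A : Set X) (k l : ℤ) (h : k + 1 = l) :
    ComplCochain A k →+ ComplCochain A l where
  toFun φ := ⟨coboundary φ.1, coboundary_mem h φ.2.1, exists_near φ.2.2 fun _ hσ => by
    obtain ⟨ρ, hρ, hv, -⟩ := coboundary_ne_zero hσ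
    exact ⟨ρ, hρ, hv⟩⟩
  map_zero' := Subtype.ext coboundary_zero
  map_add' _ _ := Subtype.ext (coboundary_add _ _)

theorem mem_complCochain_univ {k : ℤ} {φ : Simplex X → ℤ} (h : φ ∈ Cochain X k) :
    φ ∈ ComplCochain (Set.univ : Set X) k :=
  ⟨h, fun R => Or.inr ⟨R, Set.inter_subset_right⟩⟩

end Complexes

/-! ## Cochains on `X ⊗ X`

The complex of finite chains on `X ⊗ X` is the tensor product of the complexes of finite chains on
the two factors. It is free on the products `σ ⊗ τ` of simplices, so an `n`-cochain on `X ⊗ X` is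
a function on the pairs `(σ, τ)` with `dim σ + dim τ = n`. -/

/-- For a `k`-simplex `σ` and an `l`-simplex `τ`, the element of `(X × X)^((k+1)(l+1))`
whose `(i, j)` coordinate is `(σ i, τ j)`. -/
def grid {X : Type*} (s : Simplex X × Simplex X) : Simplex (X × X) :=
  ⟨s.1.1 * s.2.1 + s.1.1 + s.2.1, fun m =>
    (s.1.2 ⟨m / (s.2.1 + 1), (Nat.div_lt_iff_lt_mul (Nat.succ_pos _)).2 (by
      have := m.2; nlinarith)⟩,
     s.2.2 ⟨m % (s.2.1 + 1), Nat.mod_lt _ (Nat.succ_pos _)⟩)⟩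

theorem verts_grid {X : Type*} (s : Simplex X × Simplex X) :
    verts (grid s) = verts s.1 ×ˢ verts s.2 := by
  ext ⟨x, y⟩
  constructor
  · rintro ⟨m, hm⟩
    rw [← hm]
    exact ⟨⟨_, rfl⟩, ⟨_, rfl⟩⟩
  · rintro ⟨⟨i, rfl⟩, ⟨j, rfl⟩⟩
    have hj : (j : ℕ) < s.2.1 + 1 := j.2
    have hi : (i : ℕ) ≤ s.1.1 := Nat.le_of_lt_succ i.2
    refine ⟨⟨i * (s.2.1 + 1) + j, ?_⟩, ?_⟩
    · have : (i : ℕ) * (s.2.1 + 1) ≤ s.1.1 * (s.2.1 + 1) := Nat.mul_le_mul_right _ hi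
      simp only [grid]
      nlinarith
    · have h1 : ((i : ℕ) * (s.2.1 + 1) + j) / (s.2.1 + 1) = i := by
        rw [mul_comm, Nat.mul_add_div (Nat.succ_pos _), Nat.div_eq_of_lt hj, add_zero]
      have h2 : ((i : ℕ) * (s.2.1 + 1) + j) % (s.2.1 + 1) = j := by
        rw [mul_comm, Nat.mul_add_mod, Nat.mod_eq_of_lt hj]
      simp only [grid, h1, h2]

/-- The stabilized support, in `(X × X)^∞`, of a cochain on `X ⊗ X`. -/
def tensorSupp {X : Type*} (φ : Simplex X × Simplex X → ℤ) : Set (EvConst (X × X)) :=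
  stab '' (grid '' {s | φ s ≠ 0})

/-- The coboundary of a cochain on `X ⊗ X`, dual to
`∂(σ ⊗ τ) = ∂σ ⊗ τ + (-1)^(dim σ) σ ⊗ ∂τ`. -/
def tensorCoboundary {X : Type*} (φ : Simplex X × Simplex X → ℤ) : Simplex X × Simplex X → ℤ :=
  fun s => coboundary (fun σ => φ (σ, s.2)) s.1 +
    (-1) ^ s.1.1 * coboundary (fun τ => φ (s.1, τ)) s.2

theorem tensorSupp_zero {X : Type*} : tensorSupp (0 : Simplex X × Simplex X → ℤ) = ∅ := by
  simp [tensorSupp]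

theorem tensorSupp_neg {X : Type*} (φ : Simplex X × Simplex X → ℤ) :
    tensorSupp (-φ) = tensorSupp φ := by
  simp [tensorSupp]

theorem tensorSupp_add {X : Type*} (φ ψ : Simplex X × Simplex X → ℤ) :
    tensorSupp (φ + ψ) ⊆ tensorSupp φ ∪ tensorSupp ψ := by
  rintro _ ⟨_, ⟨s, hs, rfl⟩, rfl⟩
  by_cases h : φ s = 0
  · exact Or.inr ⟨_, ⟨s, fun h' => hs (by simp [h, h']), rfl⟩, rfl⟩
  · exact Or.inl ⟨_, ⟨s, h, rfl⟩, rfl⟩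

theorem tensorCoboundary_add {X : Type*} (φ ψ : Simplex X × Simplex X → ℤ) :
    tensorCoboundary (φ + ψ) = tensorCoboundary φ + tensorCoboundary ψ := by
  funext ⟨σ, τ⟩
  have h1 := congrFun (coboundary_add (fun σ => φ (σ, τ)) (fun σ => ψ (σ, τ))) σ
  have h2 := congrFun (coboundary_add (fun τ => φ (σ, τ)) (fun τ => ψ (σ, τ))) τ
  simp only [Pi.add_apply] at h1 h2
  have e1 : coboundary (fun σ => (φ + ψ) (σ, τ)) σ =
      coboundary (fun σ => φ (σ, τ)) σ + coboundary (fun σ => ψ (σ, τ)) σ := h1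
  have e2 : coboundary (fun τ => (φ + ψ) (σ, τ)) τ =
      coboundary (fun τ => φ (σ, τ)) τ + coboundary (fun τ => ψ (σ, τ)) τ := h2
  simp only [tensorCoboundary, Pi.add_apply] at e1 e2 ⊢
  rw [e1, e2]
  ring

theorem tensorCoboundary_ne_zero {X : Type*} {φ : Simplex X × Simplex X → ℤ}
    {s : Simplex X × Simplex X} (h : tensorCoboundary φ s ≠ 0) :
    ∃ r, φ r ≠ 0 ∧ verts (grid r) ⊆ verts (grid s) ∧ r.1.1 + r.2.1 + 1 = s.1.1 + s.2.1 := by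
  by_cases h1 : coboundary (fun σ => φ (σ, s.2)) s.1 = 0
  · have h2 : coboundary (fun τ => φ (s.1, τ)) s.2 ≠ 0 := fun h2 =>
      h (by simp [tensorCoboundary, h1, h2])
    obtain ⟨ρ, hρ, hv, hd⟩ := coboundary_ne_zero h2
    refine ⟨(s.1, ρ), hρ, ?_, by simp only; omega⟩
    rw [verts_grid, verts_grid]
    exact Set.prod_mono le_rfl hv
  · obtain ⟨ρ, hρ, hv, hd⟩ := coboundary_ne_zero h1
    refine ⟨(ρ, s.2), hρ, ?_, by simp only; omega⟩
    rw [verts_grid, verts_grid]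
    exact Set.prod_mono hv le_rfl

section Tensor

variable (X : Type*) [MetricSpace X]

/-- `CX^k(X ⊗ X - δ(X))`: the `k`-cochains on `X ⊗ X` for which the coarse intersection of the
support with the diagonal of `(X × X)^∞` is coarsely contained in the part of the diagonal over
`δ(X) = {(x, x)}`. -/
def TensorCochain (k : ℤ) : AddSubgroup (Simplex X × Simplex X → ℤ) where
  carrier := {φ | (∀ s, φ s ≠ 0 → (s.1.1 : ℤ) + s.2.1 = k) ∧
    CoarseInterContained (tensorSupp φ) (diag Set.univ) (diag (Set.range fun x : X => (x, x)))}
  zero_mem' := ⟨fun _ h => absurd rfl h,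
    by rw [tensorSupp_zero]; exact coarseInterContained_empty _ _⟩
  add_mem' := by
    rintro a b ⟨ha1, ha2⟩ ⟨hb1, hb2⟩
    refine ⟨fun s h => ?_, (ha2.union hb2).mono (tensorSupp_add a b)⟩
    by_cases h0 : a s = 0
    · exact hb1 s fun h' => h (by simp [h0, h'])
    · exact ha1 s h0
  neg_mem' := by
    rintro a ⟨ha1, ha2⟩
    exact ⟨fun s h => ha1 s (by simpa using h), by rw [tensorSupp_neg]; exact ha2⟩

variable {X}

/-- The coboundary operator `d : CX^k(X ⊗ X - δ(X)) → CX^(k+1)(X ⊗ X - δ(X))`. -/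
def TensorCochain.d (k l : ℤ) (h : k + 1 = l) : TensorCochain X k →+ TensorCochain X l where
  toFun φ := ⟨tensorCoboundary φ.1, fun s hs => by
      obtain ⟨r, hr, -, hd⟩ := tensorCoboundary_ne_zero hs
      have := φ.2.1 r hr
      omega,
    exists_near φ.2.2 fun _ hσ => by
      obtain ⟨s, hs, rfl⟩ := hσ
      obtain ⟨r, hr, hv, -⟩ := tensorCoboundary_ne_zero hs
      exact ⟨_, ⟨r, hr, rfl⟩, hv⟩⟩
  map_zero' := Subtype.ext (by
    simpa using tensorCoboundary_add (0 : Simplex X × Simplex X → ℤ) 0)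
  map_add' _ _ := Subtype.ext (tensorCoboundary_add _ _)

end Tensor

/-! ## (Co)homology groups -/

/-- The homology `ker g / im f` at the middle term of `A → B → C`. -/
abbrev Homology {A B C : Type*} [AddCommGroup A] [AddCommGroup B] [AddCommGroup C]
    (f : A →+ B) (g : B →+ C) : Type _ :=
  g.ker ⧸ f.range.addSubgroupOf g.ker

section Groups

variable (X : Type*) [MetricSpace X]

/-- `HX_k(X)`, the coarse homology of `X`. -/
abbrev CoarseHomology (k : ℤ) : Type _ :=
  Homology (CoarseChain.d (X := X) (k + 1) k rfl)
    (CoarseChain.d (X := X) k (k - 1) (sub_add_cancel k 1))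

/-- `HX^k(X ⊗ X - δ(X))`. -/
abbrev TensorCohomology (k : ℤ) : Type _ :=
  Homology (TensorCochain.d (X := X) (k - 1) k (sub_add_cancel k 1))
    (TensorCochain.d (X := X) k (k + 1) rfl)

variable {X}

/-- `HX^k(X - A)`, the coarse cohomology of the complement of `A` in `X`. -/
abbrev ComplCohomology (A : Set X) (k : ℤ) : Type _ :=
  Homology (ComplCochain.d A (k - 1) k (sub_add_cancel k 1)) (ComplCochain.d A k (k + 1) rfl)

end Groups

/-! ## The slant product -/

/-- The slant product of a cochain on `X ⊗ X` and a chain on `X`, the linear extension of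
`(φ/σ)(τ) = φ(σ ⊗ τ)`. The sum is finite when `φ` represents a cochain of `X ⊗ X - δ(X)` and `c` is
a coarse chain. -/
noncomputable def slant {X : Type*} (φ : Simplex X × Simplex X → ℤ) (c : Simplex X → ℤ) :
    Simplex X → ℤ :=
  fun τ => ∑ᶠ σ, c σ * φ (σ, τ)

section Adjoint

variable {X : Type*}

open Classical in
/-- The boundary on finite chains. -/
noncomputable def finiteBoundary : (Simplex X →₀ ℤ) →+ (Simplex X →₀ ℤ) :=
  Finsupp.liftAddHom fun σ => match σ with
    | ⟨0, _⟩ => 0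
    | ⟨k + 1, s⟩ => ∑ i : Fin (k + 2),
        (Finsupp.singleAddHom (face i s)).comp (AddMonoidHom.mulLeft ((-1) ^ (i : ℕ)))

theorem finsupp_finite_insertVertex (b : Simplex X →₀ ℤ)
    {m : ℕ} (i : Fin (m + 2)) (τ : Fin (m + 1) → X) :
    (Function.support fun x => b (insertVertex i x τ)).Finite := by
  refine Set.Finite.of_finite_image (f := fun x => insertVertex i x τ)
    (b.hasFiniteSupport.subset ?_) ?_
  · rintro _ ⟨x, hx, rfl⟩
    exact hx
  · intro x _ y _ hxy
    have h1 : (i.insertNth (α := fun _ => X) x τ) = i.insertNth (α := fun _ => X) y τ := by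
      simpa [insertVertex] using hxy
    simpa using congrFun h1 i

theorem boundary_finsupp (b : Simplex X →₀ ℤ) : boundary (⇑b) = ⇑(finiteBoundary b) := by
  classical
  induction b using Finsupp.induction_linear with
  | zero => funext τ; simp [boundary]
  | add f g hf hg =>
    rw [map_add, Finsupp.coe_add, Finsupp.coe_add, ← hf, ← hg]
    funext τ
    simp only [boundary, Pi.add_apply]
    rw [← Finset.sum_add_distrib]
    refine Finset.sum_congr rfl fun i _ => ?_
    rw [finsum_add_distrib (finsupp_finite_insertVertex f i τ.2)
      (finsupp_finite_insertVertex g i τ.2), mul_add]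
  | single s a =>
    funext ⟨m, t⟩
    obtain ⟨_ | k, s⟩ := s
    · have h : ∀ (i : Fin (m + 2)) (x : X), (⟨0, s⟩ : Simplex X) ≠ insertVertex i x t := by
        intro i x h
        have := congrArg Sigma.fst h
        simp [insertVertex] at this
      simp [boundary, finiteBoundary, h]
    · simp only [boundary, finiteBoundary, Finsupp.liftAddHom_apply_single,
        AddMonoidHom.finsetSum_apply, Finsupp.coe_finsetSum, Finset.sum_apply,
        AddMonoidHom.comp_apply, AddMonoidHom.coe_mulLeft, Finsupp.singleAddHom_apply]
      by_cases hm : m = k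
      · subst hm
        refine Finset.sum_congr rfl fun i _ => ?_
        rw [finsum_eq_single _ (s i)]
        · by_cases ht : i.removeNth s = t
          · subst ht
            simp [face, insertVertex]
          · have h1 : (⟨m + 1, s⟩ : Simplex X) ≠ insertVertex i (s i) t := by
              intro h
              have h2 : s = i.insertNth (α := fun _ => X) (s i) t := by
                simpa [insertVertex] using h
              exact ht (by rw [h2]; simp)
            have h3 : face i s ≠ ⟨m, t⟩ := by
              intro h
              exact ht (by simpa [face] using h)
            simp [h1, h3]
        · intro x hx
          have h1 : (⟨m + 1, s⟩ : Simplex X) ≠ insertVertex i x t := by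
            intro h
            have h2 : s = i.insertNth (α := fun _ => X) x t := by
              simpa [insertVertex] using h
            exact hx (by rw [h2]; simp)
          simp [h1]
      · have h : ∀ (i : Fin (m + 2)) (x : X), (⟨k + 1, s⟩ : Simplex X) ≠ insertVertex i x t := by
          intro i x h
          have := congrArg Sigma.fst h
          simp [insertVertex] at this
          exact hm this.symm
        have h' : ∀ i : Fin (k + 2), face i s ≠ ⟨m, t⟩ := by
          intro i h
          exact hm (congrArg Sigma.fst h).symm
        simp [h, h']

theorem finsum_finsupp_mul (b : Simplex X →₀ ℤ) (g : Simplex X → ℤ) :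
    ∑ᶠ σ, b σ * g σ = Finsupp.liftAddHom (fun σ => AddMonoidHom.mulRight (g σ)) b := by
  rw [Finsupp.liftAddHom_apply, Finsupp.sum]
  refine finsum_eq_finsetSum_of_support_subset _ ?_
  intro σ hσ
  have : b σ ≠ 0 := fun h => hσ (by simp [h])
  simpa using this

theorem finsum_boundary_mul_finsupp (b : Simplex X →₀ ℤ) (g : Simplex X → ℤ) :
    ∑ᶠ σ, boundary (⇑b) σ * g σ = ∑ᶠ σ, b σ * coboundary g σ := by
  rw [boundary_finsupp, finsum_finsupp_mul, finsum_finsupp_mul, ← AddMonoidHom.comp_apply]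
  congr 1
  refine Finsupp.addHom_ext fun σ a => ?_
  obtain ⟨_ | k, s⟩ := σ
  · simp [finiteBoundary, coboundary]
  · simp only [AddMonoidHom.comp_apply, finiteBoundary, Finsupp.liftAddHom_apply_single,
      AddMonoidHom.finsetSum_apply, map_sum, AddMonoidHom.coe_mulLeft,
      Finsupp.singleAddHom_apply, AddMonoidHom.coe_mulRight, coboundary]
    rw [Finset.mul_sum]
    exact Finset.sum_congr rfl fun i _ => by ring

/-- The boundary of chains is adjoint to the coboundary of cochains. -/
theorem finsum_boundary_mul {b g : Simplex X → ℤ}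
    (hfin : {σ | b σ ≠ 0 ∧ ∃ ρ, verts ρ ⊆ verts σ ∧ g ρ ≠ 0}.Finite) :
    ∑ᶠ σ, boundary b σ * g σ = ∑ᶠ σ, b σ * coboundary g σ := by
  classical
  set S := {σ | b σ ≠ 0 ∧ ∃ ρ, verts ρ ⊆ verts σ ∧ g ρ ≠ 0} with hS
  let b' : Simplex X →₀ ℤ := Finsupp.onFinset hfin.toFinset (fun σ => if σ ∈ S then b σ else 0)
    (fun σ h => by
      rw [Set.Finite.mem_toFinset]
      by_contra h'
      exact h (if_neg h'))
  have hb' : ∀ σ, (∃ ρ, verts ρ ⊆ verts σ ∧ g ρ ≠ 0) → b' σ = b σ := by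
    intro σ h
    change (if σ ∈ S then b σ else 0) = b σ
    by_cases h0 : b σ = 0
    · simp [h0]
    · exact if_pos ⟨h0, h⟩
  have e1 : ∑ᶠ σ, boundary b σ * g σ = ∑ᶠ σ, boundary (⇑b') σ * g σ := by
    refine finsum_congr fun ρ => ?_
    by_cases h0 : g ρ = 0
    · simp [h0]
    · congr 1
      refine Finset.sum_congr rfl fun i _ => ?_
      congr 1
      refine finsum_congr fun x => (hb' _ ⟨ρ, verts_subset_insertVertex i x ρ.2, h0⟩).symm
  have e2 : ∑ᶠ σ, b σ * coboundary g σ = ∑ᶠ σ, b' σ * coboundary g σ := by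
    refine finsum_congr fun σ => ?_
    by_cases h0 : coboundary g σ = 0
    · simp [h0]
    · obtain ⟨ρ, hρ, hv, -⟩ := coboundary_ne_zero h0
      rw [hb' σ ⟨ρ, hv, hρ⟩]
  rw [e1, e2, finsum_boundary_mul_finsupp]

end Adjoint

section Slant

variable {X : Type*} [MetricSpace X]

theorem slant_finite {n k : ℤ} {φ : Simplex X × Simplex X → ℤ} (hφ : φ ∈ TensorCochain X n)
    {c : Simplex X → ℤ} (hc : c ∈ CoarseChain X k) (τ : Simplex X) :
    {σ | c σ ≠ 0 ∧ ∃ ρ, verts ρ ⊆ verts σ ∧ φ (ρ, τ) ≠ 0}.Finite := by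
  obtain ⟨R₁, hR₁⟩ := hc.2.2.exists_thickening ⟨_, τ.2 0, trivial, rfl⟩
  obtain ⟨R₂, hR₂⟩ := (Set.finite_range fun i => dist (τ.2 i) (τ.2 0)).bddAbove
  have hR₂' : ∀ v ∈ verts τ, dist v (τ.2 0) ≤ R₂ := by
    rintro _ ⟨i, rfl⟩
    exact hR₂ ⟨i, rfl⟩
  have hR₂0 : 0 ≤ R₂ := dist_nonneg.trans (hR₂' _ ⟨0, rfl⟩)
  obtain ⟨R, hR⟩ := (hφ.2 (max R₁ R₂ + 1)).exists_thickening
    ⟨_, _, ⟨τ.2 0, rfl⟩, rfl⟩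
  refine (hc.2.1 (closedBall (τ.2 0) (2 * R)) isBounded_closedBall).subset ?_
  rintro σ ⟨hσ, ρ, hv, hρ⟩
  refine ⟨hσ, ?_⟩
  obtain ⟨_, ⟨x, -, rfl⟩, hx⟩ := mem_thickening_iff.1 (hR₁ ⟨σ, hσ, rfl⟩)
  have hx' := dist_stab_const_le.1 hx.le
  have hM : (0 : ℝ) < max R₁ R₂ + 1 := by
    have := le_max_right R₁ R₂
    linarith
  have h1 : stab (grid (ρ, τ)) ∈ thickening R (diag (Set.range fun x : X => (x, x))) := by
    refine hR ⟨self_subset_thickening hM _ ⟨_, ⟨_, hρ, rfl⟩, rfl⟩,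
      mem_thickening_iff.2 ⟨_, ⟨(x, τ.2 0), trivial, rfl⟩, ?_⟩⟩
    refine lt_of_le_of_lt (dist_stab_const_le.2 ?_) (lt_add_one _)
    rw [verts_grid]
    rintro ⟨v, w⟩ ⟨hvρ, hw⟩
    rw [Prod.dist_eq]
    exact max_le_max (hx' v (hv hvρ)) (hR₂' w hw)
  obtain ⟨_, ⟨_, ⟨z, rfl⟩, rfl⟩, hz⟩ := mem_thickening_iff.1 h1
  have hz' := dist_stab_const_le.1 hz.le (ρ.2 0, τ.2 0) (by
    rw [verts_grid]
    exact ⟨⟨0, rfl⟩, ⟨0, rfl⟩⟩)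
  rw [Prod.dist_eq, max_le_iff] at hz'
  obtain ⟨i, hi⟩ := hv ⟨0, rfl⟩
  refine ⟨i, ?_⟩
  rw [hi, mem_closedBall]
  have := dist_triangle_right (ρ.2 0) (τ.2 0) z
  linarith [hz'.1, hz'.2]

theorem slant_support_finite {n k : ℤ} {φ : Simplex X × Simplex X → ℤ}
    (hφ : φ ∈ TensorCochain X n) {c : Simplex X → ℤ} (hc : c ∈ CoarseChain X k) (τ : Simplex X) :
    (Function.support fun σ => c σ * φ (σ, τ)).Finite :=
  (slant_finite hφ hc τ).subset fun σ hσ =>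
    ⟨left_ne_zero_of_mul hσ, σ, subset_rfl, right_ne_zero_of_mul hσ⟩

theorem slant_mem {n k m : ℤ} (h : k + m = n) {φ : Simplex X × Simplex X → ℤ}
    (hφ : φ ∈ TensorCochain X n) {c : Simplex X → ℤ} (hc : c ∈ CoarseChain X k) :
    slant φ c ∈ ComplCochain (Set.univ : Set X) m := by
  refine mem_complCochain_univ fun τ hτ => ?_
  by_contra hm
  refine hτ ?_
  have : ∀ σ, c σ * φ (σ, τ) = 0 := by
    intro σ
    by_contra h0
    have h1 := hc.1 σ (left_ne_zero_of_mul h0)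
    have h2 := hφ.1 _ (right_ne_zero_of_mul h0)
    simp only at h2
    omega
  simp [slant, this]

theorem slant_add_left {n k : ℤ} {φ ψ : Simplex X × Simplex X → ℤ} (hφ : φ ∈ TensorCochain X n)
    (hψ : ψ ∈ TensorCochain X n) {c : Simplex X → ℤ} (hc : c ∈ CoarseChain X k) :
    slant (φ + ψ) c = slant φ c + slant ψ c := by
  funext τ
  simp only [slant, Pi.add_apply, mul_add]
  exact finsum_add_distrib (slant_support_finite hφ hc τ) (slant_support_finite hψ hc τ)

theorem slant_add_right {n k : ℤ} {φ : Simplex X × Simplex X → ℤ} (hφ : φ ∈ TensorCochain X n)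
    {a b : Simplex X → ℤ} (ha : a ∈ CoarseChain X k) (hb : b ∈ CoarseChain X k) :
    slant φ (a + b) = slant φ a + slant φ b := by
  funext τ
  simp only [slant, Pi.add_apply, add_mul]
  exact finsum_add_distrib (slant_support_finite hφ ha τ) (slant_support_finite hφ hb τ)

/-- The Leibniz rule `(dφ)/c = φ/∂c + (-1)^k d(φ/c)` for a chain `c` of degree `k`. -/
theorem slant_coboundary {n k : ℤ} {φ : Simplex X × Simplex X → ℤ} (hφ : φ ∈ TensorCochain X n)
    {c : Simplex X → ℤ} (hc : c ∈ CoarseChain X k) :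
    slant (tensorCoboundary φ) c =
      slant φ (boundary c) + (-1 : ℤ) ^ k.toNat • coboundary (slant φ c) := by
  funext τ
  have hsign : ∀ σ, c σ * (-1 : ℤ) ^ σ.1 = (-1 : ℤ) ^ k.toNat * c σ := by
    intro σ
    by_cases h0 : c σ = 0
    · simp [h0]
    · have h1 : σ.1 = k.toNat := by
        have := hc.1 σ h0
        omega
      rw [h1, mul_comm]
  have hf1 : (Function.support fun σ => c σ * coboundary (fun σ => φ (σ, τ)) σ).Finite := by
    refine (slant_finite hφ hc τ).subset fun σ hσ => ⟨left_ne_zero_of_mul hσ, ?_⟩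
    obtain ⟨ρ, hρ, hv, -⟩ := coboundary_ne_zero (right_ne_zero_of_mul hσ)
    exact ⟨ρ, hv, hρ⟩
  have e0 : slant (tensorCoboundary φ) c τ =
      ∑ᶠ σ, (c σ * coboundary (fun σ => φ (σ, τ)) σ +
        (-1 : ℤ) ^ k.toNat * (c σ * coboundary (fun τ => φ (σ, τ)) τ)) := by
    refine finsum_congr fun σ => ?_
    simp only [tensorCoboundary]
    rw [mul_add, ← mul_assoc, hsign σ, mul_assoc]
  have e1 : slant φ (boundary c) τ = ∑ᶠ σ, c σ * coboundary (fun σ => φ (σ, τ)) σ :=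
    finsum_boundary_mul (slant_finite hφ hc τ)
  rw [e0, Pi.add_apply, e1, Pi.smul_apply, smul_eq_mul]
  obtain ⟨_ | l, t⟩ := τ
  · simp [coboundary]
  · have hf2 : ∀ j : Fin (l + 2), (Function.support fun σ =>
        (-1 : ℤ) ^ (j : ℕ) * (c σ * φ (σ, face j t))).Finite := fun j =>
      (slant_support_finite hφ hc (face j t)).subset fun σ hσ => right_ne_zero_of_mul hσ
    have e2 : ∀ σ, c σ * coboundary (fun τ => φ (σ, τ)) ⟨l + 1, t⟩ =
        ∑ j : Fin (l + 2), (-1 : ℤ) ^ (j : ℕ) * (c σ * φ (σ, face j t)) := by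
      intro σ
      simp only [coboundary, Finset.mul_sum]
      exact Finset.sum_congr rfl fun j _ => by ring
    have hf3 : (Function.support fun σ =>
        ∑ j : Fin (l + 2), (-1 : ℤ) ^ (j : ℕ) * (c σ * φ (σ, face j t))).Finite := by
      refine (Set.finite_iUnion hf2).subset fun σ hσ => ?_
      obtain ⟨j, -, hj⟩ := Finset.exists_ne_zero_of_sum_ne_zero hσ
      exact Set.mem_iUnion.2 ⟨j, hj⟩
    simp only [e2]
    rw [finsum_add_distrib hf1 (hf3.subset fun σ hσ => right_ne_zero_of_mul hσ),
      ← mul_finsum, finsum_sum_comm _ _ fun j _ => hf2 j]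
    congr 2
    refine Finset.sum_congr rfl fun j _ => ?_
    rw [← mul_finsum]
    rfl

/-- The slant product on cochains and chains. -/
noncomputable def slantHom (n k m : ℤ) (h : k + m = n) :
    TensorCochain X n →+ CoarseChain X k →+ ComplCochain (Set.univ : Set X) m :=
  AddMonoidHom.mk'
    (fun φ => AddMonoidHom.mk' (fun c => ⟨slant φ.1 c.1, slant_mem h φ.2 c.2⟩)
      fun a b => Subtype.ext (slant_add_right φ.2 a.2 b.2))
    fun φ ψ => AddMonoidHom.ext fun c => Subtype.ext (slant_add_left φ.2 ψ.2 c.2)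

end Slant
section Classes

variable {X : Type*} [MetricSpace X]

/-- The slant product of a cocycle and a cycle, as a cocycle. -/
noncomputable def slantCocycle (n k m : ℤ) (h : k + m = n) :
    (TensorCochain.d (X := X) n (n + 1) rfl).ker →+
      (CoarseChain.d (X := X) k (k - 1) (sub_add_cancel k 1)).ker →+
        (ComplCochain.d (Set.univ : Set X) m (m + 1) rfl).ker :=
  AddMonoidHom.mk'
    (fun φ => AddMonoidHom.mk'
      (fun c => ⟨slantHom n k m h φ.1 c.1, by
        have h1 : tensorCoboundary φ.1.1 = 0 := congrArg Subtype.val φ.2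
        have h2 : boundary c.1.1 = 0 := congrArg Subtype.val c.2
        have h3 := slant_coboundary φ.1.2 c.1.2
        rw [h1, h2] at h3
        have h4 : slant (0 : Simplex X × Simplex X → ℤ) c.1.1 = 0 := by
          funext τ; simp [slant]
        have h5 : slant φ.1.1 (0 : Simplex X → ℤ) = 0 := by funext τ; simp [slant]
        rw [h4, h5, zero_add, eq_comm, smul_eq_zero] at h3
        exact Subtype.ext (h3.resolve_left (pow_ne_zero _ (by norm_num)))⟩)
      fun a b => Subtype.ext (map_add (slantHom n k m h φ.1) a.1 b.1))
    fun φ ψ => AddMonoidHom.ext fun c => Subtype.ext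
      (congrArg (fun f => f c.1) (map_add (slantHom n k m h) φ.1 ψ.1))

/-- The slant product of a coboundary and a cycle is a coboundary. -/
theorem slantCocycle_left (n k m : ℤ) (h : k + m = n)
    {φ : (TensorCochain.d (X := X) n (n + 1) rfl).ker}
    (hφ : φ ∈ (TensorCochain.d (X := X) (n - 1) n (sub_add_cancel n 1)).range.addSubgroupOf
      (TensorCochain.d (X := X) n (n + 1) rfl).ker)
    (c : (CoarseChain.d (X := X) k (k - 1) (sub_add_cancel k 1)).ker) :
    slantCocycle n k m h φ c ∈
      (ComplCochain.d (Set.univ : Set X) (m - 1) m (sub_add_cancel m 1)).range.addSubgroupOf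
        (ComplCochain.d (Set.univ : Set X) m (m + 1) rfl).ker := by
  obtain ⟨η, hη⟩ := AddSubgroup.mem_addSubgroupOf.1 hφ
  refine AddSubgroup.mem_addSubgroupOf.2
    ⟨(-1 : ℤ) ^ k.toNat • slantHom (n - 1) k (m - 1) (by omega) η c.1, ?_⟩
  rw [map_zsmul]
  have h2 : boundary c.1.1 = 0 := congrArg Subtype.val c.2
  have h3 := slant_coboundary η.2 c.1.2
  have h5 : slant η.1 (0 : Simplex X → ℤ) = 0 := by funext τ; simp [slant]
  rw [h2, h5, zero_add] at h3
  have h6 : tensorCoboundary η.1 = φ.1.1 := congrArg Subtype.val hη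
  rw [h6] at h3
  exact Subtype.ext h3.symm

/-- The slant product of a cocycle and a boundary is a coboundary. -/
theorem slantCocycle_right (n k m : ℤ) (h : k + m = n)
    (φ : (TensorCochain.d (X := X) n (n + 1) rfl).ker)
    {c : (CoarseChain.d (X := X) k (k - 1) (sub_add_cancel k 1)).ker}
    (hc : c ∈ (CoarseChain.d (X := X) (k + 1) k rfl).range.addSubgroupOf
      (CoarseChain.d (X := X) k (k - 1) (sub_add_cancel k 1)).ker) :
    slantCocycle n k m h φ c ∈
      (ComplCochain.d (Set.univ : Set X) (m - 1) m (sub_add_cancel m 1)).range.addSubgroupOf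
        (ComplCochain.d (Set.univ : Set X) m (m + 1) rfl).ker := by
  obtain ⟨b, hb⟩ := AddSubgroup.mem_addSubgroupOf.1 hc
  refine AddSubgroup.mem_addSubgroupOf.2
    ⟨-((-1 : ℤ) ^ (k + 1).toNat • slantHom n (k + 1) (m - 1) (by omega) φ.1 b), ?_⟩
  rw [map_neg, map_zsmul]
  have h1 : tensorCoboundary φ.1.1 = 0 := congrArg Subtype.val φ.2
  have h3 := slant_coboundary φ.1.2 b.2
  have h4 : slant (0 : Simplex X × Simplex X → ℤ) b.1 = 0 := by funext τ; simp [slant]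
  have h6 : boundary b.1 = c.1.1 := congrArg Subtype.val hb
  rw [h1, h4, h6] at h3
  exact Subtype.ext (eq_neg_of_add_eq_zero_left h3.symm).symm

/-- The slant product `U/z` of classes `U ∈ HX^n(X ⊗ X - δ(X))` and `z ∈ HX_k(X)`. It lies in
`HX^m(X - X)`, where `m = n - k`. -/
noncomputable def slantClass (n k m : ℤ) (h : k + m = n) :
    TensorCohomology X n →+ CoarseHomology X k →+ ComplCohomology (Set.univ : Set X) m :=
  QuotientAddGroup.lift _
    (AddMonoidHom.mk'
      (fun φ => QuotientAddGroup.lift _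
        ((QuotientAddGroup.mk' _).comp (slantCocycle n k m h φ))
        fun _ hc => (QuotientAddGroup.eq_zero_iff _).2 (slantCocycle_right n k m h φ hc))
      fun φ ψ => QuotientAddGroup.addMonoidHom_ext _ <| AddMonoidHom.ext fun c =>
        congrArg (QuotientAddGroup.mk' ((ComplCochain.d (Set.univ : Set X) (m - 1) m
            (sub_add_cancel m 1)).range.addSubgroupOf
              (ComplCochain.d (Set.univ : Set X) m (m + 1) rfl).ker))
          (DFunLike.congr_fun (map_add (slantCocycle (X := X) n k m h) φ ψ) c))
    fun _ hφ => QuotientAddGroup.addMonoidHom_ext _ <| AddMonoidHom.ext fun c =>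
      (QuotientAddGroup.eq_zero_iff _).2 (slantCocycle_left n k m h hφ c)

/-- On representatives, the slant product of classes is the slant product of (co)chains. -/
theorem slantClass_mk (n k m : ℤ) (h : k + m = n)
    (φ : (TensorCochain.d (X := X) n (n + 1) rfl).ker)
    (c : (CoarseChain.d (X := X) k (k - 1) (sub_add_cancel k 1)).ker) :
    slantClass n k m h (QuotientAddGroup.mk φ) (QuotientAddGroup.mk c) =
        QuotientAddGroup.mk (slantCocycle n k m h φ c) ∧
      (slantCocycle n k m h φ c).1.1 = slant φ.1.1 c.1.1 :=
  ⟨rfl, rfl⟩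

variable (X)

/-- The `0`-cochain which takes the value `1` on every `0`-simplex. -/
def oneCochain (X : Type*) : Simplex X → ℤ := fun σ => if σ.1 = 0 then 1 else 0

/-- The constant function `1`, as a cocycle of `CX^0(X - X)`. -/
def oneCocycle : (ComplCochain.d (Set.univ : Set X) 0 (0 + 1) rfl).ker :=
  ⟨⟨oneCochain X, mem_complCochain_univ (k := 0) fun σ hσ => by
      by_contra h
      exact hσ (if_neg (by exact_mod_cast h))⟩, by
    refine Subtype.ext (funext fun σ => ?_)
    obtain ⟨_ | _ | k, s⟩ := σ
    · rfl
    · change ∑ i : Fin 2, (-1 : ℤ) ^ (i : ℕ) * oneCochain X (face i s) = 0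
      simp [Fin.sum_univ_two, oneCochain, face]
    · change ∑ i : Fin (k + 3), (-1 : ℤ) ^ (i : ℕ) * oneCochain X (face i s) = 0
      simp [oneCochain, face]⟩

/-- The class `1 ∈ HX^0(X - X)`. -/
def oneClass : ComplCohomology (Set.univ : Set X) 0 := QuotientAddGroup.mk (oneCocycle X)

variable {X}

/-! ## Orientation pairs and coarse Poincaré duality spaces -/

/-- Classes `U ∈ HX^n(X ⊗ X - δ(X))` and `z ∈ HX_n(X)` form an orientation pair if
`U/z = 1 ∈ HX^0(X - X)`. -/
def IsOrientationPair (n : ℤ) (U : TensorCohomology X n) (z : CoarseHomology X n) : Prop :=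
  slantClass n n 0 (add_zero n) U z = oneClass X

variable (X)

/-- The data exhibiting `X` as a coarse Poincaré duality space of formal dimension `n`: controlled
chain homotopy equivalences between the complex `C^*(X)` of all cochains and the complex
`CX_(n-*)(X)` of coarse chains. All indices range over `ℤ`; the groups vanish in negative
degrees. -/
structure CoarseDuality (n : ℤ) where
  /-- `p : C^k(X) → CX_(n-k)(X)` -/
  p : ∀ k m : ℤ, k + m = n → (Cochain X k →+ CoarseChain X m)
  /-- `q : CX_(n-k)(X) → C^k(X)` -/
  q : ∀ k m : ℤ, k + m = n → (CoarseChain X m →+ Cochain X k)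
  /-- `F : C^(k+1)(X) → C^k(X)` -/
  F : ∀ k : ℤ, Cochain X (k + 1) →+ Cochain X k
  /-- `G : CX_m(X) → CX_(m+1)(X)` -/
  G : ∀ m : ℤ, CoarseChain X m →+ CoarseChain X (m + 1)
  p_comm : ∀ (k m : ℤ) (h : k + (m + 1) = n) (h' : k + 1 + m = n) (φ : Cochain X k),
    CoarseChain.d (m + 1) m rfl (p k (m + 1) h φ) = p (k + 1) m h' (Cochain.d k (k + 1) rfl φ)
  q_comm : ∀ (k m : ℤ) (h : k + (m + 1) = n) (h' : k + 1 + m = n) (c : CoarseChain X (m + 1)),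
    Cochain.d k (k + 1) rfl (q k (m + 1) h c) = q (k + 1) m h' (CoarseChain.d (m + 1) m rfl c)
  homotopy_F : ∀ (k m : ℤ) (h : k + 1 + m = n) (φ : Cochain X (k + 1)),
    q (k + 1) m h (p (k + 1) m h φ) - φ =
      Cochain.d k (k + 1) rfl (F k φ) + F (k + 1) (Cochain.d (k + 1) (k + 1 + 1) rfl φ)
  homotopy_G : ∀ (k m : ℤ) (h : k + (m + 1) = n) (c : CoarseChain X (m + 1)),
    p k (m + 1) h (q k (m + 1) h c) - c =
      CoarseChain.d (m + 1 + 1) (m + 1) rfl (G (m + 1) c) + G m (CoarseChain.d (m + 1) m rfl c)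
  supp_p : ∀ (k m : ℤ) (h : k + m = n) (φ : Cochain X k),
    CoarselyContained (supp (p k m h φ).1) (supp φ.1)
  supp_F : ∀ (k : ℤ) (φ : Cochain X (k + 1)),
    CoarseInterContained (supp (F k φ).1) (diag Set.univ) (supp φ.1)
  supp_q : ∀ (k m : ℤ) (h : k + m = n) (c : CoarseChain X m),
    CoarseInterContained (supp (q k m h c).1) (diag Set.univ) (supp c.1)
  supp_G : ∀ (m : ℤ) (c : CoarseChain X m), CoarselyContained (supp (G m c).1) (supp c.1)

/-- `X` is a coarse PD(`n`) space. -/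
def IsCoarsePD (n : ℤ) : Prop := Nonempty (CoarseDuality X n)

end Classes

end CoarsePD

/-! From an orientation pair to duality: let `u` be a cocycle for the diagonal class and `c` a cycle
for the fundamental class. Up to signs, `p` is the cap product with `c` and `q` the slant product `a
↦ u/a`. Both are controlled, because `u` is concentrated near the diagonal and the simplices of `c`
have bounded size. The key fact is that multiplying `u` by a cochain `φ` in the first factor is
homotopic to multiplying it in the second (`tensorCoboundary_hom`); the homotopy evaluates `φ` on
joins of a front face of one simplex with a front face of the other. Slanting with `c` turns the
first product into `q p φ` and the second into `φ · (u/c) = φ`, so `q p ≃ 1` (`slant_capOp_sub`).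

For the other composition the same homotopy for `tswap u` is transposed to chains, which is possible
because it is local. Exchanging two sums (`finsum_slant_tswap`) identifies the transposed composite
with `p' q`, where `p'` is the cap product with the cochain on the back face. The constant `tswap u
/ c` turns out to be `(-1)^n`, so `p' q ≃ 1` (`capOp'_slant_sub`). Thus `q` has homotopy inverses on
both sides, and `p q ≃ 1` follows formally (`capOp_slantOp_sub`).

Conversely, given a duality, `c = p(1)` is a cycle and `q(c) = 1` exactly, since there are no
cochains of degree `-1`. The diagonal cocycle has to be `(σ, τ) ↦ ± q(σ)(τ)`. Two things are not
given: the support bounds for `q` depend on the chain, and `q` need not commute with infinite sums.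
Over a locally finite set of vertices both hold automatically, since `q` restricted to combinations
of countably many simplices is a homomorphism out of `ℤ^ℕ`. Such a homomorphism with countable range
cannot be non-zero on every unit vector (`false_of_countable_range`), which gives a uniform bound
(`exists_kernel_within`). If it maps to `ℤ` and kills the unit vectors, it is zero
(`eq_zero_of_map_single`), which gives the sum formula (`apply_eq_finsum`). Finally `q(c) = 1`
forces every point of `X` to be boundedly close to a vertex of `c`, and a retraction onto these
vertices extends the cocycle to all of `X`. -/

namespace CoarsePD

open Metric Bornology

/-! ## Simplices as lists -/

section Lists

variable {X : Type*}

/-- The list of vertices of a simplex. -/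
def toList (σ : Simplex X) : List X := List.ofFn σ.2

/-- A cochain as a function on lists, vanishing on the empty list. -/
def lext (φ : Simplex X → ℤ) (l : List X) : ℤ :=
  match List.equivSigmaTuple l with
  | ⟨0, _⟩ => 0
  | ⟨k + 1, s⟩ => φ ⟨k, s⟩

@[simp] theorem lext_nil (φ : Simplex X → ℤ) : lext φ [] = 0 := rfl

@[simp] theorem lext_toList (φ : Simplex X → ℤ) (σ : Simplex X) : lext φ (toList σ) = φ σ := by
  have h : List.equivSigmaTuple (toList σ) = ⟨σ.1 + 1, σ.2⟩ :=
    List.equivSigmaTuple.apply_symm_apply ⟨σ.1 + 1, σ.2⟩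
  simp only [lext, h]

theorem exists_toList {l : List X} (hl : l ≠ []) : ∃ σ : Simplex X, toList σ = l := by
  have h : List.equivSigmaTuple.symm (List.equivSigmaTuple l) = l :=
    List.equivSigmaTuple.symm_apply_apply l
  rcases h' : List.equivSigmaTuple l with ⟨_ | k, s⟩
  · rw [h'] at h
    exact absurd h.symm (by simpa [List.equivSigmaTuple] using hl)
  · rw [h'] at h
    exact ⟨⟨k, s⟩, h⟩

theorem exists_of_lext_ne_zero {φ : Simplex X → ℤ} {l : List X} (h : lext φ l ≠ 0) :
    ∃ σ : Simplex X, toList σ = l ∧ φ σ ≠ 0 := by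
  obtain ⟨σ, rfl⟩ := exists_toList (l := l) (by rintro rfl; exact h rfl)
  exact ⟨σ, rfl, by simpa using h⟩

theorem mem_toList {σ : Simplex X} {v : X} : v ∈ toList σ ↔ v ∈ verts σ := by
  rw [toList, List.mem_ofFn]
  rfl

@[simp] theorem length_toList (σ : Simplex X) : (toList σ).length = σ.1 + 1 := by
  simp [toList]

theorem toList_ne_nil (σ : Simplex X) : toList σ ≠ [] := fun h => by
  have := length_toList σ
  simp [h] at this

theorem lext_add (φ ψ : Simplex X → ℤ) : lext (φ + ψ) = lext φ + lext ψ := by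
  funext l
  rcases eq_or_ne l [] with rfl | h
  · simp
  · obtain ⟨σ, rfl⟩ := exists_toList h
    simp

/-- The augmented coboundary on functions of lists. -/
def lcob : (List X → ℤ) → List X → ℤ
  | _, [] => 0
  | φ, x :: l => φ l - lcob (fun m => φ (x :: m)) l

@[simp] theorem lcob_nil (φ : List X → ℤ) : lcob φ [] = 0 := rfl

theorem lcob_cons (φ : List X → ℤ) (x : X) (l : List X) :
    lcob φ (x :: l) = φ l - lcob (fun m => φ (x :: m)) l := rfl

/-- Omitting the first vertex gives the leading term of the recursion; omitting a later one shifts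
its index by one, whence the minus sign. -/
theorem lcob_ofFn {k : ℕ} (φ : List X → ℤ) (s : Fin (k + 1) → X) :
    lcob φ (List.ofFn s) = ∑ i : Fin (k + 1), (-1) ^ (i : ℕ) * φ (List.ofFn (i.removeNth s)) := by
  induction k generalizing φ with
  | zero => simp [lcob_cons]
  | succ k ih =>
    rw [List.ofFn_succ, lcob_cons, ih, Fin.sum_univ_succ (n := k + 1), sub_eq_add_neg,
      ← Finset.sum_neg_distrib]
    congr 1
    · simp [Fin.removeNth_zero, Fin.tail_def]
    · refine Finset.sum_congr rfl fun i _ => ?_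
      have h : List.ofFn (i.succ.removeNth s) =
          s 0 :: List.ofFn (i.removeNth fun j => s j.succ) := by
        rw [List.ofFn_succ]
        congr 1
        simp only [Fin.removeNth, Fin.succ_succAbove_succ]
        rfl
      rw [h, Fin.val_succ, pow_succ]
      ring

/-- The condition `f [] = 0` undoes the augmentation: on a one-vertex list `lcob f` returns `f []`,
while `coboundary` vanishes on `0`-simplices. -/
theorem coboundary_eq_lcob {φ : Simplex X → ℤ} {f : List X → ℤ} (h0 : f [] = 0)
    (h : ∀ σ, f (toList σ) = φ σ) (σ : Simplex X) : coboundary φ σ = lcob f (toList σ) := by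
  obtain ⟨k, s⟩ := σ
  simp only [toList]
  rw [lcob_ofFn]
  cases k with
  | zero => simp [coboundary, h0]
  | succ k =>
    refine Finset.sum_congr rfl fun i _ => ?_
    rw [← h]
    rfl

theorem lcob_lext (φ : Simplex X → ℤ) : lcob (lext φ) = lext (coboundary φ) := by
  funext l
  rcases eq_or_ne l [] with rfl | h
  · rfl
  · obtain ⟨σ, rfl⟩ := exists_toList h
    rw [lext_toList, coboundary_eq_lcob (lext_nil φ) (lext_toList φ)]

theorem lcob_add (φ ψ : List X → ℤ) (l : List X) :
    lcob (fun m => φ m + ψ m) l = lcob φ l + lcob ψ l := by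
  induction l generalizing φ ψ with
  | nil => simp
  | cons x l ih => simp only [lcob_cons, ih]; ring

theorem lcob_const_mul (a : ℤ) (φ : List X → ℤ) (l : List X) :
    lcob (fun m => a * φ m) l = a * lcob φ l := by
  induction l generalizing φ with
  | nil => simp
  | cons x l ih => simp only [lcob_cons, ih]; ring

/-- A factor depending multiplicatively on the length only. -/
theorem lcob_pow_mul {a : ℤ} (ha : a * a = 1) (φ : List X → ℤ) (l : List X) :
    lcob (fun m => a ^ m.length * φ m) l = a * a ^ l.length * lcob φ l := by
  induction l generalizing φ with
  | nil => simp
  | cons x l ih =>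
    have e : (fun m : List X => a ^ (x :: m).length * φ (x :: m)) =
        fun m => a * (a ^ m.length * φ (x :: m)) := by
      funext m; rw [List.length_cons, pow_succ]; ring
    rw [lcob_cons, lcob_cons, e, lcob_const_mul, ih, List.length_cons, pow_succ]
    linear_combination (-(a ^ l.length * φ l)) * ha

/-- The omitted vertex lies in `a` or in `b`, and positions in `b` are shifted by the length of `a`.
-/
theorem lcob_append (φ : List X → ℤ) (a b : List X) :
    lcob φ (a ++ b) = lcob (fun m => φ (m ++ b)) a +
      (-1) ^ a.length * lcob (fun m => φ (a ++ m)) b := by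
  induction a generalizing φ with
  | nil => simp
  | cons x a ih =>
    simp only [List.cons_append, lcob_cons, ih, List.length_cons, pow_succ]
    ring

/-- The sum over the splittings of a list into an initial and a final segment with one common
element. -/
def lsplit : (List X → List X → ℤ) → List X → ℤ
  | _, [] => 0
  | Ψ, x :: l => Ψ [x] (x :: l) + lsplit (fun a b => Ψ (x :: a) b) l

@[simp] theorem lsplit_nil (Ψ : List X → List X → ℤ) : lsplit Ψ [] = 0 := rfl

theorem lsplit_cons (Ψ : List X → List X → ℤ) (x : X) (l : List X) :
    lsplit Ψ (x :: l) = Ψ [x] (x :: l) + lsplit (fun a b => Ψ (x :: a) b) l := rfl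

theorem lsplit_add (Φ Ψ : List X → List X → ℤ) (l : List X) :
    lsplit (fun a b => Φ a b + Ψ a b) l = lsplit Φ l + lsplit Ψ l := by
  induction l generalizing Φ Ψ with
  | nil => simp
  | cons x l ih => simp only [lsplit_cons, ih]; ring

theorem lsplit_const_mul (r : ℤ) (Ψ : List X → List X → ℤ) (l : List X) :
    lsplit (fun a b => r * Ψ a b) l = r * lsplit Ψ l := by
  induction l generalizing Ψ with
  | nil => simp
  | cons x l ih => simp only [lsplit_cons, ih]; ring

theorem lsplit_sub (Φ Ψ : List X → List X → ℤ) (l : List X) :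
    lsplit (fun a b => Φ a b - Ψ a b) l = lsplit Φ l - lsplit Ψ l := by
  have h := lsplit_add Φ (fun a b => (-1) * Ψ a b) l
  rw [lsplit_const_mul] at h
  rw [sub_eq_add_neg, ← neg_one_mul, ← h]
  congr 1
  funext a b
  ring

theorem lsplit_neg (Ψ : List X → List X → ℤ) (l : List X) :
    lsplit (fun a b => -Ψ a b) l = -lsplit Ψ l := by
  simpa using lsplit_const_mul (-1) Ψ l

theorem lsplit_congr {Φ Ψ : List X → List X → ℤ} {l : List X}
    (h : ∀ a b, a.length + b.length = l.length + 1 → a ⊆ l → b ⊆ l → a ≠ [] → b ≠ [] →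
      Φ a b = Ψ a b) : lsplit Φ l = lsplit Ψ l := by
  induction l generalizing Φ Ψ with
  | nil => rfl
  | cons x l ih =>
    rw [lsplit_cons, lsplit_cons, h [x] (x :: l) (by simp; omega) (by simp) (by simp) (by simp)
      (by simp)]
    congr 1
    exact ih fun a b h1 h2 h3 _ h5 => h _ _ (by simp; omega)
      (List.cons_subset_cons x h2) (List.subset_cons_of_subset x h3) (by simp) h5

theorem exists_of_lsplit_ne_zero {Ψ : List X → List X → ℤ} {l : List X} (h : lsplit Ψ l ≠ 0) :
    ∃ a b, Ψ a b ≠ 0 ∧ a.length + b.length = l.length + 1 ∧ a ⊆ l ∧ b ⊆ l := by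
  by_contra! h'
  refine h ((lsplit_congr (Ψ := fun _ _ => 0) fun a b h1 h2 h3 _ _ => ?_).trans ?_)
  · by_contra h0
    exact h' a b h0 h1 h2 h3
  · simpa using lsplit_const_mul 0 (fun _ _ => 0) l

theorem lcob_lsplit_comm (Ψ : List X → List X → List X → ℤ) (l m : List X) :
    lcob (fun n => lsplit (fun a b => Ψ a b n) l) m = lsplit (fun a b => lcob (Ψ a b) m) l := by
  induction l generalizing Ψ with
  | nil =>
    simpa using lcob_const_mul 0 (fun _ => 0) m
  | cons x l ih => simp only [lsplit_cons, lcob_add, ih]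

/-- The Leibniz rule for splittings. -/
theorem lcob_lsplit {Ψ : List X → List X → ℤ} (h : ∀ a, Ψ a [] = 0) (l : List X) :
    lcob (lsplit Ψ) l = lsplit (fun a b => lcob (fun m => Ψ m b) a) l -
      lsplit (fun a b => (-1) ^ a.length * lcob (Ψ a) b) l - Ψ [] l := by
  -- As a sum over splittings, omitting the common vertex from the end of `a` cancels against
  -- omitting it from the start of `b` in the preceding splitting. Of the two extreme omissions, the
  -- one emptying `a` leaves `Ψ [] l`, and the one emptying `b` vanishes by `h`.
  induction l generalizing Ψ with
  | nil => simp [h]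
  | cons x l ih =>
    have e1 : (fun m => lsplit Ψ (x :: m)) =
        fun m => Ψ [x] (x :: m) + lsplit (fun a b => Ψ (x :: a) b) m := rfl
    have e2 : (fun a b => (-1 : ℤ) ^ (x :: a).length * lcob (Ψ (x :: a)) b) =
        fun a b => (-1) * ((-1) ^ a.length * lcob (Ψ (x :: a)) b) := by
      funext a b; rw [List.length_cons, pow_succ]; ring
    rw [lcob_cons, e1, lcob_add, ih (fun a => h _), lsplit_cons, lsplit_cons, e2,
      lsplit_const_mul]
    simp only [lcob_cons, lsplit_sub, lcob_nil, List.length_singleton]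
    ring

end Lists

/-! ### Cup products, and the join homotopy on `X ⊗ X`. -/

section Products

variable {X : Type*}

/-- The join of initial segments: a chain homotopy between the two ways of multiplying a cochain
`u` of `X ⊗ X` by a cochain `φ` of one of the factors. -/
def lhom (φ : List X → ℤ) (u : List X → List X → ℤ) (l m : List X) : ℤ :=
  lsplit (fun a b => lsplit (fun a' b' =>
    (-1) ^ (b.length * (a'.length + 1)) * (φ (a ++ a') * u b b')) m) l

theorem neg_one_pow_mul_self (n : ℕ) : (-1 : ℤ) ^ n * (-1) ^ n = 1 := by
  rw [← mul_pow]; norm_num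

theorem lcob_lhom_left {φ : List X → ℤ} {u : List X → List X → ℤ} (h2 : ∀ b, u [] b = 0)
    (l m : List X) :
    lcob (fun x => lhom φ u x m) l =
      lsplit (fun a b => lsplit (fun a' b' => (-1) ^ (b.length * (a'.length + 1)) *
        (lcob (fun x => φ (x ++ a')) a * u b b')) m) l -
      lsplit (fun a b => lsplit (fun a' b' => (-1) ^ (b.length * (a'.length + 1)) *
        ((-1) ^ a.length * (-1) ^ (a'.length + 1) * φ (a ++ a') * lcob (fun x => u x b') b)) m) l -
      lsplit (fun a' b' => (-1) ^ (l.length * (a'.length + 1)) * (φ a' * u l b')) m := by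
  have h3 : ∀ a : List X, lsplit (fun a' b' =>
      (-1) ^ (([] : List X).length * (a'.length + 1)) * (φ (a ++ a') * u [] b')) m = 0 := by
    intro a
    rw [lsplit_congr (Ψ := fun _ _ => 0 * 0) fun a' b' _ _ _ _ _ => by rw [h2]; ring,
      lsplit_const_mul, zero_mul]
  refine (lcob_lsplit h3 l).trans ?_
  congr 1
  congr 1
  · refine lsplit_congr fun a b _ _ _ _ _ => ?_
    rw [lcob_lsplit_comm]
    refine lsplit_congr fun a' b' _ _ _ _ _ => ?_
    rw [lcob_const_mul]
    congr 1
    simp only [mul_comm _ (u b b')]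
    rw [lcob_const_mul]
  · refine lsplit_congr fun a b _ _ _ _ _ => ?_
    rw [lcob_lsplit_comm, ← lsplit_const_mul]
    refine lsplit_congr fun a' b' _ _ _ _ _ => ?_
    simp only [mul_comm _ (a'.length + 1), pow_mul]
    rw [lcob_pow_mul (neg_one_pow_mul_self _), lcob_const_mul]
    ring

theorem lcob_lhom_right {φ : List X → ℤ} {u : List X → List X → ℤ} (h1 : ∀ b, u b [] = 0)
    (l m : List X) :
    lcob (lhom φ u l) m =
      lsplit (fun a b => lsplit (fun a' b' => (-1) ^ (b.length * (a'.length + 1)) *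
        ((-1) ^ b.length * lcob (fun x => φ (a ++ x)) a' * u b b')) m) l -
      lsplit (fun a b => lsplit (fun a' b' => (-1) ^ (b.length * (a'.length + 1)) *
        ((-1) ^ a'.length * φ (a ++ a') * lcob (u b) b')) m) l -
      lsplit (fun a b => (-1) ^ b.length * (φ a * u b m)) l := by
  rw [← lsplit_sub, ← lsplit_sub]
  refine (lcob_lsplit_comm (fun a b n => lsplit (fun a' b' =>
    (-1) ^ (b.length * (a'.length + 1)) * (φ (a ++ a') * u b b')) n) l m).trans ?_
  refine lsplit_congr fun a b _ _ _ _ _ => ?_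
  refine (lcob_lsplit (fun a' => by rw [h1]; ring) m).trans ?_
  congr 1
  · congr 1
    · refine lsplit_congr fun a' b' _ _ _ _ _ => ?_
      have e : (fun n : List X => (-1 : ℤ) ^ (b.length * (n.length + 1)) * (φ (a ++ n) * u b b')) =
          fun n => ((-1) ^ b.length * u b b') * (((-1) ^ b.length) ^ n.length * φ (a ++ n)) := by
        funext n; rw [pow_mul, pow_succ]; ring
      rw [e, lcob_const_mul, lcob_pow_mul (neg_one_pow_mul_self _), pow_mul, pow_succ]
      ring
    · refine lsplit_congr fun a' b' _ _ _ _ _ => ?_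
      rw [lcob_const_mul, lcob_const_mul]
      ring
  · simp

/-- By `lcob_append`, the terms in which the join `a ++ a'` is differentiated assemble to `lcob φ`,
and those in which `u` is differentiated cancel because of the cocycle condition `hu`. The end terms
of the two Leibniz rules are the two products of `φ` with `u`. A list is one longer than the
dimension of its simplex, so `-(-1)^l.length` is the usual tensor sign. -/
theorem lcob_lhom {φ : List X → ℤ} {u : List X → List X → ℤ} (h1 : ∀ b, u b [] = 0)
    (h2 : ∀ b, u [] b = 0)
    (hu : ∀ b b', lcob (fun x => u x b') b = (-1) ^ b.length * lcob (u b) b') (l m : List X) :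
    lcob (fun x => lhom φ u x m) l - (-1) ^ l.length * lcob (lhom φ u l) m =
      lhom (lcob φ) u l m - lsplit (fun a b => (-1) ^ a.length * (φ a * u b m)) l -
      lsplit (fun a' b' => (-1) ^ (l.length * (a'.length + 1)) * (φ a' * u l b')) m := by
  have hs : ∀ a b : List X, a.length + b.length = l.length + 1 →
      (-1 : ℤ) ^ l.length = -((-1) ^ a.length * (-1) ^ b.length) := by
    intro a b h
    rw [← pow_add, h, pow_succ]
    ring
  rw [lcob_lhom_left h2, lcob_lhom_right h1, mul_sub, mul_sub, ← lsplit_const_mul,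
    ← lsplit_const_mul, ← lsplit_const_mul]
  have e : lsplit (fun a b => (-1) ^ a.length * (φ a * u b m)) l =
      - lsplit (fun a b => (-1) ^ l.length * ((-1) ^ b.length * (φ a * u b m))) l := by
    rw [← lsplit_neg]
    refine lsplit_congr fun a b h _ _ _ _ => ?_
    rw [hs a b h]
    linear_combination (-(-1) ^ a.length * φ a * u b m) * neg_one_pow_mul_self b.length
  rw [e]
  have e' : lhom (lcob φ) u l m =
      lsplit (fun a b => lsplit (fun a' b' => (-1) ^ (b.length * (a'.length + 1)) *
        (lcob (fun x => φ (x ++ a')) a * u b b')) m) l -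
      lsplit (fun a b => lsplit (fun a' b' => (-1) ^ (b.length * (a'.length + 1)) *
        ((-1) ^ a.length * (-1) ^ (a'.length + 1) * φ (a ++ a') * lcob (fun x => u x b') b)) m) l -
      (lsplit (fun a b => (-1) ^ l.length * lsplit (fun a' b' =>
        (-1) ^ (b.length * (a'.length + 1)) *
        ((-1) ^ b.length * lcob (fun x => φ (a ++ x)) a' * u b b')) m) l -
      lsplit (fun a b => (-1) ^ l.length * lsplit (fun a' b' =>
        (-1) ^ (b.length * (a'.length + 1)) *
        ((-1) ^ a'.length * φ (a ++ a') * lcob (u b) b')) m) l) := by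
    rw [← lsplit_sub, ← lsplit_sub, ← lsplit_sub]
    refine lsplit_congr fun a b h _ _ _ _ => ?_
    rw [← lsplit_const_mul, ← lsplit_const_mul, ← lsplit_sub, ← lsplit_sub, ← lsplit_sub]
    refine lsplit_congr fun a' b' h' _ _ _ _ => ?_
    rw [lcob_append, hu b b', hs a b h, pow_succ]
    linear_combination (-(-1) ^ (b.length * (a'.length + 1)) * (-1) ^ a.length *
      lcob (fun x => φ (a ++ x)) a' * u b b') * neg_one_pow_mul_self b.length
  rw [e']
  ring

/-- Multiplication of a (co)chain by a function of the dimension. -/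
def sg (ε : ℕ → ℤ) (φ : Simplex X → ℤ) : Simplex X → ℤ := fun σ => ε σ.1 * φ σ

theorem lext_sg (ε : ℕ → ℤ) (φ : Simplex X → ℤ) (l : List X) :
    lext (sg ε φ) l = ε (l.length - 1) * lext φ l := by
  rcases eq_or_ne l [] with rfl | h
  · simp
  · obtain ⟨σ, rfl⟩ := exists_toList h
    simp [sg]

/-- The truncated subtraction is harmless, since the coboundary vanishes in dimension `0`. -/
theorem coboundary_sg (ε : ℕ → ℤ) (φ : Simplex X → ℤ) :
    coboundary (sg ε φ) = sg (fun k => ε (k - 1)) (coboundary φ) := by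
  funext ⟨k, s⟩
  cases k with
  | zero => simp [coboundary, sg]
  | succ k =>
    simp only [coboundary, sg, face, Finset.mul_sum, Nat.add_sub_cancel]
    exact Finset.sum_congr rfl fun i _ => by ring

theorem sg_sg (ε η : ℕ → ℤ) (φ : Simplex X → ℤ) :
    sg ε (sg η φ) = sg (fun k => ε k * η k) φ := by
  funext σ; simp [sg, mul_assoc]

/-- The cup product of cochains, summed over all degrees. -/
def cup (φ ψ : Simplex X → ℤ) : Simplex X → ℤ := fun σ =>
  lsplit (fun a b => lext φ a * lext ψ b) (toList σ)

/-- This is `lcob_lsplit` for a product; the shift between length and dimension turns its sign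
`-(-1)^a.length` into `(-1)^k`. -/
theorem coboundary_cup (φ ψ : Simplex X → ℤ) :
    coboundary (cup φ ψ) =
      cup (coboundary φ) ψ + cup (sg (fun k => (-1) ^ k) φ) (coboundary ψ) := by
  funext σ
  rw [coboundary_eq_lcob (φ := cup φ ψ) (f := lsplit fun a b => lext φ a * lext ψ b) rfl (fun _ => rfl),
    lcob_lsplit (by simp)]
  simp only [cup, Pi.add_apply, lext_nil, zero_mul, sub_zero, ← lcob_lext]
  rw [sub_eq_add_neg]
  congr 1
  · refine lsplit_congr fun a b _ _ _ _ _ => ?_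
    simp only [mul_comm _ (lext ψ b)]
    rw [lcob_const_mul]
  · rw [← lsplit_neg]
    refine lsplit_congr fun a b _ _ _ ha _ => ?_
    obtain ⟨k, hk⟩ := Nat.exists_eq_succ_of_ne_zero (mt List.length_eq_zero_iff.1 ha)
    rw [lcob_const_mul, lext_sg, hk, Nat.succ_sub_one, pow_succ]
    ring

theorem cup_add_right (φ ψ ψ' : Simplex X → ℤ) : cup φ (ψ + ψ') = cup φ ψ + cup φ ψ' := by
  funext σ
  simp only [cup, Pi.add_apply, ← lsplit_add, lext_add, mul_add]

theorem cup_add_left (φ φ' ψ : Simplex X → ℤ) : cup (φ + φ') ψ = cup φ ψ + cup φ' ψ := by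
  funext σ
  simp only [cup, Pi.add_apply, ← lsplit_add, lext_add, add_mul]

theorem exists_of_cup_ne_zero {φ ψ : Simplex X → ℤ} {σ : Simplex X} (h : cup φ ψ σ ≠ 0) :
    ∃ α β, φ α ≠ 0 ∧ ψ β ≠ 0 ∧ verts α ⊆ verts σ ∧ verts β ⊆ verts σ ∧ α.1 + β.1 = σ.1 := by
  obtain ⟨a, b, h0, hl, ha, hb⟩ := exists_of_lsplit_ne_zero h
  obtain ⟨α, rfl, hα⟩ := exists_of_lext_ne_zero (left_ne_zero_of_mul h0)
  obtain ⟨β, rfl, hβ⟩ := exists_of_lext_ne_zero (right_ne_zero_of_mul h0)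
  simp only [length_toList] at hl
  exact ⟨α, β, hα, hβ, fun v hv => mem_toList.1 (ha (mem_toList.2 hv)),
    fun v hv => mem_toList.1 (hb (mem_toList.2 hv)), by omega⟩

theorem lsplit_mul_one {f : List X → ℤ} {g : List X → ℤ} {e : ℤ}
    (hg : ∀ x, g [x] = e) (hg' : ∀ l, 2 ≤ l.length → g l = 0) {l : List X} (hl : l ≠ []) :
    lsplit (fun a b => f a * g b) l = f l * e := by
  induction l generalizing f with
  | nil => exact absurd rfl hl
  | cons x l ih =>
    rw [lsplit_cons]
    rcases eq_or_ne l [] with rfl | h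
    · simp [hg]
    · rw [hg' (x :: l) (by
        have := List.length_pos_iff.2 h
        rw [List.length_cons]; omega), mul_zero, zero_add]
      exact ih (f := fun a => f (x :: a)) h

/-- Only the splitting whose back face is the last vertex contributes. It is applied to the slant
product `u/c`, which lives in degree `0`. -/
theorem cup_const (φ : Simplex X → ℤ) (e : ℤ) (ψ : Simplex X → ℤ) (h0 : ∀ x, ψ ⟨0, x⟩ = e)
    (h1 : ∀ k s, ψ ⟨k + 1, s⟩ = 0) : cup φ ψ = fun σ => φ σ * e := by
  funext σ
  refine (lsplit_mul_one (f := lext φ) (e := e) (fun x => ?_) (fun l hl => ?_)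
    (toList_ne_nil σ)).trans (by rw [lext_toList])
  · obtain ⟨⟨k, s⟩, hs⟩ := exists_toList (l := [x]) (by simp)
    have h := length_toList (⟨k, s⟩ : Simplex X)
    rw [hs] at h
    obtain rfl : k = 0 := by simpa using h.symm
    rw [← hs, lext_toList, h0]
  · obtain ⟨⟨k, s⟩, hs⟩ := exists_toList (l := l) (by rintro rfl; simp at hl)
    have h := length_toList (⟨k, s⟩ : Simplex X)
    rw [hs] at h
    obtain ⟨j, rfl⟩ : ∃ j, k = j + 1 := ⟨k - 1, by simp only at h; omega⟩
    rw [← hs, lext_toList, h1]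

/-- A cochain of `X ⊗ X` as a function on pairs of lists. -/
def lext₂ (u : Simplex X × Simplex X → ℤ) (a b : List X) : ℤ :=
  lext (fun σ => lext (fun τ => u (σ, τ)) b) a

theorem lext₂_nil_left (u : Simplex X × Simplex X → ℤ) (b : List X) : lext₂ u [] b = 0 := rfl

theorem lext₂_nil_right (u : Simplex X × Simplex X → ℤ) (a : List X) : lext₂ u a [] = 0 := by
  rcases eq_or_ne a [] with rfl | h
  · rfl
  · obtain ⟨σ, rfl⟩ := exists_toList h
    simp [lext₂]

theorem lext₂_toList (u : Simplex X × Simplex X → ℤ) (σ τ : Simplex X) :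
    lext₂ u (toList σ) (toList τ) = u (σ, τ) := by simp [lext₂]

/-- The cocycle condition on `u` in the form required by `lcob_lhom`. Empty lists cause no trouble
because `lext₂` vanishes on them. -/
theorem lcob_lext₂ {u : Simplex X × Simplex X → ℤ} (hu : tensorCoboundary u = 0)
    (a b : List X) :
    lcob (fun x => lext₂ u x b) a = (-1) ^ a.length * lcob (lext₂ u a) b := by
  have hz : ∀ l : List X, lcob (fun _ : List X => (0 : ℤ)) l = 0 := fun l => by
    simpa using lcob_const_mul 0 (fun _ => 0) l
  rcases eq_or_ne a [] with rfl | ha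
  · change 0 = _ * lcob (fun _ => 0) b
    rw [hz, mul_zero]
  rcases eq_or_ne b [] with rfl | hb
  · simp only [lext₂_nil_right, hz, lcob_nil, mul_zero]
  obtain ⟨σ, rfl⟩ := exists_toList ha
  obtain ⟨τ, rfl⟩ := exists_toList hb
  have h := congrFun hu (σ, τ)
  simp only [tensorCoboundary, Pi.zero_apply] at h
  rw [coboundary_eq_lcob (f := fun x => lext₂ u x (toList τ)) (lext₂_nil_left u _)
      (fun ρ => lext₂_toList u ρ τ),
    coboundary_eq_lcob (f := lext₂ u (toList σ)) (lext₂_nil_right u _)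
      (fun ρ => lext₂_toList u σ ρ)] at h
  rw [length_toList, pow_succ]
  linear_combination h

/-- The homotopy `lhom` for cochains. -/
def hom (φ : Simplex X → ℤ) (u : Simplex X × Simplex X → ℤ) : Simplex X × Simplex X → ℤ :=
  fun s => lhom (lext φ) (lext₂ u) (toList s.1) (toList s.2)

theorem exists_of_lext₂_ne_zero {u : Simplex X × Simplex X → ℤ} {a b : List X}
    (h : lext₂ u a b ≠ 0) : ∃ α β, toList α = a ∧ toList β = b ∧ u (α, β) ≠ 0 := by
  obtain ⟨α, rfl, hα⟩ := exists_of_lext_ne_zero h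
  obtain ⟨β, rfl, hβ⟩ := exists_of_lext_ne_zero hα
  exact ⟨α, β, rfl, rfl, hβ⟩

/-- Each of the two splittings repeats a vertex, and the two front parts merge into one simplex; so
`hom` of a `k`-cochain and an `n`-cochain has degree `k + n - 1`. The inclusions of vertices are the
source of every support estimate for `hom`. -/
theorem exists_of_hom_ne_zero {φ : Simplex X → ℤ} {u : Simplex X × Simplex X → ℤ}
    {s : Simplex X × Simplex X} (h : hom φ u s ≠ 0) :
    ∃ ρ α β, φ ρ ≠ 0 ∧ u (α, β) ≠ 0 ∧ verts ρ ⊆ verts s.1 ∪ verts s.2 ∧ verts α ⊆ verts s.1 ∧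
      verts β ⊆ verts s.2 ∧ ρ.1 + α.1 + β.1 = s.1.1 + s.2.1 + 1 := by
  obtain ⟨a, b, h1, hl1, ha, hb⟩ := exists_of_lsplit_ne_zero h
  obtain ⟨a', b', h2, hl2, ha', hb'⟩ := exists_of_lsplit_ne_zero h1
  have h3 := right_ne_zero_of_mul h2
  obtain ⟨ρ, hρ, hρ0⟩ := exists_of_lext_ne_zero (left_ne_zero_of_mul h3)
  obtain ⟨α, β, rfl, rfl, hu⟩ := exists_of_lext₂_ne_zero (right_ne_zero_of_mul h3)
  have hl := congrArg List.length hρ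
  simp only [length_toList, List.length_append] at hl hl1 hl2
  refine ⟨ρ, α, β, hρ0, hu, fun v hv => ?_, fun v hv => mem_toList.1 (hb (mem_toList.2 hv)),
    fun v hv => mem_toList.1 (hb' (mem_toList.2 hv)), by omega⟩
  rw [← mem_toList, hρ, List.mem_append] at hv
  exact hv.imp (fun h => mem_toList.1 (ha h)) (fun h => mem_toList.1 (ha' h))

theorem hom_add (φ ψ : Simplex X → ℤ) (u : Simplex X × Simplex X → ℤ) :
    hom (φ + ψ) u = hom φ u + hom ψ u := by
  funext s
  simp only [hom, lhom, lext_add, Pi.add_apply, add_mul, mul_add, lsplit_add]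

/-- The cross product with a cochain of the second factor, with the sign it has in
`tensorCoboundary_hom`. -/
def cupSnd (φ : Simplex X → ℤ) (u : Simplex X × Simplex X → ℤ) : Simplex X × Simplex X → ℤ :=
  fun s => cup (sg (fun k => (-1) ^ ((s.1.1 + 1) * k)) φ) (fun τ => u (s.1, τ)) s.2

/-- This translates `lcob_lhom` to simplices: multiplications of a cocycle `u` by `φ` in the first
and in the second factor are chain homotopic via `hom`. -/
theorem tensorCoboundary_hom (φ : Simplex X → ℤ) {u : Simplex X × Simplex X → ℤ}
    (hu : tensorCoboundary u = 0) :
    tensorCoboundary (hom φ u) = hom (coboundary φ) u +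
      (fun s => cup (sg (fun k => (-1) ^ k) φ) (fun σ => u (σ, s.2)) s.1) - cupSnd φ u := by
  funext ⟨σ, τ⟩
  have hz : ∀ l : List X, lhom (lext φ) (lext₂ u) l [] = 0 := fun l => by
    refine (lsplit_congr (Ψ := fun _ _ => 0 * 0) fun _ _ _ _ _ _ _ => rfl).trans ?_
    rw [lsplit_const_mul, zero_mul]
  simp only [tensorCoboundary, Pi.add_apply, Pi.sub_apply]
  rw [coboundary_eq_lcob (φ := fun σ => hom φ u (σ, τ)) (f := fun x => lhom (lext φ) (lext₂ u) x (toList τ)) rfl (fun _ => rfl),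
    coboundary_eq_lcob (φ := fun τ => hom φ u (σ, τ)) (f := lhom (lext φ) (lext₂ u) (toList σ)) (hz _) (fun _ => rfl)]
  have h := lcob_lhom (φ := lext φ) (lext₂_nil_right u) (lext₂_nil_left u) (lcob_lext₂ hu)
    (toList σ) (toList τ)
  rw [lcob_lext, length_toList, pow_succ] at h
  have e1 : cup (sg (fun k => (-1) ^ k) φ) (fun σ => u (σ, τ)) σ =
      -lsplit (fun a b => (-1) ^ a.length * (lext φ a * lext₂ u b (toList τ))) (toList σ) := by
    rw [← lsplit_neg]
    refine lsplit_congr fun a b _ _ _ ha hb => ?_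
    obtain ⟨α, rfl⟩ := exists_toList ha
    obtain ⟨β, rfl⟩ := exists_toList hb
    simp only [lext_toList, lext₂_toList, length_toList, sg, pow_succ]
    ring
  have e2 : cupSnd φ u (σ, τ) = lsplit (fun a' b' => (-1) ^ ((σ.1 + 1) * (a'.length + 1)) *
      (lext φ a' * lext₂ u (toList σ) b')) (toList τ) := by
    refine lsplit_congr fun a b _ _ _ ha hb => ?_
    obtain ⟨α, rfl⟩ := exists_toList ha
    obtain ⟨β, rfl⟩ := exists_toList hb
    simp only [lext_toList, lext₂_toList, length_toList, sg]
    have : (σ.1 + 1) * (α.1 + 1 + 1) = (σ.1 + 1) * α.1 + 2 * (σ.1 + 1) := by ring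
    rw [this, pow_add, pow_mul _ 2]
    norm_num
    ring
  rw [e1, e2]
  simp only [hom]
  linear_combination h

end Products

/-! ## Control of supports -/

section Control

variable {X : Type*}

theorem zero_mem_verts (σ : Simplex X) : σ.2 0 ∈ verts σ := ⟨0, rfl⟩

theorem finite_verts (σ : Simplex X) : (verts σ).Finite := Set.finite_range _

theorem finite_simplices {S : Set X} (hS : S.Finite) (n : ℕ) :
    {σ : Simplex X | verts σ ⊆ S ∧ σ.1 ≤ n}.Finite := by
  have h : ∀ k : ℕ, {s : Fin (k + 1) → X | ∀ i, s i ∈ S}.Finite := fun k =>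
    (Set.Finite.pi' fun _ => hS)
  refine ((Set.finite_Iic n).biUnion fun k _ => (h k).image fun s => (⟨k, s⟩ : Simplex X)).subset ?_
  rintro ⟨k, s⟩ ⟨h1, h2⟩
  exact Set.mem_biUnion (x := k) h2 ⟨s, fun i => h1 ⟨i, rfl⟩, rfl⟩

variable [MetricSpace X]

/-- All vertices of `σ` are at distance at most `R` from all vertices of `ρ`. -/
def Within (R : ℝ) (σ ρ : Simplex X) : Prop :=
  ∀ v ∈ verts σ, ∀ w ∈ verts ρ, dist v w ≤ R

theorem Within.symm {R : ℝ} {σ ρ : Simplex X} (h : Within R σ ρ) : Within R ρ σ :=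
  fun v hv w hw => by rw [dist_comm]; exact h w hw v hv

theorem Within.mono {R R' : ℝ} {σ ρ : Simplex X} (h : Within R σ ρ) (hR : R ≤ R') :
    Within R' σ ρ := fun v hv w hw => (h v hv w hw).trans hR

theorem Within.nonneg {R : ℝ} {σ ρ : Simplex X} (h : Within R σ ρ) : 0 ≤ R :=
  dist_nonneg.trans (h _ (zero_mem_verts σ) _ (zero_mem_verts ρ))

theorem Within.trans {R R' : ℝ} {σ ρ τ : Simplex X} (h : Within R σ ρ) (h' : Within R' ρ τ) :
    Within (R + R') σ τ := fun v hv w hw =>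
  (dist_triangle v (ρ.2 0) w).trans
    (add_le_add (h v hv _ (zero_mem_verts ρ)) (h' _ (zero_mem_verts ρ) w hw))

theorem Within.subset {R : ℝ} {σ ρ σ' ρ' : Simplex X} (h : Within R σ ρ)
    (hσ : verts σ' ⊆ verts σ) (hρ : verts ρ' ⊆ verts ρ) : Within R σ' ρ' :=
  fun v hv w hw => h v (hσ hv) w (hρ hw)

theorem exists_within_self (σ : Simplex X) : ∃ R, Within R σ σ := by
  obtain ⟨R, hR⟩ := ((finite_verts σ).prod (finite_verts σ)).image (fun p => dist p.1 p.2)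
    |>.bddAbove
  exact ⟨R, fun v hv w hw => hR ⟨(v, w), ⟨hv, hw⟩, rfl⟩⟩

theorem within_of_dist_const {σ : Simplex X} {x : X} {R : ℝ}
    (h : dist (stab σ) (EvConst.const x) ≤ R) : Within (R + R) σ σ := fun v hv w hw =>
  (dist_triangle_right v w x).trans
    (add_le_add (dist_stab_const_le.1 h v hv) (dist_stab_const_le.1 h w hw))

theorem dist_stab_le {σ ρ : Simplex X} {R : ℝ} (h : Within R σ ρ) : dist (stab σ) (stab ρ) ≤ R :=
  EvConst.dist_le_iff.2 fun _ => h _ ⟨_, rfl⟩ _ ⟨_, rfl⟩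

/-- The sup metric compares only vertices in equal positions; the bound `R'` on the size of `σ`
upgrades this to all pairs of vertices. -/
theorem within_of_dist_stab {σ ρ : Simplex X} {R R' : ℝ} (h : dist (stab σ) (stab ρ) ≤ R)
    (hσ : Within R' σ σ) : Within (R' + R) σ ρ := by
  rintro v hv _ ⟨j, rfl⟩
  have h1 := EvConst.dist_le_iff.1 h j
  have h2 : (⟨min (j : ℕ) ρ.1, Nat.lt_succ_of_le (min_le_right _ _)⟩ : Fin (ρ.1 + 1)) = j :=
    Fin.ext (min_eq_left (Nat.le_of_lt_succ j.2))
  simp only [stab, h2] at h1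
  exact (dist_triangle _ _ _).trans (add_le_add (hσ v hv _ ⟨_, rfl⟩) h1)

theorem CoarseChain.exists_within {k : ℤ} {c : Simplex X → ℤ} (hc : c ∈ CoarseChain X k) :
    ∃ R, ∀ σ, c σ ≠ 0 → Within R σ σ := by
  rcases isEmpty_or_nonempty X with hX | ⟨⟨x⟩⟩
  · exact ⟨0, fun σ => isEmptyElim (σ.2 0)⟩
  · obtain ⟨R, hR⟩ := hc.2.2.exists_thickening ⟨_, x, trivial, rfl⟩
    refine ⟨R + R, fun σ hσ => ?_⟩
    obtain ⟨_, ⟨y, -, rfl⟩, hy⟩ := mem_thickening_iff.1 (hR ⟨σ, hσ, rfl⟩)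
    exact within_of_dist_const hy.le

theorem mem_coarseChain {k : ℤ} {c : Simplex X → ℤ} {R : ℝ} (h1 : c ∈ Cochain X k)
    (h2 : ∀ x r, {σ : Simplex X | c σ ≠ 0 ∧ ∃ v ∈ verts σ, dist v x ≤ r}.Finite)
    (h3 : ∀ σ, c σ ≠ 0 → Within R σ σ) : c ∈ CoarseChain X k := by
  refine ⟨h1, fun B hB => ?_, Or.inr ⟨R + 1, ?_⟩⟩
  · rcases isEmpty_or_nonempty X with hX | ⟨⟨x⟩⟩
    · exact Set.toFinite _ |>.subset (s := ∅) fun σ => isEmptyElim (σ.2 0)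
    · obtain ⟨r, hr⟩ := hB.subset_closedBall x
      exact (h2 x r).subset fun σ ⟨hσ, i, hi⟩ => ⟨hσ, σ.2 i, ⟨i, rfl⟩, hr hi⟩
  · rintro _ ⟨σ, hσ, rfl⟩
    refine mem_thickening_iff.2 ⟨_, ⟨σ.2 0, trivial, rfl⟩, ?_⟩
    exact (dist_stab_const_le.2 fun v hv => h3 σ hσ v hv _ (zero_mem_verts σ)).trans_lt
      (lt_add_one _)

theorem CoarseChain.finite_near {k : ℤ} {c : Simplex X → ℤ} (hc : c ∈ CoarseChain X k) (x : X)
    (r : ℝ) : {σ : Simplex X | c σ ≠ 0 ∧ ∃ v ∈ verts σ, dist v x ≤ r}.Finite := by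
  refine (hc.2.1 (closedBall x r) isBounded_closedBall).subset ?_
  rintro σ ⟨hσ, _, ⟨i, rfl⟩, hi⟩
  exact ⟨hσ, i, hi⟩

/-- If `α` and `β` are small, their grid is near a constant sequence, hence near some `(z, z)`, so
that both simplices are near `z`. Together with `mem_tensorCochain`, this replaces the condition on
grids by one on pairs of simplices. -/
theorem TensorCochain.exists_within {n : ℤ} {u : Simplex X × Simplex X → ℤ}
    (hu : u ∈ TensorCochain X n) (R : ℝ) :
    ∃ R', ∀ α β, u (α, β) ≠ 0 → Within R α α → Within R β β → Within R' α β := by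
  rcases isEmpty_or_nonempty X with hX | ⟨⟨x⟩⟩
  · exact ⟨0, fun α => isEmptyElim (α.2 0)⟩
  · obtain ⟨R', hR'⟩ := (hu.2 (R + 1)).exists_thickening ⟨_, _, ⟨x, rfl⟩, rfl⟩
    refine ⟨R' + R', fun α β h hα hβ => ?_⟩
    have hR := hα.nonneg
    have h1 : stab (grid (α, β)) ∈ thickening R' (diag (Set.range fun x : X => (x, x))) := by
      refine hR' ⟨self_subset_thickening (by linarith) _ ⟨_, ⟨_, h, rfl⟩, rfl⟩,
        mem_thickening_iff.2 ⟨_, ⟨(α.2 0, β.2 0), trivial, rfl⟩, ?_⟩⟩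
      refine lt_of_le_of_lt (dist_stab_const_le.2 ?_) (lt_add_one _)
      rw [verts_grid]
      rintro ⟨v, w⟩ ⟨hv, hw⟩
      exact max_le (hα v hv _ (zero_mem_verts α)) (hβ w hw _ (zero_mem_verts β))
    obtain ⟨_, ⟨_, ⟨z, rfl⟩, rfl⟩, hz⟩ := mem_thickening_iff.1 h1
    intro v hv w hw
    have hz' := dist_stab_const_le.1 hz.le (v, w) (by rw [verts_grid]; exact ⟨hv, hw⟩)
    rw [Prod.dist_eq, max_le_iff] at hz'
    exact (dist_triangle_right v w z).trans (add_le_add hz'.1 hz'.2)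

theorem mem_tensorCochain {n : ℤ} {u : Simplex X × Simplex X → ℤ}
    (h : ∀ s, u s ≠ 0 → (s.1.1 : ℤ) + s.2.1 = n)
    (h' : ∀ R, ∃ R', ∀ α β, u (α, β) ≠ 0 → Within R α α → Within R β β → Within R' α β) :
    u ∈ TensorCochain X n := by
  refine ⟨h, fun R => ?_⟩
  -- A grid and a constant sequence both within `R` of `z` are within `2 * R` of each other, so `α`
  -- and `β` have size at most `2 * R + 2 * R`.
  obtain ⟨R', hR'⟩ := h' (2 * R + 2 * R)
  refine Or.inr ⟨R + max (2 * R + 2 * R) R', ?_⟩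
  rintro z ⟨hz1, hz2⟩
  obtain ⟨_, ⟨_, ⟨⟨α, β⟩, hs, rfl⟩, rfl⟩, h1⟩ := mem_thickening_iff.1 hz1
  obtain ⟨_, ⟨⟨x, y⟩, -, rfl⟩, h2⟩ := mem_thickening_iff.1 hz2
  have h3 : dist (stab (grid (α, β))) (EvConst.const (x, y)) ≤ 2 * R := by
    linarith [dist_triangle_left (stab (grid (α, β))) (EvConst.const (x, y)) z]
  have h4 := dist_stab_const_le.1 h3
  rw [verts_grid] at h4
  have hα : Within (2 * R + 2 * R) α α := within_of_dist_const (x := x)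
    (dist_stab_const_le.2 fun v hv =>
      (max_le_iff.1 (h4 (v, β.2 0) ⟨hv, zero_mem_verts β⟩)).1)
  have hβ : Within (2 * R + 2 * R) β β := within_of_dist_const (x := y)
    (dist_stab_const_le.2 fun w hw =>
      (max_le_iff.1 (h4 (α.2 0, w) ⟨zero_mem_verts α, hw⟩)).2)
  have hαβ := hR' α β hs hα hβ
  refine mem_thickening_iff.2 ⟨_, ⟨_, ⟨α.2 0, rfl⟩, rfl⟩, ?_⟩
  refine (dist_triangle _ _ _).trans_lt (add_lt_add_of_lt_of_le h1 (dist_stab_const_le.2 ?_))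
  rw [verts_grid]
  rintro ⟨v, w⟩ ⟨hv, hw⟩
  exact max_le_max (hα v hv _ (zero_mem_verts α)) (hαβ.symm w hw _ (zero_mem_verts α))

/-- The part of the support of `ψ` consisting of simplices of bounded size is near the support of
`φ`. -/
def NearSupp (ψ φ : Simplex X → ℤ) : Prop :=
  ∀ R, ∃ R', ∀ σ, ψ σ ≠ 0 → Within R σ σ → ∃ ρ, φ ρ ≠ 0 ∧ Within R' σ ρ

theorem NearSupp.coarseInterContained {ψ φ : Simplex X → ℤ} (h : NearSupp ψ φ) :
    CoarseInterContained (supp ψ) (diag Set.univ) (supp φ) := by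
  intro R
  obtain ⟨R', hR'⟩ := h (2 * R + 2 * R)
  refine Or.inr ⟨R + R', ?_⟩
  rintro z ⟨hz1, hz2⟩
  obtain ⟨_, ⟨σ, hσ, rfl⟩, h1⟩ := mem_thickening_iff.1 hz1
  obtain ⟨_, ⟨x, -, rfl⟩, h2⟩ := mem_thickening_iff.1 hz2
  have h3 : dist (stab σ) (EvConst.const x) ≤ 2 * R := by
    linarith [dist_triangle_left (stab σ) (EvConst.const x) z]
  obtain ⟨ρ, hρ, hw⟩ := hR' σ hσ (within_of_dist_const h3)
  exact mem_thickening_iff.2 ⟨_, ⟨ρ, hρ, rfl⟩,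
    (dist_triangle _ _ _).trans_lt (add_lt_add_of_lt_of_le h1 (dist_stab_le hw))⟩

theorem NearSupp.coarselyContained {k : ℤ} {c φ : Simplex X → ℤ} (h : NearSupp c φ)
    (hc : c ∈ CoarseChain X k) : CoarselyContained (supp c) (supp φ) := by
  obtain ⟨R, hR⟩ := CoarseChain.exists_within hc
  obtain ⟨R', hR'⟩ := h R
  refine Or.inr ⟨R' + 1, ?_⟩
  rintro _ ⟨σ, hσ, rfl⟩
  obtain ⟨ρ, hρ, hw⟩ := hR' σ hσ (hR σ hσ)
  exact mem_thickening_iff.2 ⟨_, ⟨ρ, hρ, rfl⟩, (dist_stab_le hw).trans_lt (lt_add_one _)⟩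

/-- For `φ = 0` the hypothesis only says that certain sets are bounded, whereas `NearSupp` would
force `ψ = 0`; this is why `φ ≠ 0` is required. -/
theorem CoarseInterContained.nearSupp {ψ φ : Simplex X → ℤ}
    (h : CoarseInterContained (supp ψ) (diag Set.univ) (supp φ)) (hφ : φ ≠ 0) :
    NearSupp ψ φ := by
  obtain ⟨ρ₀, hρ₀⟩ := Function.ne_iff.1 hφ
  intro R
  obtain ⟨R', hR'⟩ := (h (R + 1)).exists_thickening ⟨_, ρ₀, hρ₀, rfl⟩
  refine ⟨R + R', fun σ hσ hR => ?_⟩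
  have h1 : stab σ ∈ thickening R' (supp φ) := by
    refine hR' ⟨self_subset_thickening (by linarith [hR.nonneg]) _ ⟨_, hσ, rfl⟩,
      mem_thickening_iff.2 ⟨_, ⟨σ.2 0, trivial, rfl⟩, ?_⟩⟩
    exact (dist_stab_const_le.2 fun v hv => hR v hv _ (zero_mem_verts σ)).trans_lt (lt_add_one _)
  obtain ⟨_, ⟨ρ, hρ, rfl⟩, hz⟩ := mem_thickening_iff.1 h1
  exact ⟨ρ, hρ, within_of_dist_stab hz.le hR⟩

theorem NearSupp.trans {χ ψ φ : Simplex X → ℤ} (h : NearSupp χ ψ) (h' : NearSupp ψ φ) :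
    NearSupp χ φ := by
  intro R
  obtain ⟨R', hR'⟩ := h R
  obtain ⟨R'', hR''⟩ := h' (R' + R')
  refine ⟨R' + R'', fun σ hσ hR => ?_⟩
  obtain ⟨ρ, hρ, hw⟩ := hR' σ hσ hR
  obtain ⟨τ, hτ, hw'⟩ := hR'' ρ hρ (hw.symm.trans hw)
  exact ⟨τ, hτ, hw.trans hw'⟩

theorem NearSupp.add {ψ ψ' φ : Simplex X → ℤ} (h : NearSupp ψ φ) (h' : NearSupp ψ' φ) :
    NearSupp (ψ + ψ') φ := by
  intro R
  obtain ⟨R₁, h₁⟩ := h R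
  obtain ⟨R₂, h₂⟩ := h' R
  refine ⟨max R₁ R₂, fun σ hσ hR => ?_⟩
  by_cases h0 : ψ σ = 0
  · obtain ⟨ρ, hρ, hw⟩ := h₂ σ (fun h' => hσ (by simp [h0, h'])) hR
    exact ⟨ρ, hρ, hw.mono (le_max_right _ _)⟩
  · obtain ⟨ρ, hρ, hw⟩ := h₁ σ h0 hR
    exact ⟨ρ, hρ, hw.mono (le_max_left _ _)⟩

theorem nearSupp_of_imp {ψ φ : Simplex X → ℤ} (h : ∀ σ, ψ σ ≠ 0 → φ σ ≠ 0) : NearSupp ψ φ :=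
  fun R => ⟨R, fun σ hσ hR => ⟨σ, h σ hσ, hR⟩⟩

theorem NearSupp.mono {ψ ψ' φ : Simplex X → ℤ} (h : NearSupp ψ φ)
    (h' : ∀ σ, ψ' σ ≠ 0 → ψ σ ≠ 0) : NearSupp ψ' φ :=
  (nearSupp_of_imp h').trans h

end Control

/-! ## Transposition of operators on cochains -/

section Transpose

variable {X : Type*}

open Classical in
/-- The cochain with value `1` on `ρ` and `0` elsewhere. -/
noncomputable def delta (ρ : Simplex X) : Simplex X → ℤ := fun σ => if σ = ρ then 1 else 0

@[simp] theorem delta_self (ρ : Simplex X) : delta ρ ρ = 1 := if_pos rfl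

theorem delta_of_ne {σ ρ : Simplex X} (h : σ ≠ ρ) : delta ρ σ = 0 := if_neg h

theorem eq_of_delta_ne_zero {σ ρ : Simplex X} (h : delta ρ σ ≠ 0) : σ = ρ := by
  by_contra h'
  exact h (delta_of_ne h')

theorem finsum_mul_delta (c : Simplex X → ℤ) (ρ : Simplex X) : ∑ᶠ σ, c σ * delta ρ σ = c ρ := by
  rw [finsum_eq_single _ ρ fun σ h => by rw [delta_of_ne h, mul_zero], delta_self, mul_one]

/-- The transpose of an operator on cochains, applied to a chain. -/
noncomputable def transpose (T : (Simplex X → ℤ) →+ (Simplex X → ℤ)) (c : Simplex X → ℤ) :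
    Simplex X → ℤ := fun ρ => ∑ᶠ σ, c σ * T (delta ρ) σ

theorem exists_of_transpose_ne_zero {T : (Simplex X → ℤ) →+ (Simplex X → ℤ)} {c : Simplex X → ℤ}
    {ρ : Simplex X} (h : transpose T c ρ ≠ 0) : ∃ σ, c σ ≠ 0 ∧ T (delta ρ) σ ≠ 0 := by
  by_contra! h'
  refine h ((finsum_congr fun σ => ?_).trans finsum_zero)
  by_cases h0 : c σ = 0
  · rw [h0, zero_mul]
  · rw [h' σ h0, mul_zero]

/-- The value at `σ` only depends on the values on the finite set `S`. -/
def DeterminedOn (T : (Simplex X → ℤ) →+ (Simplex X → ℤ)) (σ : Simplex X)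
    (S : Finset (Simplex X)) : Prop :=
  ∀ ψ : Simplex X → ℤ, (∀ ρ ∈ S, ψ ρ = 0) → T ψ σ = 0

theorem DeterminedOn.mem {T : (Simplex X → ℤ) →+ (Simplex X → ℤ)} {σ ρ : Simplex X}
    {S : Finset (Simplex X)} (h : DeterminedOn T σ S) (h' : T (delta ρ) σ ≠ 0) : ρ ∈ S := by
  by_contra hρ
  exact h' (h _ fun ρ' h1 => delta_of_ne fun h2 => hρ (h2 ▸ h1))

theorem DeterminedOn.finite_support {T : (Simplex X → ℤ) →+ (Simplex X → ℤ)} {σ : Simplex X}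
    {S : Finset (Simplex X)} (h : DeterminedOn T σ S) (ψ : Simplex X → ℤ) :
    (Function.support fun ρ => T (delta ρ) σ * ψ ρ).Finite :=
  S.finite_toSet.subset fun _ hρ => h.mem (left_ne_zero_of_mul hρ)

/-- Subtracting from `ψ` the finite combination of `delta ρ` with the same values on `S` leaves a
cochain that `T` does not see at `σ`. Locality thus takes the place of continuity for infinite sums.
-/
theorem DeterminedOn.apply_eq {T : (Simplex X → ℤ) →+ (Simplex X → ℤ)} {σ : Simplex X}
    {S : Finset (Simplex X)} (h : DeterminedOn T σ S) (ψ : Simplex X → ℤ) :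
    T ψ σ = ∑ᶠ ρ, T (delta ρ) σ * ψ ρ := by
  rw [finsum_eq_finsetSum_of_support_subset (s := S) _
    fun ρ hρ => h.mem (left_ne_zero_of_mul hρ)]
  have h1 := h (ψ - ∑ ρ ∈ S, ψ ρ • delta ρ) fun ρ hρ => by
    rw [Pi.sub_apply, Finset.sum_apply, Finset.sum_eq_single_of_mem ρ hρ]
    · simp
    · intro ρ' _ h'
      rw [Pi.smul_apply, delta_of_ne h'.symm, smul_zero]
  rw [map_sub, map_sum, Pi.sub_apply, sub_eq_zero] at h1
  rw [h1, Finset.sum_apply]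
  refine Finset.sum_congr rfl fun ρ _ => ?_
  rw [map_zsmul, Pi.smul_apply, smul_eq_mul, mul_comm]

variable [MetricSpace X]

/-- On simplices of bounded size, the operator only depends on finitely many nearby values. -/
def IsLocal (T : (Simplex X → ℤ) →+ (Simplex X → ℤ)) : Prop :=
  ∀ R, ∃ R', ∀ σ, Within R σ σ → ∃ S : Finset (Simplex X),
    (∀ ρ ∈ S, Within R' σ ρ) ∧ DeterminedOn T σ S

theorem transpose_finite {T : (Simplex X → ℤ) →+ (Simplex X → ℤ)} (hT : IsLocal T) {k : ℤ}
    {c : Simplex X → ℤ} (hc : c ∈ CoarseChain X k) (x : X) (r : ℝ) :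
    {σ | c σ ≠ 0 ∧ ∃ ρ, T (delta ρ) σ ≠ 0 ∧ ∃ v ∈ verts ρ, dist v x ≤ r}.Finite := by
  obtain ⟨R, hR⟩ := CoarseChain.exists_within hc
  obtain ⟨R', hR'⟩ := hT R
  refine (CoarseChain.finite_near hc x (R' + r)).subset ?_
  rintro σ ⟨hσ, ρ, hρ, v, hv, hvx⟩
  obtain ⟨S, hS, hd⟩ := hR' σ (hR σ hσ)
  exact ⟨hσ, σ.2 0, zero_mem_verts σ, (dist_triangle _ v _).trans
    (add_le_add (hS ρ (hd.mem hρ) _ (zero_mem_verts σ) v hv) hvx)⟩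

theorem transpose_mem {T : (Simplex X → ℤ) →+ (Simplex X → ℤ)} (hT : IsLocal T) {k m : ℤ}
    {c : Simplex X → ℤ} (hc : c ∈ CoarseChain X k)
    (hdeg : ∀ σ ρ, c σ ≠ 0 → T (delta ρ) σ ≠ 0 → (ρ.1 : ℤ) = m) :
    transpose T c ∈ CoarseChain X m := by
  obtain ⟨R, hR⟩ := CoarseChain.exists_within hc
  obtain ⟨R', hR'⟩ := hT R
  choose! S hS hd using hR'
  refine mem_coarseChain (R := R' + R') (fun ρ hρ => ?_) (fun x r => ?_) fun ρ hρ => ?_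
  · obtain ⟨σ, hσ, h⟩ := exists_of_transpose_ne_zero hρ
    exact hdeg σ ρ hσ h
  · refine ((transpose_finite hT hc x r).biUnion fun σ _ => (S σ).finite_toSet).subset ?_
    rintro ρ ⟨hρ, hv⟩
    obtain ⟨σ, hσ, h⟩ := exists_of_transpose_ne_zero hρ
    exact Set.mem_biUnion (x := σ) ⟨hσ, ρ, h, hv⟩ ((hd σ (hR σ hσ)).mem h)
  · obtain ⟨σ, hσ, h⟩ := exists_of_transpose_ne_zero hρ
    have := hS σ (hR σ hσ) ρ ((hd σ (hR σ hσ)).mem h)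
    exact this.symm.trans this

theorem transpose_nearSupp {T : (Simplex X → ℤ) →+ (Simplex X → ℤ)} (hT : IsLocal T) {k : ℤ}
    {c : Simplex X → ℤ} (hc : c ∈ CoarseChain X k) : NearSupp (transpose T c) c := by
  obtain ⟨R, hR⟩ := CoarseChain.exists_within hc
  obtain ⟨R', hR'⟩ := hT R
  refine fun _ => ⟨R', fun ρ hρ _ => ?_⟩
  obtain ⟨σ, hσ, h⟩ := exists_of_transpose_ne_zero hρ
  obtain ⟨S, hS, hd⟩ := hR' σ (hR σ hσ)
  exact ⟨σ, hσ, (hS ρ (hd.mem h)).symm⟩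

/-- The defining property of the transpose. -/
theorem finsum_transpose_mul {T : (Simplex X → ℤ) →+ (Simplex X → ℤ)} (hT : IsLocal T) {k : ℤ}
    {c : Simplex X → ℤ} (hc : c ∈ CoarseChain X k) {ψ : Simplex X → ℤ}
    (hfin : {σ | c σ ≠ 0 ∧ ∃ ρ, ψ ρ ≠ 0 ∧ T (delta ρ) σ ≠ 0}.Finite) :
    ∑ᶠ ρ, transpose T c ρ * ψ ρ = ∑ᶠ σ, c σ * T ψ σ := by
  obtain ⟨R, hR⟩ := CoarseChain.exists_within hc
  obtain ⟨R', hR'⟩ := hT R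
  choose! S hS hd using hR'
  have e1 : ∀ ρ, transpose T c ρ * ψ ρ =
      ∑ σ ∈ hfin.toFinset, c σ * (T (delta ρ) σ * ψ ρ) := by
    intro ρ
    by_cases h0 : ψ ρ = 0
    · simp [h0]
    · rw [transpose, finsum_eq_finsetSum_of_support_subset (s := hfin.toFinset), Finset.sum_mul]
      · exact Finset.sum_congr rfl fun σ _ => mul_assoc _ _ _
      · intro σ hσ
        rw [Set.Finite.coe_toFinset]
        exact ⟨left_ne_zero_of_mul hσ, ρ, h0, right_ne_zero_of_mul hσ⟩
  have e2 : ∑ᶠ σ, c σ * T ψ σ = ∑ σ ∈ hfin.toFinset, c σ * T ψ σ := by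
    refine finsum_eq_finsetSum_of_support_subset _ fun σ hσ => ?_
    have h1 := left_ne_zero_of_mul hσ
    have h2 := right_ne_zero_of_mul hσ
    rw [(hd σ (hR σ h1)).apply_eq] at h2
    obtain ⟨ρ, hρ⟩ : ∃ ρ, T (delta ρ) σ * ψ ρ ≠ 0 := by
      by_contra! h3
      exact h2 ((finsum_congr h3).trans finsum_zero)
    rw [Set.Finite.coe_toFinset]
    exact ⟨h1, ρ, right_ne_zero_of_mul hρ, left_ne_zero_of_mul hρ⟩
  rw [finsum_congr e1, e2, finsum_sum_comm]
  · refine Finset.sum_congr rfl fun σ hσ => ?_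
    rw [Set.Finite.mem_toFinset] at hσ
    rw [(hd σ (hR σ hσ.1)).apply_eq ψ, mul_finsum]
  · intro σ hσ
    rw [Set.Finite.mem_toFinset] at hσ
    exact ((hd σ (hR σ hσ.1)).finite_support ψ).subset fun ρ hρ => right_ne_zero_of_mul hρ

/-- Evaluate against `delta ρ`: adjointness moves the boundary onto `delta ρ`, then the transpose is
moved across. In `transpose_boundary` the two operations occur in the opposite order, so that
homotopy formulas for `T` transpose to chains. -/
theorem boundary_transpose {T : (Simplex X → ℤ) →+ (Simplex X → ℤ)} (hT : IsLocal T) {k m : ℤ}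
    {c : Simplex X → ℤ} (hc : c ∈ CoarseChain X k) (hm : transpose T c ∈ CoarseChain X m)
    (ρ : Simplex X) :
    boundary (transpose T c) ρ = ∑ᶠ σ, c σ * T (coboundary (delta ρ)) σ := by
  rw [← finsum_mul_delta (boundary (transpose T c)), finsum_boundary_mul, finsum_transpose_mul hT hc]
  · refine (transpose_finite hT hc (ρ.2 0) 0).subset ?_
    rintro σ ⟨hσ, τ, hτ, h⟩
    obtain ⟨ρ', hρ', hv, -⟩ := coboundary_ne_zero hτ
    rw [eq_of_delta_ne_zero hρ'] at hv
    exact ⟨hσ, τ, h, ρ.2 0, hv (zero_mem_verts ρ), (dist_self _).le⟩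
  · refine (CoarseChain.finite_near hm (ρ.2 0) 0).subset ?_
    rintro σ ⟨hσ, τ, hτ, h⟩
    rw [eq_of_delta_ne_zero h] at hτ
    exact ⟨hσ, ρ.2 0, hτ (zero_mem_verts ρ), (dist_self _).le⟩

theorem transpose_boundary {T : (Simplex X → ℤ) →+ (Simplex X → ℤ)} (hT : IsLocal T) {k : ℤ}
    {c : Simplex X → ℤ} (hc : c ∈ CoarseChain X k) (ρ : Simplex X) :
    transpose T (boundary c) ρ = ∑ᶠ σ, c σ * coboundary (T (delta ρ)) σ := by
  refine finsum_boundary_mul ?_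
  obtain ⟨R, hR⟩ := CoarseChain.exists_within hc
  obtain ⟨R', hR'⟩ := hT R
  refine (CoarseChain.finite_near hc (ρ.2 0) R').subset ?_
  rintro σ ⟨hσ, τ, hτ, h⟩
  obtain ⟨S, hS, hd⟩ := hR' τ ((hR σ hσ).subset hτ hτ)
  exact ⟨hσ, τ.2 0, hτ (zero_mem_verts τ),
    hS ρ (hd.mem h) _ (zero_mem_verts τ) _ (zero_mem_verts ρ)⟩

end Transpose

/-! ### Cup, cap and slant products as local operators. -/

section Operators

variable {X : Type*}

/-- Signs depending on the dimensions of the factors can be compared splitting by splitting, using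
`α.1 + β.1 = σ.1`. -/
theorem cup_congr {φ ψ φ' ψ' : Simplex X → ℤ} {σ : Simplex X} {r : ℤ}
    (h : ∀ α β, verts α ⊆ verts σ → verts β ⊆ verts σ → α.1 + β.1 = σ.1 →
      φ α * ψ β = r * (φ' α * ψ' β)) :
    cup φ ψ σ = r * cup φ' ψ' σ := by
  simp only [cup]
  rw [← lsplit_const_mul]
  refine lsplit_congr fun a b hl ha hb ha0 hb0 => ?_
  obtain ⟨α, rfl⟩ := exists_toList ha0
  obtain ⟨β, rfl⟩ := exists_toList hb0
  simp only [length_toList] at hl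
  simp only [lext_toList]
  exact h α β (fun v hv => mem_toList.1 (ha (mem_toList.2 hv)))
    (fun v hv => mem_toList.1 (hb (mem_toList.2 hv))) (by omega)

theorem cup_neg_left (φ ψ : Simplex X → ℤ) (σ : Simplex X) : cup (-φ) ψ σ = -cup φ ψ σ := by
  rw [← neg_one_mul (cup φ ψ σ)]
  exact cup_congr fun α β _ _ _ => by simp

theorem delta_sg (ε : ℕ → ℤ) (ρ : Simplex X) : sg ε (delta ρ) = fun σ => ε ρ.1 * delta ρ σ := by
  funext σ
  by_cases h : σ = ρ
  · rw [h]; rfl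
  · simp [sg, delta_of_ne h]

theorem boundary_sg (ε : ℕ → ℤ) (c : Simplex X → ℤ) :
    boundary (sg ε c) = sg (fun k => ε (k + 1)) (boundary c) := by
  funext τ
  simp only [boundary, sg, insertVertex, Finset.mul_sum]
  refine Finset.sum_congr rfl fun i _ => ?_
  simp only [← smul_eq_mul (ε (τ.1 + 1))]
  rw [← smul_finsum, smul_eq_mul, smul_eq_mul]
  ring

theorem sg_add (ε : ℕ → ℤ) (φ ψ : Simplex X → ℤ) : sg ε (φ + ψ) = sg ε φ + sg ε ψ := by
  funext σ; simp [sg, mul_add]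

theorem sg_mem {ε : ℕ → ℤ} {k : ℤ} {φ : Simplex X → ℤ} (hφ : φ ∈ Cochain X k) :
    sg ε φ ∈ Cochain X k := fun σ hσ => hφ σ (right_ne_zero_of_mul hσ)

/-- Cup product with `φ` on the left. -/
def cupLeft (φ : Simplex X → ℤ) : (Simplex X → ℤ) →+ (Simplex X → ℤ) :=
  AddMonoidHom.mk' (cup φ) (cup_add_right φ)

/-- Cup product with `φ` on the right. -/
def cupRight (φ : Simplex X → ℤ) : (Simplex X → ℤ) →+ (Simplex X → ℤ) :=
  AddMonoidHom.mk' (fun ψ => cup ψ φ) fun ψ ψ' => cup_add_left ψ ψ' φ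

/-- The simplices of dimension at most `n` with vertices in a finite set. -/
noncomputable def simplicesIn {S : Set X} (hS : S.Finite) (n : ℕ) : Finset (Simplex X) :=
  (finite_simplices hS n).toFinset

theorem mem_simplicesIn {S : Set X} (hS : S.Finite) {n : ℕ} {σ : Simplex X} :
    σ ∈ simplicesIn hS n ↔ verts σ ⊆ S ∧ σ.1 ≤ n := Set.Finite.mem_toFinset _

theorem cupLeft_determinedOn (φ : Simplex X → ℤ) (σ : Simplex X) :
    DeterminedOn (cupLeft φ) σ (simplicesIn (finite_verts σ) σ.1) := by
  intro ψ h
  by_contra h0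
  obtain ⟨α, β, -, hβ, -, hv, hd⟩ := exists_of_cup_ne_zero h0
  exact hβ (h β ((mem_simplicesIn _).2 ⟨hv, by omega⟩))

theorem cupRight_determinedOn (φ : Simplex X → ℤ) (σ : Simplex X) :
    DeterminedOn (cupRight φ) σ (simplicesIn (finite_verts σ) σ.1) := by
  intro ψ h
  by_contra h0
  obtain ⟨α, β, hα, -, hv, -, hd⟩ := exists_of_cup_ne_zero h0
  exact hα (h α ((mem_simplicesIn _).2 ⟨hv, by omega⟩))

theorem transpose_zero (T : (Simplex X → ℤ) →+ (Simplex X → ℤ)) : transpose T 0 = 0 := by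
  funext ρ; simp [transpose]

/-- The sign `(-1)^(k(k+1)/2)`. -/
def sgnP : ℕ → ℤ
  | 0 => 1
  | k + 1 => (-1) ^ (k + 1) * sgnP k

theorem sgnP_mul_self (k : ℕ) : sgnP k * sgnP k = 1 := by
  induction k with
  | zero => rfl
  | succ k ih =>
    rw [sgnP]
    linear_combination ((-1) ^ (k + 1) * (-1) ^ (k + 1)) * ih + neg_one_pow_mul_self (k + 1)

/-- Indeed `(-1)^k * sgnP k = -sgnP (k + 1)`. This is the relation that makes the cap product a
chain map without a sign. -/
theorem coboundary_sgnP (φ : Simplex X → ℤ) :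
    coboundary (sg (fun k => (-1) ^ k * sgnP k) φ) = -sg sgnP (coboundary φ) := by
  rw [coboundary_sg]
  funext ⟨k, s⟩
  cases k with
  | zero => simp [sg, coboundary]
  | succ k =>
    simp only [sg, Pi.neg_apply, Nat.add_sub_cancel, sgnP, pow_succ]
    ring

/-- Every pair of simplices in the support of `K` has a pair of faces in the support of `u`. -/
def FacesIn (K u : Simplex X × Simplex X → ℤ) : Prop :=
  ∀ σ τ, K (σ, τ) ≠ 0 → ∃ α β, u (α, β) ≠ 0 ∧ verts α ⊆ verts σ ∧ verts β ⊆ verts τ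

theorem facesIn_hom (φ : Simplex X → ℤ) (u : Simplex X × Simplex X → ℤ) :
    FacesIn (hom φ u) u := fun σ τ h => by
  obtain ⟨-, α, β, -, h, -, hα, hβ, -⟩ := exists_of_hom_ne_zero h
  exact ⟨α, β, h, hα, hβ⟩

theorem facesIn_cupFst (φ : Simplex X → ℤ) (u : Simplex X × Simplex X → ℤ) :
    FacesIn (fun s => cup φ (fun σ => u (σ, s.2)) s.1) u := fun σ τ h => by
  obtain ⟨-, β, -, hβ, -, hv, -⟩ := exists_of_cup_ne_zero h
  exact ⟨β, τ, hβ, hv, subset_rfl⟩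

theorem facesIn_cupSnd (φ : Simplex X → ℤ) (u : Simplex X × Simplex X → ℤ) :
    FacesIn (cupSnd φ u) u := fun σ τ h => by
  obtain ⟨-, β, -, hβ, -, hv, -⟩ := exists_of_cup_ne_zero h
  exact ⟨σ, β, hβ, subset_rfl, hv⟩

theorem exists_of_slant_ne_zero {u : Simplex X × Simplex X → ℤ} {c : Simplex X → ℤ}
    {τ : Simplex X} (h : slant u c τ ≠ 0) : ∃ σ, c σ ≠ 0 ∧ u (σ, τ) ≠ 0 := by
  by_contra! h'
  refine h ((finsum_congr fun σ => ?_).trans finsum_zero)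
  by_cases h0 : c σ = 0
  · rw [h0, zero_mul]
  · rw [h' σ h0, mul_zero]

variable [MetricSpace X]

theorem cupLeft_isLocal (φ : Simplex X → ℤ) : IsLocal (cupLeft φ) := fun R =>
  ⟨R, fun σ hσ => ⟨_, fun _ hρ => hσ.subset subset_rfl ((mem_simplicesIn _).1 hρ).1,
    cupLeft_determinedOn φ σ⟩⟩

theorem cupRight_isLocal (φ : Simplex X → ℤ) : IsLocal (cupRight φ) := fun R =>
  ⟨R, fun σ hσ => ⟨_, fun _ hρ => hσ.subset subset_rfl ((mem_simplicesIn _).1 hρ).1,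
    cupRight_determinedOn φ σ⟩⟩

theorem IsLocal.nearSupp {T : (Simplex X → ℤ) →+ (Simplex X → ℤ)} (hT : IsLocal T)
    (ψ : Simplex X → ℤ) : NearSupp (T ψ) ψ := by
  intro R
  obtain ⟨R', hR'⟩ := hT R
  refine ⟨R', fun σ hσ hR => ?_⟩
  obtain ⟨S, hS, hd⟩ := hR' σ hR
  by_contra! h
  exact hσ (hd ψ fun ρ hρ => by
    by_contra h0
    exact h ρ h0 (hS ρ hρ))

/-- All simplices of the support of `ψ` meet a fixed bounded set. -/
def BddSupp (ψ : Simplex X → ℤ) : Prop :=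
  ∃ (x : X) (r : ℝ), ∀ τ, ψ τ ≠ 0 → ∃ v ∈ verts τ, dist v x ≤ r

theorem bddSupp_delta (ρ : Simplex X) : BddSupp (delta ρ) :=
  ⟨ρ.2 0, 0, fun τ hτ => ⟨ρ.2 0, by rw [eq_of_delta_ne_zero hτ]; exact zero_mem_verts ρ,
    (dist_self _).le⟩⟩

theorem BddSupp.coboundary {ψ : Simplex X → ℤ} (h : BddSupp ψ) : BddSupp (coboundary ψ) := by
  obtain ⟨x, r, h⟩ := h
  refine ⟨x, r, fun τ hτ => ?_⟩
  obtain ⟨ρ, hρ, hv, -⟩ := coboundary_ne_zero hτ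
  obtain ⟨v, hv', hx⟩ := h ρ hρ
  exact ⟨v, hv hv', hx⟩

theorem BddSupp.finite {ψ : Simplex X → ℤ} (h : BddSupp ψ)
    {T : (Simplex X → ℤ) →+ (Simplex X → ℤ)} (hT : IsLocal T) {k : ℤ}
    {c : Simplex X → ℤ} (hc : c ∈ CoarseChain X k) :
    (Function.support fun σ => c σ * T ψ σ).Finite := by
  obtain ⟨x, r, h⟩ := h
  refine (transpose_finite hT hc x r).subset fun σ hσ => ?_
  obtain ⟨R, hR⟩ := CoarseChain.exists_within hc
  obtain ⟨R', hR'⟩ := hT R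
  have h1 := left_ne_zero_of_mul hσ
  obtain ⟨S, -, hd⟩ := hR' σ (hR σ h1)
  have h2 := right_ne_zero_of_mul hσ
  rw [hd.apply_eq] at h2
  obtain ⟨ρ, hρ⟩ : ∃ ρ, T (delta ρ) σ * ψ ρ ≠ 0 := by
    by_contra! h3
    exact h2 ((finsum_congr h3).trans finsum_zero)
  exact ⟨h1, ρ, left_ne_zero_of_mul hρ, h ρ (right_ne_zero_of_mul hρ)⟩

/-! ### Cap products -/

theorem cap_mem {n k m : ℤ} (h : k + m = n) {c φ : Simplex X → ℤ} (hc : c ∈ CoarseChain X n)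
    (hφ : φ ∈ Cochain X k) : transpose (cupLeft φ) c ∈ CoarseChain X m := by
  refine transpose_mem (cupLeft_isLocal φ) hc fun σ ρ hσ hρ => ?_
  obtain ⟨α, β, hα, hβ, -, -, hd⟩ := exists_of_cup_ne_zero hρ
  have h1 := hφ α hα
  have h2 := hc.1 σ hσ
  have h3 := eq_of_delta_ne_zero hβ
  subst h3
  omega

theorem cap_mem' {n k m : ℤ} (h : k + m = n) {c φ : Simplex X → ℤ} (hc : c ∈ CoarseChain X n)
    (hφ : φ ∈ Cochain X k) : transpose (cupRight φ) c ∈ CoarseChain X m := by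
  refine transpose_mem (cupRight_isLocal φ) hc fun σ ρ hσ hρ => ?_
  obtain ⟨α, β, hα, hβ, -, -, hd⟩ := exists_of_cup_ne_zero hρ
  have h1 := hφ β hβ
  have h2 := hc.1 σ hσ
  have h3 := eq_of_delta_ne_zero hα
  subst h3
  omega

theorem cap_nearSupp {n : ℤ} {c : Simplex X → ℤ} (hc : c ∈ CoarseChain X n) (φ : Simplex X → ℤ) :
    NearSupp (transpose (cupLeft φ) c) φ := by
  obtain ⟨R, hR⟩ := CoarseChain.exists_within hc
  refine fun _ => ⟨R, fun ρ hρ _ => ?_⟩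
  obtain ⟨σ, hσ, h⟩ := exists_of_transpose_ne_zero hρ
  obtain ⟨α, β, hα, hβ, hv, hv', -⟩ := exists_of_cup_ne_zero h
  rw [eq_of_delta_ne_zero hβ] at hv'
  exact ⟨α, hα, (hR σ hσ).subset hv' hv⟩

theorem cap_nearSupp' {n : ℤ} {c : Simplex X → ℤ} (hc : c ∈ CoarseChain X n)
    (φ : Simplex X → ℤ) : NearSupp (transpose (cupRight φ) c) φ := by
  obtain ⟨R, hR⟩ := CoarseChain.exists_within hc
  refine fun _ => ⟨R, fun ρ hρ _ => ?_⟩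
  obtain ⟨σ, hσ, h⟩ := exists_of_transpose_ne_zero hρ
  obtain ⟨α, β, hα, hβ, hv, hv', -⟩ := exists_of_cup_ne_zero h
  rw [eq_of_delta_ne_zero hα] at hv
  exact ⟨β, hβ, (hR σ hσ).subset hv hv'⟩

/-- Since `c` is a cycle, it pairs to zero with the coboundary of a cup product with `delta ρ`. The
Leibniz rule splits this pairing into the two sides, the cochain being twisted by `(-1)^k * sgnP k`
so that the signs match by `coboundary_sgnP`. -/
theorem boundary_cap {n k : ℤ} {c φ : Simplex X → ℤ} (hc : c ∈ CoarseChain X n)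
    (hdc : boundary c = 0) (hφ : φ ∈ Cochain X k) :
    boundary (transpose (cupLeft (sg sgnP φ)) c) =
      transpose (cupLeft (sg sgnP (coboundary φ))) c := by
  funext ρ
  rw [boundary_transpose (cupLeft_isLocal _) hc (cap_mem (add_sub_cancel k n) hc (sg_mem hφ))]
  have h := transpose_boundary (cupLeft_isLocal (sg (fun k => (-1) ^ k * sgnP k) φ)) hc ρ
  rw [hdc, transpose_zero, Pi.zero_apply] at h
  have e : ∀ σ, c σ * coboundary (cupLeft (sg (fun k => (-1) ^ k * sgnP k) φ) (delta ρ)) σ =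
      c σ * cupLeft (sg sgnP φ) (coboundary (delta ρ)) σ -
        c σ * cupLeft (sg sgnP (coboundary φ)) (delta ρ) σ := by
    intro σ
    have h2 : sg (fun k => (-1) ^ k) (sg (fun k => (-1) ^ k * sgnP k) φ) = sg sgnP φ := by
      rw [sg_sg]
      congr 1
      funext k
      rw [← mul_assoc, neg_one_pow_mul_self, one_mul]
    simp only [cupLeft, AddMonoidHom.mk'_apply]
    rw [coboundary_cup, Pi.add_apply, coboundary_sgnP, cup_neg_left, h2]
    ring
  rw [finsum_congr e, finsum_sub_distrib
    ((bddSupp_delta ρ).coboundary.finite (cupLeft_isLocal _) hc)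
    ((bddSupp_delta ρ).finite (cupLeft_isLocal _) hc)] at h
  exact sub_eq_zero.1 h.symm

/-- The argument of `boundary_cap` with the cochain on the back face. The Leibniz sign now depends
on the dimension of `ρ`, so the correcting sign sits on the resulting chain. -/
theorem boundary_cap' {n k : ℤ} {c φ : Simplex X → ℤ} (hc : c ∈ CoarseChain X n)
    (hdc : boundary c = 0) (hφ : φ ∈ Cochain X k) :
    boundary (sg sgnP (transpose (cupRight φ) c)) =
      sg sgnP (transpose (cupRight (coboundary φ)) c) := by
  rw [boundary_sg]
  funext ρ
  have h := transpose_boundary (cupRight_isLocal φ) hc ρ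
  rw [hdc, transpose_zero, Pi.zero_apply] at h
  have e : ∀ σ, c σ * coboundary (cupRight φ (delta ρ)) σ =
      c σ * cupRight φ (coboundary (delta ρ)) σ +
        (-1) ^ ρ.1 * (c σ * cupRight (coboundary φ) (delta ρ) σ) := by
    intro σ
    simp only [cupRight, AddMonoidHom.mk'_apply]
    rw [coboundary_cup, Pi.add_apply, delta_sg,
      cup_congr (φ := fun σ => (-1) ^ ρ.1 * delta ρ σ) (φ' := delta ρ) (ψ' := coboundary φ)
        (r := (-1) ^ ρ.1) fun α β _ _ _ => by ring]
    ring
  have hf := (bddSupp_delta ρ).finite (cupRight_isLocal (coboundary φ)) hc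
  rw [finsum_congr e, finsum_add_distrib
    ((bddSupp_delta ρ).coboundary.finite (cupRight_isLocal _) hc)
    (hf.subset fun σ hσ => right_ne_zero_of_mul hσ), ← mul_finsum _ _] at h
  simp only [sg]
  rw [boundary_transpose (cupRight_isLocal _) hc (cap_mem' (add_sub_cancel k n) hc hφ)]
  simp only [transpose]
  rw [sgnP, pow_succ]
  linear_combination ((-1) ^ ρ.1 * sgnP ρ.1) * h +
    sgnP ρ.1 * (∑ᶠ σ, c σ * cupRight (coboundary φ) (delta ρ) σ) * neg_one_pow_mul_self ρ.1

/-! ### Slant products -/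

/-- Chain `σ` of steps: `σ` has bounded size by coarseness of `c`, its face `α` is near `β` by the
support of `u`, and `β` is a face of the small simplex `τ`. This estimate gives both the finiteness
and the control of slant products. -/
theorem facesIn_within {n k : ℤ} {u : Simplex X × Simplex X → ℤ} (hu : u ∈ TensorCochain X n)
    {c : Simplex X → ℤ} (hc : c ∈ CoarseChain X k) (R : ℝ) :
    ∃ R', ∀ σ τ α β, c σ ≠ 0 → Within R τ τ → u (α, β) ≠ 0 → verts α ⊆ verts σ →
      verts β ⊆ verts τ → Within R' σ τ := by
  obtain ⟨R₀, hR₀⟩ := CoarseChain.exists_within hc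
  obtain ⟨R', hR'⟩ := TensorCochain.exists_within hu (max R₀ R)
  refine ⟨R₀ + R' + R, fun σ τ α β hσ hτ huv hα hβ => ?_⟩
  have h1 := hR₀ σ hσ
  exact ((h1.subset subset_rfl hα).trans (hR' α β huv
    ((h1.subset hα hα).mono (le_max_left _ _)) ((hτ.subset hβ hβ).mono (le_max_right _ _)))).trans
    (hτ.subset hβ subset_rfl)

theorem faces_finite {n k : ℤ} {u : Simplex X × Simplex X → ℤ} (hu : u ∈ TensorCochain X n)
    {c : Simplex X → ℤ} (hc : c ∈ CoarseChain X k) (τ : Simplex X) :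
    {σ | c σ ≠ 0 ∧ ∃ α β, u (α, β) ≠ 0 ∧ verts α ⊆ verts σ ∧ verts β ⊆ verts τ}.Finite := by
  obtain ⟨R, hR⟩ := exists_within_self τ
  obtain ⟨R', hR'⟩ := facesIn_within hu hc R
  refine (CoarseChain.finite_near hc (τ.2 0) R').subset ?_
  rintro σ ⟨hσ, α, β, h, hα, hβ⟩
  exact ⟨hσ, σ.2 0, zero_mem_verts σ,
    hR' σ τ α β hσ hR h hα hβ _ (zero_mem_verts σ) _ (zero_mem_verts τ)⟩

theorem FacesIn.finite {n k : ℤ} {K u : Simplex X × Simplex X → ℤ} (h : FacesIn K u)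
    (hu : u ∈ TensorCochain X n) {c : Simplex X → ℤ} (hc : c ∈ CoarseChain X k) (τ : Simplex X) :
    (Function.support fun σ => c σ * K (σ, τ)).Finite :=
  (faces_finite hu hc τ).subset fun σ hσ =>
    ⟨left_ne_zero_of_mul hσ, h σ τ (right_ne_zero_of_mul hσ)⟩

theorem FacesIn.mem {n m : ℤ} {K u : Simplex X × Simplex X → ℤ} (h : FacesIn K u)
    (hu : u ∈ TensorCochain X n) (hdeg : ∀ s, K s ≠ 0 → (s.1.1 : ℤ) + s.2.1 = m) :
    K ∈ TensorCochain X m := by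
  refine mem_tensorCochain hdeg fun R => ?_
  obtain ⟨R', hR'⟩ := TensorCochain.exists_within hu R
  refine ⟨R + R' + R, fun σ τ hK hσ hτ => ?_⟩
  obtain ⟨α, β, huv, hα, hβ⟩ := h σ τ hK
  exact ((hσ.subset subset_rfl hα).trans (hR' α β huv (hσ.subset hα hα)
    (hτ.subset hβ hβ))).trans (hτ.subset hβ subset_rfl)

/-- The slant product with a join. -/
noncomputable def homOp {n k : ℤ} {u : Simplex X × Simplex X → ℤ} (hu : u ∈ TensorCochain X n)
    {c : Simplex X → ℤ} (hc : c ∈ CoarseChain X k) : (Simplex X → ℤ) →+ (Simplex X → ℤ) :=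
  AddMonoidHom.mk' (fun φ => slant (hom φ u) c) fun φ ψ => by
    funext τ
    simp only [slant, Pi.add_apply, hom_add, mul_add]
    exact finsum_add_distrib ((facesIn_hom φ u).finite hu hc τ) ((facesIn_hom ψ u).finite hu hc τ)

theorem slant_nearSupp {n k : ℤ} {u : Simplex X × Simplex X → ℤ} (hu : u ∈ TensorCochain X n)
    {c : Simplex X → ℤ} (hc : c ∈ CoarseChain X k) : NearSupp (slant u c) c := by
  intro R
  obtain ⟨R', hR'⟩ := facesIn_within hu hc R
  refine ⟨R', fun τ hτ hR => ?_⟩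
  obtain ⟨σ, hσ, h⟩ := exists_of_slant_ne_zero hτ
  exact ⟨σ, hσ, (hR' σ τ σ τ hσ hR h subset_rfl subset_rfl).symm⟩

/-- Only finitely many simplices `σ` of `c` have a face paired by `u` with a face of `τ`, and they
are all near `τ`. The cochain is evaluated only on simplices with vertices in such a `σ` and in `τ`,
of bounded dimension. -/
theorem homOp_isLocal {n k : ℤ} {u : Simplex X × Simplex X → ℤ} (hu : u ∈ TensorCochain X n)
    {c : Simplex X → ℤ} (hc : c ∈ CoarseChain X k) : IsLocal (homOp hu hc) := by
  classical
  intro R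
  obtain ⟨R', hR'⟩ := facesIn_within hu hc R
  refine ⟨max R R', fun τ hτ => ?_⟩
  let A := (faces_finite hu hc τ).toFinset
  refine ⟨A.biUnion fun σ =>
    simplicesIn ((finite_verts σ).union (finite_verts τ)) (σ.1 + τ.1 + 1), fun ρ hρ => ?_,
    fun ψ hψ => ?_⟩
  · obtain ⟨σ, hσ, hρ⟩ := Finset.mem_biUnion.1 hρ
    obtain ⟨hσ, α, β, h, hα, hβ⟩ := (Set.Finite.mem_toFinset _).1 hσ
    have hw := (hR' σ τ α β hσ hτ h hα hβ).symm
    intro v hv w hw'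
    rcases ((mem_simplicesIn _).1 hρ).1 hw' with h1 | h1
    · exact (hw v hv w h1).trans (le_max_right _ _)
    · exact (hτ v hv w h1).trans (le_max_left _ _)
  · by_contra h0
    obtain ⟨σ, hσ, h1⟩ := exists_of_slant_ne_zero h0
    obtain ⟨ρ, α, β, hρ, h, hv, hα, hβ, hd⟩ := exists_of_hom_ne_zero h1
    refine hρ (hψ ρ (Finset.mem_biUnion.2 ⟨σ, (Set.Finite.mem_toFinset _).2
      ⟨hσ, α, β, h, hα, hβ⟩, (mem_simplicesIn _).2 ⟨hv, ?_⟩⟩))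
    simp only at hd
    omega

theorem homOp_mem {n k l : ℤ} {u : Simplex X × Simplex X → ℤ} (hu : u ∈ TensorCochain X n)
    {c : Simplex X → ℤ} (hc : c ∈ CoarseChain X n) {φ : Simplex X → ℤ} (hφ : φ ∈ Cochain X k)
    (hl : l + 1 = k) : homOp hu hc φ ∈ Cochain X l := by
  intro τ hτ
  obtain ⟨σ, hσ, h1⟩ := exists_of_slant_ne_zero hτ
  obtain ⟨ρ, α, β, hρ, h, -, -, -, hd⟩ := exists_of_hom_ne_zero h1
  have h1 := hc.1 σ hσ
  have h2 := hφ ρ hρ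
  have h3 := hu.1 _ h
  simp only at hd h3
  omega

/-- One finite set of simplices of `c` computes the slant product on every simplex with vertices in
those of `τ`, so linearity of the cup product suffices. -/
theorem cup_slant {n k : ℤ} {u : Simplex X × Simplex X → ℤ} (hu : u ∈ TensorCochain X n)
    {c : Simplex X → ℤ} (hc : c ∈ CoarseChain X k) (φ : Simplex X → ℤ) (τ : Simplex X) :
    cup φ (slant u c) τ = ∑ᶠ σ, c σ * cup φ (fun ρ => u (σ, ρ)) τ := by
  have hA := faces_finite hu hc τ
  have e : cupLeft φ (slant u c) τ =
      cupLeft φ (∑ σ ∈ hA.toFinset, c σ • fun ρ => u (σ, ρ)) τ := by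
    rw [← sub_eq_zero, ← Pi.sub_apply, ← map_sub]
    refine cupLeft_determinedOn φ τ _ fun ρ hρ => ?_
    have hv := ((mem_simplicesIn _).1 hρ).1
    rw [Pi.sub_apply, sub_eq_zero, slant,
      finsum_eq_finsetSum_of_support_subset (s := hA.toFinset), Finset.sum_apply]
    · rfl
    · intro σ hσ
      rw [Set.Finite.coe_toFinset]
      exact ⟨left_ne_zero_of_mul hσ, σ, ρ, right_ne_zero_of_mul hσ, subset_rfl, hv⟩
  refine e.trans ?_
  rw [finsum_eq_finsetSum_of_support_subset (s := hA.toFinset), map_sum, Finset.sum_apply]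
  · refine Finset.sum_congr rfl fun σ _ => ?_
    rw [map_zsmul]
    rfl
  · intro σ hσ
    rw [Set.Finite.coe_toFinset]
    obtain ⟨-, β, -, hβ, -, hv, -⟩ := exists_of_cup_ne_zero (right_ne_zero_of_mul hσ)
    exact ⟨left_ne_zero_of_mul hσ, σ, β, hβ, subset_rfl, hv⟩

theorem slant_cap {n k : ℤ} {u : Simplex X × Simplex X → ℤ} (hu : u ∈ TensorCochain X n)
    {c : Simplex X → ℤ} (hc : c ∈ CoarseChain X k) (φ : Simplex X → ℤ) (τ : Simplex X) :
    slant u (transpose (cupLeft φ) c) τ = ∑ᶠ σ, c σ * cup φ (fun ρ => u (ρ, τ)) σ := by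
  refine finsum_transpose_mul (cupLeft_isLocal φ) hc ((faces_finite hu hc τ).subset ?_)
  rintro σ ⟨hσ, ρ, hρ, h⟩
  obtain ⟨-, β, -, hβ, -, hv, -⟩ := exists_of_cup_ne_zero h
  rw [eq_of_delta_ne_zero hβ] at hv
  exact ⟨hσ, ρ, τ, hρ, hv, subset_rfl⟩

/-- The slant product with the fundamental cycle inverts the cap product up to homotopy. -/
theorem coboundary_homOp {n : ℕ} {k e : ℤ} {u : Simplex X × Simplex X → ℤ}
    (hu : u ∈ TensorCochain X n) (hdu : tensorCoboundary u = 0) {c : Simplex X → ℤ}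
    (hc : c ∈ CoarseChain X n) (hdc : boundary c = 0) (he : ∀ x, slant u c ⟨0, x⟩ = e)
    {φ : Simplex X → ℤ} (hφ : φ ∈ Cochain X k) (τ : Simplex X) :
    (-1) ^ n * coboundary (homOp hu hc φ) τ =
      homOp hu hc (coboundary φ) τ +
        slant u (transpose (cupLeft (sg (fun k => (-1) ^ k) φ)) c) τ -
        (-1) ^ ((n + 1) * τ.1) * φ τ * e := by
  have hK : hom φ u ∈ TensorCochain X (k + n - 1) := by
    refine (facesIn_hom φ u).mem hu fun s hs => ?_
    obtain ⟨ρ, α, β, hρ, h, -, -, -, hd⟩ := exists_of_hom_ne_zero hs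
    have h2 := hφ ρ hρ
    have h3 := hu.1 _ h
    simp only at h3
    omega
  have h := congrFun (slant_coboundary hK hc) τ
  have e0 : slant (hom φ u) (0 : Simplex X → ℤ) = 0 := by funext τ; simp [slant]
  rw [hdc, e0, zero_add, Pi.smul_apply, smul_eq_mul, Int.toNat_natCast] at h
  have e1 : ∀ x, slant u c x = if x.1 = 0 then e else 0 := by
    rintro ⟨_ | j, x⟩
    · exact he x
    · by_contra h0
      obtain ⟨σ, hσ, h1⟩ := exists_of_slant_ne_zero (by simpa using h0)
      have h2 := hc.1 σ hσ
      have h3 := hu.1 _ h1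
      simp only at h3
      omega
  -- Multiplication in the second factor passes through the slant product, where only the degree `0`
  -- cochain `u/c`, constantly `e`, remains. Multiplication in the first factor becomes a cap
  -- product by `slant_cap`.
  have e2 : slant (cupSnd φ u) c τ = (-1) ^ ((n + 1) * τ.1) * φ τ * e := by
    have h1 := cup_slant hu hc (sg (fun k => (-1) ^ ((n + 1) * k)) φ) τ
    rw [cup_const _ e _ he fun j s => by rw [e1]; simp] at h1
    refine Eq.trans (finsum_congr fun σ => ?_) h1.symm
    by_cases h0 : c σ = 0
    · rw [h0, zero_mul, zero_mul]
    · have h2 : σ.1 = n := by exact_mod_cast hc.1 σ h0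
      simp only [cupSnd, h2]
  change _ = slant (hom (coboundary φ) u) c τ + _ - _
  rw [← e2, slant_cap hu hc]
  refine h.symm.trans ?_
  rw [tensorCoboundary_hom φ hdu]
  simp only [slant, Pi.sub_apply, Pi.add_apply, mul_add, mul_sub]
  have f1 := (facesIn_hom (coboundary φ) u).finite hu hc τ
  have f2 := (facesIn_cupFst (sg (fun k => (-1) ^ k) φ) u).finite hu hc τ
  rw [finsum_sub_distrib _ ((facesIn_cupSnd φ u).finite hu hc τ), finsum_add_distrib f1 f2]
  exact (f1.union f2).subset (Function.support_add _ _)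

end Operators

/-! ### Sign identities, and the exchange of the two factors. -/

section Signs

theorem mul_finsum_int {α : Type*} (r : ℤ) (f : α → ℤ) : r * ∑ᶠ a, f a = ∑ᶠ a, r * f a :=
  smul_finsum r f

variable {X : Type*}

/-- The sign `(-1)^(k(k+3)/2)`. -/
def sgnQ (k : ℕ) : ℤ := (-1) ^ k * sgnP k

theorem sgnQ_mul_self (k : ℕ) : sgnQ k * sgnQ k = 1 := by
  rw [sgnQ]
  linear_combination ((-1) ^ k * (-1) ^ k) * sgnP_mul_self k + neg_one_pow_mul_self k

theorem sgnQ_succ (k : ℕ) : sgnQ (k + 1) = sgnP k := by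
  rw [sgnQ, sgnP, ← mul_assoc, neg_one_pow_mul_self, one_mul]

theorem sgnP_add (a b : ℕ) : sgnP (a + b) = sgnP a * sgnP b * (-1) ^ (a * b) := by
  induction a with
  | zero => simp [sgnP]
  | succ a ih =>
    rw [Nat.add_right_comm, sgnP, ih, sgnP]
    ring

theorem neg_one_pow_mul_succ (a : ℕ) : (-1 : ℤ) ^ (a * (a + 1)) = 1 :=
  (Nat.even_mul_succ_self a).neg_one_pow

/-- Here `a` is the degree of a cochain and `b` that of its cap product with an `(a + b)`-chain: the
signs of `p` and `q` combine to those in `coboundary_joinOp`. -/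
theorem sgnQ_mul_sgnQ_add (a b : ℕ) :
    sgnQ b * (sgnQ (a + b) * sgnP a) = (-1) ^ a * (-1) ^ ((a + b + 1) * a) := by
  have e : (-1 : ℤ) ^ ((a + b + 1) * a) = (-1) ^ (a * b) := by
    rw [show (a + b + 1) * a = a * (a + 1) + a * b by ring, pow_add, neg_one_pow_mul_succ, one_mul]
  rw [e, sgnQ, sgnQ, sgnP_add, pow_add]
  linear_combination ((-1) ^ a * (-1) ^ (a * b) * (-1) ^ b * (-1) ^ b * sgnP b * sgnP b) *
    sgnP_mul_self a + ((-1) ^ a * (-1) ^ (a * b) * (-1) ^ b * (-1) ^ b) * sgnP_mul_self b +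
    ((-1) ^ a * (-1) ^ (a * b)) * neg_one_pow_mul_self b

/-- Exchange of the two factors of `X ⊗ X`. -/
def tswap (u : Simplex X × Simplex X → ℤ) : Simplex X × Simplex X → ℤ :=
  fun s => (-1) ^ (s.1.1 * s.2.1) * u (s.2, s.1)

theorem coboundary_eq_zero {φ : Simplex X → ℤ} {σ : Simplex X} (h : σ.1 = 0) :
    coboundary φ σ = 0 := by
  obtain ⟨k, s⟩ := σ
  simp only at h
  subst h
  rfl

/-- With the Koszul sign in `tswap`, the two summands of the tensor coboundary change places up to a
common sign. -/
theorem tensorCoboundary_tswap {u : Simplex X × Simplex X → ℤ} (h : tensorCoboundary u = 0) :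
    tensorCoboundary (tswap u) = 0 := by
  funext ⟨σ, τ⟩
  have h1 := congrFun h (τ, σ)
  simp only [tensorCoboundary, Pi.zero_apply] at h1 ⊢
  have e1 : coboundary (fun ρ => tswap u (ρ, τ)) σ =
      (-1) ^ (σ.1 * τ.1) * (-1) ^ τ.1 * coboundary (fun ρ => u (τ, ρ)) σ := by
    refine (congrFun (coboundary_sg (fun k => (-1) ^ (k * τ.1)) fun ρ => u (τ, ρ)) σ).trans ?_
    simp only [sg]
    rcases h0 : σ.1 with _ | k
    · simp [coboundary_eq_zero h0]
    · rw [Nat.add_sub_cancel, add_mul, one_mul, pow_add]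
      linear_combination (-(-1) ^ (k * τ.1) * coboundary (fun ρ => u (τ, ρ)) σ) *
        neg_one_pow_mul_self τ.1
  have e2 : coboundary (fun ρ => tswap u (σ, ρ)) τ =
      (-1) ^ (σ.1 * τ.1) * (-1) ^ σ.1 * coboundary (fun ρ => u (ρ, σ)) τ := by
    refine (congrFun (coboundary_sg (fun k => (-1) ^ (σ.1 * k)) fun ρ => u (ρ, σ)) τ).trans ?_
    simp only [sg]
    rcases h0 : τ.1 with _ | k
    · simp [coboundary_eq_zero h0]
    · rw [Nat.add_sub_cancel, mul_add, mul_one, pow_add]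
      linear_combination (-(-1) ^ (σ.1 * k) * coboundary (fun ρ => u (ρ, σ)) τ) *
        neg_one_pow_mul_self σ.1
  rw [e1, e2]
  linear_combination (-1) ^ (σ.1 * τ.1) * h1 + (-1) ^ (σ.1 * τ.1) *
    coboundary (fun ρ => u (ρ, σ)) τ * neg_one_pow_mul_self σ.1

/-- Multiplication by a function of the dimension, as a homomorphism. -/
def sgHom (ε : ℕ → ℤ) : (Simplex X → ℤ) →+ (Simplex X → ℤ) := AddMonoidHom.mk' (sg ε) (sg_add ε)

theorem delta_mem (ρ : Simplex X) : delta ρ ∈ Cochain X (ρ.1 : ℤ) := fun σ hσ => by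
  rw [eq_of_delta_ne_zero hσ]

/-- The sign `(-1)^((n+1)k)`. -/
def sgnF (n k : ℕ) : ℤ := (-1) ^ ((n + 1) * k)

theorem sgnF_mul_self (n k : ℕ) : sgnF n k * sgnF n k = 1 := neg_one_pow_mul_self _

theorem coboundary_sgnF (n : ℕ) (φ : Simplex X → ℤ) :
    coboundary (sg (sgnF n) φ) = (-1 : ℤ) ^ (n + 1) • sg (sgnF n) (coboundary φ) := by
  rw [coboundary_sg]
  funext σ
  simp only [sg, Pi.smul_apply, smul_eq_mul]
  rcases h0 : σ.1 with _ | k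
  · simp [coboundary_eq_zero h0]
  · rw [Nat.add_sub_cancel, sgnF, sgnF, mul_add, mul_one, pow_add _ _ (n + 1)]
    linear_combination (-(-1) ^ ((n + 1) * k) * coboundary φ σ) * neg_one_pow_mul_self (n + 1)

variable [MetricSpace X]

theorem tswap_mem {n : ℤ} {u : Simplex X × Simplex X → ℤ} (hu : u ∈ TensorCochain X n) :
    tswap u ∈ TensorCochain X n := by
  refine mem_tensorCochain (fun s hs => ?_) fun R => ?_
  · have := hu.1 _ (right_ne_zero_of_mul hs)
    simp only at this
    omega
  · obtain ⟨R', hR'⟩ := TensorCochain.exists_within hu R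
    exact ⟨R', fun α β h hα hβ => (hR' β α (right_ne_zero_of_mul h) hβ hα).symm⟩

theorem CoarseChain.of_support {k : ℤ} {c c' : Simplex X → ℤ} (hc : c ∈ CoarseChain X k)
    (h : ∀ σ, c' σ ≠ 0 → c σ ≠ 0) : c' ∈ CoarseChain X k :=
  ⟨fun σ hσ => hc.1 σ (h σ hσ), fun B hB => (hc.2.1 B hB).subset fun σ hσ => ⟨h σ hσ.1, hσ.2⟩,
    hc.2.2.mono (Set.image_mono fun σ hσ => h σ hσ)⟩

theorem sg_mem_coarseChain {ε : ℕ → ℤ} {k : ℤ} {c : Simplex X → ℤ} (hc : c ∈ CoarseChain X k) :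
    sg ε c ∈ CoarseChain X k :=
  CoarseChain.of_support hc fun _ hσ => right_ne_zero_of_mul hσ

theorem IsLocal.comp_sgHom {T : (Simplex X → ℤ) →+ (Simplex X → ℤ)} (hT : IsLocal T)
    (ε : ℕ → ℤ) : IsLocal (T.comp (sgHom ε)) := by
  intro R
  obtain ⟨R', hR'⟩ := hT R
  refine ⟨R', fun σ hσ => ?_⟩
  obtain ⟨S, hS, hd⟩ := hR' σ hσ
  refine ⟨S, hS, fun ψ hψ => hd _ fun ρ hρ => ?_⟩
  change ε ρ.1 * ψ ρ = 0
  rw [hψ ρ hρ, mul_zero]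

theorem transpose_add {T : (Simplex X → ℤ) →+ (Simplex X → ℤ)} (hT : IsLocal T) {k : ℤ}
    {a b : Simplex X → ℤ} (ha : a ∈ CoarseChain X k) (hb : b ∈ CoarseChain X k) :
    transpose T (a + b) = transpose T a + transpose T b := by
  funext ρ
  simp only [transpose, Pi.add_apply, add_mul]
  exact finsum_add_distrib ((bddSupp_delta ρ).finite hT ha) ((bddSupp_delta ρ).finite hT hb)

end Signs

/-! ### Cap and slant products are inverse up to homotopy. -/

section Inverses

variable {X : Type*} [MetricSpace X] {n : ℕ} {u : Simplex X × Simplex X → ℤ} {c : Simplex X → ℤ}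

theorem slant_boundary {m : ℤ} (hu : u ∈ TensorCochain X n) (hdu : tensorCoboundary u = 0)
    {a : Simplex X → ℤ} (ha : a ∈ CoarseChain X m) :
    slant u (boundary a) = -((-1 : ℤ) ^ m.toNat • coboundary (slant u a)) := by
  have h := slant_coboundary hu ha
  have h0 : slant (0 : Simplex X × Simplex X → ℤ) a = 0 := by funext τ; simp [slant]
  rw [hdu, h0] at h
  exact eq_neg_of_add_eq_zero_left h.symm

/-- The relation `sgnQ (k + 1) = (-1)^k * sgnQ k` absorbs the sign of the Leibniz rule, so that `q`
commutes with the differentials exactly. -/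
theorem coboundary_slant {m : ℤ} (hu : u ∈ TensorCochain X n) (hdu : tensorCoboundary u = 0)
    {a : Simplex X → ℤ} (ha : a ∈ CoarseChain X m) :
    coboundary (slant u (sg sgnQ a)) = slant u (sg sgnQ (boundary a)) := by
  have h := slant_boundary hu hdu (sg_mem_coarseChain (ε := sgnQ) ha)
  rw [boundary_sg] at h
  funext τ
  have h1 := congrFun h τ
  simp only [Pi.neg_apply, Pi.smul_apply, smul_eq_mul] at h1
  have e : slant u (sg sgnQ (boundary a)) τ =
      -(-1) ^ m.toNat * slant u (sg (fun k => sgnQ (k + 1)) (boundary a)) τ := by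
    simp only [slant]
    rw [mul_finsum_int]
    refine finsum_congr fun σ => ?_
    by_cases h0 : boundary a σ = 0
    · simp [sg, h0]
    · have h2 := (boundary_mem (sub_add_cancel m 1) ha).1 σ h0
      have h3 : m.toNat = σ.1 + 1 := by omega
      simp only [sg]
      rw [h3, sgnQ_succ, sgnQ, pow_succ]
      ring
  rw [e, h1]
  linear_combination (-coboundary (slant u (sg sgnQ a)) τ) * neg_one_pow_mul_self m.toNat

/-- `p : C^*(X) → CX_(n-*)(X)`, the cap product with the fundamental cycle. -/
noncomputable def capOp (hc : c ∈ CoarseChain X n) : (Simplex X → ℤ) →+ (Simplex X → ℤ) :=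
  AddMonoidHom.mk' (fun φ => transpose (cupLeft (sg sgnP (sg (fun _ => sgnQ n) φ))) c)
    fun φ ψ => by
      funext ρ
      simp only [transpose, Pi.add_apply, sg_add]
      rw [← finsum_add_distrib ((bddSupp_delta ρ).finite (cupLeft_isLocal _) hc)
        ((bddSupp_delta ρ).finite (cupLeft_isLocal _) hc)]
      refine finsum_congr fun σ => ?_
      simp only [cupLeft, AddMonoidHom.mk'_apply, cup_add_left, Pi.add_apply, mul_add]

/-- The cap product in which the cochain is evaluated on the other end of the simplices. -/
noncomputable def capOp' (hc : c ∈ CoarseChain X n) : (Simplex X → ℤ) →+ (Simplex X → ℤ) :=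
  AddMonoidHom.mk' (fun φ => sg sgnP (transpose (cupRight (sg (fun _ => (-1) ^ n) φ)) c))
    fun φ ψ => by
      rw [← sg_add]
      congr 1
      funext ρ
      simp only [transpose, Pi.add_apply, sg_add]
      rw [← finsum_add_distrib ((bddSupp_delta ρ).finite (cupRight_isLocal _) hc)
        ((bddSupp_delta ρ).finite (cupRight_isLocal _) hc)]
      refine finsum_congr fun σ => ?_
      simp only [cupRight, AddMonoidHom.mk'_apply, cup_add_right, Pi.add_apply, mul_add]

theorem boundary_capOp (hc : c ∈ CoarseChain X n) (hdc : boundary c = 0) {k : ℤ}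
    {φ : Simplex X → ℤ} (hφ : φ ∈ Cochain X k) :
    boundary (capOp hc φ) = capOp hc (coboundary φ) := by
  refine (boundary_cap hc hdc (sg_mem hφ)).trans ?_
  rw [coboundary_sg]
  rfl

theorem boundary_capOp' (hc : c ∈ CoarseChain X n) (hdc : boundary c = 0) {k : ℤ}
    {φ : Simplex X → ℤ} (hφ : φ ∈ Cochain X k) :
    boundary (capOp' hc φ) = capOp' hc (coboundary φ) := by
  refine (boundary_cap' hc hdc (sg_mem hφ)).trans ?_
  rw [coboundary_sg]
  rfl

/-- The homotopy `F`. -/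
noncomputable def joinOp (hu : u ∈ TensorCochain X n) (hc : c ∈ CoarseChain X n) :
    (Simplex X → ℤ) →+ (Simplex X → ℤ) :=
  (homOp hu hc).comp (sgHom (sgnF n))

theorem joinOp_isLocal (hu : u ∈ TensorCochain X n) (hc : c ∈ CoarseChain X n) :
    IsLocal (joinOp hu hc) := (homOp_isLocal hu hc).comp_sgHom _

/-- This is `coboundary_homOp` applied to `sg (sgnF n) φ`; the twist cancels the sign in front of `φ
τ * e`. -/
theorem coboundary_joinOp (hu : u ∈ TensorCochain X n) (hdu : tensorCoboundary u = 0)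
    (hc : c ∈ CoarseChain X n) (hdc : boundary c = 0) {e : ℤ} (he : ∀ x, slant u c ⟨0, x⟩ = e)
    {k : ℤ} {φ : Simplex X → ℤ} (hφ : φ ∈ Cochain X k) (τ : Simplex X) :
    slant u (transpose (cupLeft (sg (fun k => (-1) ^ k) (sg (sgnF n) φ))) c) τ - φ τ * e =
      (-1) ^ n * (coboundary (joinOp hu hc φ) τ + joinOp hu hc (coboundary φ) τ) := by
  have h := coboundary_homOp hu hdu hc hdc he (sg_mem (ε := sgnF n) hφ) τ
  rw [coboundary_sgnF, map_zsmul, Pi.smul_apply, smul_eq_mul] at h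
  have h1 := sgnF_mul_self n τ.1
  change (-1) ^ n * coboundary (joinOp hu hc φ) τ =
    (-1) ^ (n + 1) * joinOp hu hc (coboundary φ) τ + _ - sgnF n τ.1 * (sgnF n τ.1 * φ τ) * e at h
  rw [pow_succ] at h
  linear_combination φ τ * e * h1 - h

/-- In a splitting of an `n`-simplex of `c` the two degrees add up to `n`, so `sgnQ_mul_sgnQ_add`
applies. The constant `sgnQ n` in `capOp` was put there for this. -/
theorem slant_capOp (hc : c ∈ CoarseChain X n) (φ : Simplex X → ℤ) :
    sg sgnQ (capOp hc φ) =
      transpose (cupLeft (sg (fun k => (-1) ^ k) (sg (sgnF n) φ))) c := by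
  funext ρ
  change sgnQ ρ.1 * transpose (cupLeft (sg sgnP (sg (fun _ => sgnQ n) φ))) c ρ = _
  simp only [transpose]
  rw [mul_finsum_int]
  refine finsum_congr fun σ => ?_
  by_cases h0 : c σ = 0
  · simp [h0]
  · have h1 : σ.1 = n := by exact_mod_cast hc.1 σ h0
    rw [mul_left_comm]
    congr 1
    refine (cup_congr fun α β _ _ hd => ?_).symm
    by_cases h2 : β = ρ
    · subst h2
      have h3 := sgnQ_mul_sgnQ_add α.1 β.1
      rw [hd, h1] at h3
      simp only [sg, sgnF]
      linear_combination (-φ α * delta β β) * h3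
    · simp [delta_of_ne h2]

theorem slant_capOp_sub (hu : u ∈ TensorCochain X n) (hdu : tensorCoboundary u = 0)
    (hc : c ∈ CoarseChain X n) (hdc : boundary c = 0) (he : ∀ x, slant u c ⟨0, x⟩ = 1)
    {k : ℤ} {φ : Simplex X → ℤ} (hφ : φ ∈ Cochain X k) :
    slant u (sg sgnQ (capOp hc φ)) - φ =
      coboundary (joinOp hu hc (sg (fun _ => (-1) ^ n) φ)) +
        joinOp hu hc (sg (fun _ => (-1) ^ n) (coboundary φ)) := by
  funext τ
  have h := coboundary_joinOp hu hdu hc hdc he hφ τ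
  have e : ∀ ψ : Simplex X → ℤ, sg (fun _ => (-1) ^ n) ψ = (-1 : ℤ) ^ n • ψ := fun _ => rfl
  have e' : ∀ ψ : Simplex X → ℤ, coboundary ((-1 : ℤ) ^ n • ψ) = (-1 : ℤ) ^ n • coboundary ψ :=
    fun ψ => coboundary_sg (fun _ => (-1) ^ n) ψ
  rw [slant_capOp, e, e, map_zsmul, map_zsmul, e']
  simp only [Pi.sub_apply, Pi.add_apply, Pi.smul_apply, smul_eq_mul]
  linear_combination h

/-- Both sides are the double sum over `σ` in `a` and `τ` in `c` of `delta ρ ∪ u(σ, ·)` evaluated at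
`τ`, up to sign. Hence the transpose of capping and then slanting with `tswap u` is slanting with
`u` and then capping from the other side. -/
theorem finsum_slant_tswap {m : ℤ} (hu : u ∈ TensorCochain X n) (hc : c ∈ CoarseChain X n)
    {a : Simplex X → ℤ} (ha : a ∈ CoarseChain X m) (ρ : Simplex X) :
    ∑ᶠ σ, a σ * slant (tswap u)
        (transpose (cupLeft (sg (fun k => (-1) ^ k) (sg (sgnF n) (delta ρ)))) c) σ =
      sgnP ρ.1 * ∑ᶠ τ, c τ * cup (delta ρ) (slant u (sg sgnQ a)) τ := by
  have hA : {τ | c τ ≠ 0 ∧ verts ρ ⊆ verts τ}.Finite :=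
    (CoarseChain.finite_near hc (ρ.2 0) 0).subset fun τ h =>
      ⟨h.1, ρ.2 0, h.2 (zero_mem_verts ρ), (dist_self _).le⟩
  have key : ∀ σ τ, a σ * (c τ * cup (sg (fun k => (-1) ^ k) (sg (sgnF n) (delta ρ)))
      (fun β => tswap u (β, σ)) τ) =
      sgnP ρ.1 * c τ * (sg sgnQ a σ * cup (delta ρ) (fun β => u (σ, β)) τ) := by
    intro σ τ
    by_cases h0 : c τ = 0
    · simp [h0]
    · have h1 : τ.1 = n := by exact_mod_cast hc.1 τ h0
      have h2 : cup (sg (fun k => (-1) ^ k) (sg (sgnF n) (delta ρ)))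
          (fun β => tswap u (β, σ)) τ =
          sgnP ρ.1 * sgnQ σ.1 * cup (delta ρ) (fun β => u (σ, β)) τ := by
        refine cup_congr fun α β _ _ hd => ?_
        by_cases h3 : α = ρ
        · subst h3
          by_cases h4 : u (σ, β) = 0
          · simp [tswap, h4]
          · have h5 := hu.1 _ h4
            simp only at h5
            -- Both `σ` and `α = ρ` have dimension complementary to that of `β`; so a sign in the
            -- dimension of `σ` can be traded for one in that of `ρ`.
            have h6 : σ.1 = α.1 := by omega
            have h7 : n = β.1 + α.1 := by omega
            simp only [sg, tswap, sgnF, h6, h7, sgnQ]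
            have h8 : (-1 : ℤ) ^ ((β.1 + α.1 + 1) * α.1) = (-1) ^ (β.1 * α.1) := by
              rw [show (β.1 + α.1 + 1) * α.1 = α.1 * (α.1 + 1) + β.1 * α.1 by ring, pow_add,
                neg_one_pow_mul_succ, one_mul]
            rw [h8]
            linear_combination ((-1) ^ α.1 * delta α α * u (σ, β)) *
              (neg_one_pow_mul_self (β.1 * α.1) - sgnP_mul_self α.1)
        · simp [sg, delta_of_ne h3]
      rw [h2, sg]
      ring
  have f : ∀ τ, (Function.support fun σ =>
      sg sgnQ a σ * cup (delta ρ) (fun β => u (σ, β)) τ).Finite := fun τ =>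
    (faces_finite hu ha τ).subset fun σ hσ => by
      obtain ⟨-, β, -, hβ, -, hv, -⟩ := exists_of_cup_ne_zero (right_ne_zero_of_mul hσ)
      exact ⟨right_ne_zero_of_mul (left_ne_zero_of_mul hσ), σ, β, hβ, subset_rfl, hv⟩
  have e1 : ∀ σ, a σ * slant (tswap u)
      (transpose (cupLeft (sg (fun k => (-1) ^ k) (sg (sgnF n) (delta ρ)))) c) σ =
      ∑ τ ∈ hA.toFinset,
        sgnP ρ.1 * c τ * (sg sgnQ a σ * cup (delta ρ) (fun β => u (σ, β)) τ) := by
    intro σ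
    rw [slant_cap (tswap_mem hu) hc, finsum_eq_finsetSum_of_support_subset (s := hA.toFinset),
      Finset.mul_sum]
    · exact Finset.sum_congr rfl fun τ _ => key σ τ
    · intro τ hτ
      rw [Set.Finite.coe_toFinset]
      obtain ⟨α, -, hα, -, hv, -, -⟩ := exists_of_cup_ne_zero (right_ne_zero_of_mul hτ)
      have h2 := right_ne_zero_of_mul (right_ne_zero_of_mul hα)
      rw [eq_of_delta_ne_zero h2] at hv
      exact ⟨left_ne_zero_of_mul hτ, hv⟩
  rw [finsum_congr e1, finsum_sum_comm _ _ fun τ _ =>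
    (f τ).subset fun σ hσ => right_ne_zero_of_mul hσ,
    finsum_eq_finsetSum_of_support_subset (s := hA.toFinset), Finset.mul_sum]
  · refine Finset.sum_congr rfl fun τ _ => ?_
    rw [← mul_finsum_int, cup_slant hu (sg_mem_coarseChain ha), mul_assoc]
  · intro τ hτ
    rw [Set.Finite.coe_toFinset]
    obtain ⟨α, -, hα, -, hv, -, -⟩ := exists_of_cup_ne_zero (right_ne_zero_of_mul hτ)
    rw [eq_of_delta_ne_zero hα] at hv
    exact ⟨left_ne_zero_of_mul hτ, hv⟩

/-- The homotopy for the other composition, as a transpose. -/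
noncomputable def joinOpT (hu : u ∈ TensorCochain X n) (hc : c ∈ CoarseChain X n)
    (a : Simplex X → ℤ) : Simplex X → ℤ := transpose (joinOp (tswap_mem hu) hc) a

theorem joinOpT_mem {m l : ℤ} (hl : m + 1 = l) (hu : u ∈ TensorCochain X n)
    (hc : c ∈ CoarseChain X n) {a : Simplex X → ℤ} (ha : a ∈ CoarseChain X m) :
    joinOpT hu hc a ∈ CoarseChain X l := by
  refine transpose_mem (joinOp_isLocal _ hc) ha fun σ ρ hσ hρ => ?_
  have h := homOp_mem (tswap_mem hu) hc (sg_mem (ε := sgnF n) (delta_mem ρ))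
    (sub_add_cancel _ 1) σ hρ
  have := ha.1 σ hσ
  omega

/-- The identity `coboundary_joinOp` for `tswap u` and `delta ρ`, paired with the chain `a`; the two
homotopy terms become those of the transpose. -/
theorem boundary_joinOpT {m : ℤ} (hu : u ∈ TensorCochain X n) (hdu : tensorCoboundary u = 0)
    (hc : c ∈ CoarseChain X n) (hdc : boundary c = 0) {e : ℤ}
    (he : ∀ x, slant (tswap u) c ⟨0, x⟩ = e) {a : Simplex X → ℤ} (ha : a ∈ CoarseChain X m)
    (ρ : Simplex X) :
    sgnP ρ.1 * ∑ᶠ τ, c τ * cup (delta ρ) (slant u (sg sgnQ a)) τ - e * a ρ =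
      (-1) ^ n * (boundary (joinOpT hu hc a) ρ + joinOpT hu hc (boundary a) ρ) := by
  have hT := joinOp_isLocal (tswap_mem hu) hc
  have f1 := (bddSupp_delta ρ).coboundary.finite hT ha
  have f2 : (Function.support fun σ =>
      a σ * coboundary (joinOp (tswap_mem hu) hc (delta ρ)) σ).Finite := by
    obtain ⟨R, hR⟩ := CoarseChain.exists_within ha
    obtain ⟨R', hR'⟩ := hT R
    refine (CoarseChain.finite_near ha (ρ.2 0) R').subset fun σ hσ => ?_
    have h1 := left_ne_zero_of_mul hσ
    obtain ⟨τ, hτ, hv, -⟩ := coboundary_ne_zero (right_ne_zero_of_mul hσ)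
    obtain ⟨S, hS, hd⟩ := hR' τ ((hR σ h1).subset hv hv)
    exact ⟨h1, τ.2 0, hv (zero_mem_verts τ),
      hS ρ (hd.mem hτ) _ (zero_mem_verts τ) _ (zero_mem_verts ρ)⟩
  have h : ∀ σ, a σ * slant (tswap u)
      (transpose (cupLeft (sg (fun k => (-1) ^ k) (sg (sgnF n) (delta ρ)))) c) σ =
      (-1) ^ n * (a σ * joinOp (tswap_mem hu) hc (coboundary (delta ρ)) σ +
        a σ * coboundary (joinOp (tswap_mem hu) hc (delta ρ)) σ) + e * (a σ * delta ρ σ) := by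
    intro σ
    linear_combination a σ * coboundary_joinOp (tswap_mem hu) (tensorCoboundary_tswap hdu) hc hdc
      he (delta_mem ρ) σ
  have f3 : (Function.support fun σ => a σ * delta ρ σ).Finite :=
    (Set.finite_singleton ρ).subset fun σ hσ => eq_of_delta_ne_zero (right_ne_zero_of_mul hσ)
  have f12 := (f1.union f2).subset (Function.support_add _ _)
  rw [← finsum_slant_tswap hu hc ha, finsum_congr h, finsum_add_distrib
    (f12.subset fun σ hσ => right_ne_zero_of_mul hσ) (f3.subset fun σ hσ => right_ne_zero_of_mul hσ),
    ← mul_finsum_int, ← mul_finsum_int, finsum_mul_delta, finsum_add_distrib f1 f2]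
  rw [show boundary (joinOpT hu hc a) ρ = _ from
      boundary_transpose hT ha (joinOpT_mem rfl hu hc ha) ρ,
    show joinOpT hu hc (boundary a) ρ = _ from transpose_boundary hT ha ρ]
  ring

/-- The slant product of a cocycle and a cycle of the same degree is constant. -/
theorem exists_slant_eq (hu : u ∈ TensorCochain X n) (hdu : tensorCoboundary u = 0)
    (hc : c ∈ CoarseChain X n) (hdc : boundary c = 0) : ∃ e, ∀ x, slant u c ⟨0, x⟩ = e := by
  have h := slant_boundary hu hdu hc
  have h0 : slant u (0 : Simplex X → ℤ) = 0 := by funext τ; simp [slant]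
  rw [hdc, h0, eq_comm, neg_eq_zero, smul_eq_zero] at h
  have h1 := h.resolve_left (pow_ne_zero _ (by norm_num))
  have h2 : ∀ s : Fin 2 → X, slant u c (face 0 s) = slant u c (face 1 s) := by
    intro s
    have h3 := congrFun h1 ⟨1, s⟩
    change ∑ i : Fin 2, (-1 : ℤ) ^ (i : ℕ) * slant u c (face i s) = 0 at h3
    rw [Fin.sum_univ_two] at h3
    simp only [Fin.val_zero, Fin.val_one, pow_zero, pow_one] at h3
    linear_combination h3
  rcases isEmpty_or_nonempty (Fin 1 → X) with hX | ⟨⟨y⟩⟩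
  · exact ⟨0, fun x => isEmptyElim x⟩
  · refine ⟨slant u c ⟨0, y⟩, fun x => ?_⟩
    have h3 := h2 ![y 0, x 0]
    have e1 : face 0 ![y 0, x 0] = (⟨0, x⟩ : Simplex X) := by
      simp only [face]
      congr 1
      funext i
      fin_cases i
      rfl
    have e2 : face 1 ![y 0, x 0] = (⟨0, y⟩ : Simplex X) := by
      simp only [face]
      congr 1
      funext i
      fin_cases i
      rfl
    rwa [e1, e2] at h3

/-- By `exists_slant_eq` the value is a constant `e`. For `a = c` the homotopy formula says that
`((-1)^n - e) • c` is a boundary up to sign. Slanting with `u` turns `c` into `1` and a boundary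
into a coboundary, which vanishes on `0`-simplices; so `e = (-1)^n`. -/
theorem slant_tswap_eq (hu : u ∈ TensorCochain X n) (hdu : tensorCoboundary u = 0)
    (hc : c ∈ CoarseChain X n) (hdc : boundary c = 0) (he : slant u c = oneCochain X) (x) :
    slant (tswap u) c ⟨0, x⟩ = (-1) ^ n := by
  obtain ⟨e, he'⟩ := exists_slant_eq (tswap_mem hu) (tensorCoboundary_tswap hdu) hc hdc
  rw [he']
  have h1 : slant u (sg sgnQ c) = fun σ => sgnQ n * oneCochain X σ := by
    rw [← he]
    funext τ
    simp only [slant]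
    rw [mul_finsum_int]
    refine finsum_congr fun σ => ?_
    by_cases h0 : c σ = 0
    · simp [sg, h0]
    · have h1 : σ.1 = n := by exact_mod_cast hc.1 σ h0
      simp only [sg, h1]
      ring
  have h2 : ∀ ρ, ((-1) ^ n - e) * c ρ = (-1) ^ n * boundary (joinOpT hu hc c) ρ := by
    intro ρ
    have h := boundary_joinOpT hu hdu hc hdc he' hc ρ
    have h3 : joinOpT hu hc (boundary c) ρ = 0 := by
      rw [hdc, joinOpT, transpose_zero]
      rfl
    rw [h1, h3, add_zero, cup_const (delta ρ) (sgnQ n) _ (fun x => by simp [oneCochain])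
      (fun k s => by simp [oneCochain])] at h
    have h4 : ∑ᶠ τ, c τ * (delta ρ τ * sgnQ n) = c ρ * sgnQ n := by
      rw [finsum_eq_single _ ρ fun σ h => by rw [delta_of_ne h, zero_mul, mul_zero], delta_self,
        one_mul]
    rw [h4] at h
    rw [← h]
    by_cases h0 : c ρ = 0
    · simp [h0]
    · have h5 : ρ.1 = n := by exact_mod_cast hc.1 ρ h0
      rw [h5, sgnQ]
      linear_combination (-(-1) ^ n * c ρ) * sgnP_mul_self n
  have h3 : ((-1) ^ n - e) * slant u c ⟨0, x⟩ =
      (-1) ^ n * slant u (boundary (joinOpT hu hc c)) ⟨0, x⟩ := by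
    simp only [slant]
    rw [mul_finsum_int, mul_finsum_int]
    refine finsum_congr fun σ => ?_
    rw [← mul_assoc, h2, mul_assoc]
  rw [slant_boundary hu hdu (joinOpT_mem rfl hu hc hc), he] at h3
  simp only [oneCochain, Pi.neg_apply, Pi.smul_apply, coboundary_eq_zero, smul_zero, neg_zero,
    mul_zero, if_true, mul_one] at h3
  exact (sub_eq_zero.1 h3).symm

theorem capOp'_slant_sub {m : ℤ} (hu : u ∈ TensorCochain X n) (hdu : tensorCoboundary u = 0)
    (hc : c ∈ CoarseChain X n) (hdc : boundary c = 0) (he : slant u c = oneCochain X)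
    {a : Simplex X → ℤ} (ha : a ∈ CoarseChain X m) :
    capOp' hc (slant u (sg sgnQ a)) - a =
      boundary (joinOpT hu hc a) + joinOpT hu hc (boundary a) := by
  funext ρ
  have h := boundary_joinOpT hu hdu hc hdc (slant_tswap_eq hu hdu hc hdc he) ha ρ
  have e1 : capOp' hc (slant u (sg sgnQ a)) ρ =
      (-1) ^ n * (sgnP ρ.1 * ∑ᶠ τ, c τ * cup (delta ρ) (slant u (sg sgnQ a)) τ) := by
    change sgnP ρ.1 * transpose (cupRight (sg (fun _ => (-1) ^ n) _)) c ρ = _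
    rw [mul_left_comm]
    congr 1
    rw [mul_finsum_int]
    refine finsum_congr fun τ => ?_
    rw [mul_left_comm]
    congr 1
    exact cup_congr fun α β _ _ _ => by simp only [sg]; ring
  rw [Pi.sub_apply, Pi.add_apply, e1]
  linear_combination (-1) ^ n * h + (boundary (joinOpT hu hc a) ρ + joinOpT hu hc (boundary a) ρ +
    a ρ) * neg_one_pow_mul_self n

end Inverses

/-! ### An orientation pair yields a coarse duality. -/

section Duality

variable {X : Type*} [MetricSpace X] {n : ℕ} {u : Simplex X × Simplex X → ℤ} {c : Simplex X → ℤ}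

theorem capOp_mem {k m : ℤ} (h : k + m = n) (hc : c ∈ CoarseChain X n) {φ : Simplex X → ℤ}
    (hφ : φ ∈ Cochain X k) : capOp hc φ ∈ CoarseChain X m :=
  cap_mem h hc (sg_mem (sg_mem hφ))

theorem capOp'_mem {k m : ℤ} (h : k + m = n) (hc : c ∈ CoarseChain X n) {φ : Simplex X → ℤ}
    (hφ : φ ∈ Cochain X k) : capOp' hc φ ∈ CoarseChain X m :=
  sg_mem_coarseChain (cap_mem' h hc (sg_mem hφ))

/-- `q : CX_(n-*)(X) → C^*(X)`, the slant product with the diagonal cocycle. -/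
noncomputable def slantOp (u : Simplex X × Simplex X → ℤ) (a : Simplex X → ℤ) : Simplex X → ℤ :=
  slant u (sg sgnQ a)

theorem slantOp_mem {k m : ℤ} (h : k + m = n) (hu : u ∈ TensorCochain X n) {a : Simplex X → ℤ}
    (ha : a ∈ CoarseChain X m) : slantOp u a ∈ Cochain X k :=
  (slant_mem (by omega) hu (sg_mem_coarseChain ha)).1

theorem slantOp_add {m : ℤ} (hu : u ∈ TensorCochain X n) {a b : Simplex X → ℤ}
    (ha : a ∈ CoarseChain X m) (hb : b ∈ CoarseChain X m) :
    slantOp u (a + b) = slantOp u a + slantOp u b := by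
  rw [slantOp, sg_add, slant_add_right hu (sg_mem_coarseChain ha) (sg_mem_coarseChain hb)]
  rfl

theorem slantOp_nearSupp {m : ℤ} (hu : u ∈ TensorCochain X n) {a : Simplex X → ℤ}
    (ha : a ∈ CoarseChain X m) : NearSupp (slantOp u a) a :=
  (slant_nearSupp hu (sg_mem_coarseChain ha)).trans
    (nearSupp_of_imp fun _ h => right_ne_zero_of_mul h)

/-- The homotopy from `qp` to the identity. -/
noncomputable def homotopyF (hu : u ∈ TensorCochain X n) (hc : c ∈ CoarseChain X n) :
    (Simplex X → ℤ) →+ (Simplex X → ℤ) :=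
  (joinOp hu hc).comp (sgHom fun _ => (-1) ^ n)

theorem homotopyF_mem {k l : ℤ} (hl : l + 1 = k) (hu : u ∈ TensorCochain X n)
    (hc : c ∈ CoarseChain X n) {φ : Simplex X → ℤ} (hφ : φ ∈ Cochain X k) :
    homotopyF hu hc φ ∈ Cochain X l :=
  homOp_mem hu hc (sg_mem (ε := sgnF n) (sg_mem (ε := fun _ => (-1) ^ n) hφ)) hl

theorem homotopyF_nearSupp (hu : u ∈ TensorCochain X n) (hc : c ∈ CoarseChain X n)
    (φ : Simplex X → ℤ) : NearSupp (homotopyF hu hc φ) φ :=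
  ((joinOp_isLocal hu hc).comp_sgHom _).nearSupp φ

/-- The homotopy from `pq` to the identity. -/
noncomputable def homotopyG (hu : u ∈ TensorCochain X n) (hc : c ∈ CoarseChain X n)
    (a : Simplex X → ℤ) : Simplex X → ℤ :=
  joinOpT hu hc a + capOp' hc (homotopyF hu hc (slantOp u a)) +
    -joinOpT hu hc (capOp hc (slantOp u a))

theorem homotopyG_mem {m l : ℤ} (hl : m + 1 = l) (hu : u ∈ TensorCochain X n)
    (hc : c ∈ CoarseChain X n) {a : Simplex X → ℤ} (ha : a ∈ CoarseChain X m) :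
    homotopyG hu hc a ∈ CoarseChain X l := by
  have hq := slantOp_mem (sub_add_cancel (n : ℤ) m) hu ha
  exact add_mem (add_mem (joinOpT_mem hl hu hc ha)
    (capOp'_mem (by omega) hc (homotopyF_mem (sub_add_cancel _ 1) hu hc hq)))
    (neg_mem (joinOpT_mem hl hu hc (capOp_mem (sub_add_cancel (n : ℤ) m) hc hq)))

theorem joinOpT_add {m : ℤ} (hu : u ∈ TensorCochain X n) (hc : c ∈ CoarseChain X n)
    {a b : Simplex X → ℤ} (ha : a ∈ CoarseChain X m) (hb : b ∈ CoarseChain X m) :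
    joinOpT hu hc (a + b) = joinOpT hu hc a + joinOpT hu hc b :=
  transpose_add (joinOp_isLocal _ hc) ha hb

theorem homotopyG_add {m : ℤ} (hu : u ∈ TensorCochain X n) (hc : c ∈ CoarseChain X n)
    {a b : Simplex X → ℤ} (ha : a ∈ CoarseChain X m) (hb : b ∈ CoarseChain X m) :
    homotopyG hu hc (a + b) = homotopyG hu hc a + homotopyG hu hc b := by
  have h := sub_add_cancel (n : ℤ) m
  rw [homotopyG, slantOp_add hu ha hb, map_add, map_add, map_add, joinOpT_add hu hc ha hb,
    joinOpT_add hu hc (capOp_mem h hc (slantOp_mem h hu ha))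
      (capOp_mem h hc (slantOp_mem h hu hb)), homotopyG, homotopyG]
  abel

theorem homotopyG_nearSupp {m : ℤ} (hu : u ∈ TensorCochain X n) (hc : c ∈ CoarseChain X n)
    {a : Simplex X → ℤ} (ha : a ∈ CoarseChain X m) : NearSupp (homotopyG hu hc a) a := by
  have h := sub_add_cancel (n : ℤ) m
  have hT := joinOp_isLocal (tswap_mem hu) hc
  have hq := slantOp_nearSupp hu ha
  have hcap : ∀ (ε η : ℕ → ℤ) (φ : Simplex X → ℤ), NearSupp (sg ε (sg η φ)) φ := fun ε η φ =>
    nearSupp_of_imp fun _ h => right_ne_zero_of_mul (right_ne_zero_of_mul h)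
  refine ((transpose_nearSupp hT ha).add ?_).add (NearSupp.mono (ψ := joinOpT hu hc
    (capOp hc (slantOp u a))) ?_ fun σ hσ => by simpa using hσ)
  · refine NearSupp.trans ?_ ((homotopyF_nearSupp hu hc _).trans hq)
    refine NearSupp.mono ((cap_nearSupp' hc _).trans
      (nearSupp_of_imp fun _ h => right_ne_zero_of_mul h)) fun σ h => right_ne_zero_of_mul h
  · exact (transpose_nearSupp hT (capOp_mem h hc (slantOp_mem h hu ha))).trans
      (((cap_nearSupp hc _).trans (hcap _ _ _)).trans hq)

theorem boundary_neg {m : ℤ} {a : Simplex X → ℤ} (ha : a ∈ CoarseChain X m) :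
    boundary (-a) = -boundary a := by
  have h := map_neg (CoarseChain.d m (m - 1) (sub_add_cancel m 1)) (⟨a, ha⟩ : CoarseChain X m)
  exact congrArg Subtype.val h

theorem slantOp_capOp_sub (hu : u ∈ TensorCochain X n) (hdu : tensorCoboundary u = 0)
    (hc : c ∈ CoarseChain X n) (hdc : boundary c = 0) (he : slant u c = oneCochain X)
    {k : ℤ} {φ : Simplex X → ℤ} (hφ : φ ∈ Cochain X k) :
    slantOp u (capOp hc φ) - φ =
      coboundary (homotopyF hu hc φ) + homotopyF hu hc (coboundary φ) :=
  slant_capOp_sub hu hdu hc hdc (fun x => by rw [he]; rfl) hφ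

/-- Write `p'` for `capOp'`. From `q p ≃ 1` and `p' q ≃ 1` one gets `p q ≃ p' q p q ≃ p' q ≃ 1`, and
the three terms of `homotopyG` are the homotopies for these steps. -/
theorem capOp_slantOp_sub {m : ℤ} (hu : u ∈ TensorCochain X n) (hdu : tensorCoboundary u = 0)
    (hc : c ∈ CoarseChain X n) (hdc : boundary c = 0) (he : slant u c = oneCochain X)
    {a : Simplex X → ℤ} (ha : a ∈ CoarseChain X m) :
    capOp hc (slantOp u a) - a = boundary (homotopyG hu hc a) + homotopyG hu hc (boundary a) := by
  have h := sub_add_cancel (n : ℤ) m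
  have hq := slantOp_mem h hu ha
  have hp := capOp_mem h hc hq
  have hF := homotopyF_mem (sub_add_cancel _ 1) hu hc hq
  have hpF := capOp'_mem (m := m + 1) (by omega) hc hF
  have e1 := capOp'_slant_sub hu hdu hc hdc he ha
  have e2 := capOp'_slant_sub hu hdu hc hdc he hp
  have e3 := congrArg (capOp' hc) (slantOp_capOp_sub hu hdu hc hdc he hq)
  have e4 := boundary_capOp' hc hdc hF
  have e5 : boundary (capOp hc (slantOp u a)) = capOp hc (slantOp u (boundary a)) := by
    rw [boundary_capOp hc hdc hq]
    congr 1
    exact coboundary_slant hu hdu ha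
  have e6 : coboundary (slantOp u a) = slantOp u (boundary a) := coboundary_slant hu hdu ha
  rw [map_sub, map_add, ← e4, e6] at e3
  change capOp' hc (slantOp u a) - a = _ at e1
  change capOp' hc (slantOp u (capOp hc (slantOp u a))) - _ = _ at e2
  rw [e5] at e2
  rw [homotopyG, homotopyG, boundary_add (add_mem (joinOpT_mem rfl hu hc ha) hpF)
    (neg_mem (joinOpT_mem rfl hu hc hp)), boundary_add (joinOpT_mem rfl hu hc ha) hpF,
    boundary_neg (joinOpT_mem rfl hu hc hp)]
  -- The telescoping `p q - 1 = (p' q - 1) - (p' q p q - p q) + p' (q p q - q)`.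
  have e := congrArg₂ (· + ·) (congrArg₂ (· - ·) e1 e2) e3
  rw [show capOp hc (slantOp u a) - a = _ from (by abel : _ =
    capOp' hc (slantOp u a) - a -
      (capOp' hc (slantOp u (capOp hc (slantOp u a))) - capOp hc (slantOp u a)) +
      (capOp' hc (slantOp u (capOp hc (slantOp u a))) - capOp' hc (slantOp u a))), e]
  abel

theorem isCoarsePD_of_slant_eq (hu : u ∈ TensorCochain X n) (hdu : tensorCoboundary u = 0)
    (hc : c ∈ CoarseChain X n) (hdc : boundary c = 0) (he : slant u c = oneCochain X) :
    IsCoarsePD X n := by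
  have hcap : ∀ φ : Simplex X → ℤ, NearSupp (capOp hc φ) φ := fun φ =>
    (cap_nearSupp hc _).trans
      (nearSupp_of_imp fun _ h => right_ne_zero_of_mul (right_ne_zero_of_mul h))
  exact ⟨{
    p := fun k m h => AddMonoidHom.mk' (fun φ => ⟨capOp hc φ.1, capOp_mem h hc φ.2⟩)
      fun φ ψ => Subtype.ext (map_add (capOp hc) φ.1 ψ.1)
    q := fun k m h => AddMonoidHom.mk' (fun a => ⟨slantOp u a.1, slantOp_mem h hu a.2⟩)
      fun a b => Subtype.ext (slantOp_add hu a.2 b.2)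
    F := fun k => AddMonoidHom.mk' (fun φ => ⟨homotopyF hu hc φ.1, homotopyF_mem rfl hu hc φ.2⟩)
      fun φ ψ => Subtype.ext (map_add (homotopyF hu hc) φ.1 ψ.1)
    G := fun m => AddMonoidHom.mk' (fun a => ⟨homotopyG hu hc a.1, homotopyG_mem rfl hu hc a.2⟩)
      fun a b => Subtype.ext (homotopyG_add hu hc a.2 b.2)
    p_comm := fun k m h h' φ => Subtype.ext (boundary_capOp hc hdc φ.2)
    q_comm := fun k m h h' a => Subtype.ext (coboundary_slant hu hdu a.2)
    homotopy_F := fun k m h φ => Subtype.ext (slantOp_capOp_sub hu hdu hc hdc he φ.2)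
    homotopy_G := fun k m h a => Subtype.ext (capOp_slantOp_sub hu hdu hc hdc he a.2)
    supp_p := fun k m h φ => (hcap φ.1).coarselyContained (capOp_mem h hc φ.2)
    supp_F := fun k φ => (homotopyF_nearSupp hu hc φ.1).coarseInterContained
    supp_q := fun k m h a => (slantOp_nearSupp hu a.2).coarseInterContained
    supp_G := fun m a => (homotopyG_nearSupp hu hc a.2).coarselyContained
      (homotopyG_mem rfl hu hc a.2) }⟩

theorem isCoarsePD_of_isOrientationPair {U : TensorCohomology X n} {z : CoarseHomology X n}
    (h : IsOrientationPair (n : ℤ) U z) : IsCoarsePD X n := by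
  induction U using QuotientAddGroup.induction_on with | H φ => ?_
  induction z using QuotientAddGroup.induction_on with | H a => ?_
  have h1 := QuotientAddGroup.eq.1 h
  obtain ⟨η, hη⟩ := AddSubgroup.mem_addSubgroupOf.1 h1
  -- There are no cochains of degree `-1`, so equality of classes in degree `0` is equality of
  -- cocycles.
  have h2 : η = 0 := Subtype.ext (funext fun σ => by
    by_contra h0
    have := η.2.1 σ h0
    omega)
  rw [h2, map_zero] at hη
  have h3 : (-(slantCocycle (n : ℤ) n 0 (add_zero _) φ a) + oneCocycle X).1.1 = 0 :=
    congrArg Subtype.val hη.symm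
  have h4 : -slant φ.1.1 a.1.1 + oneCochain X = 0 := h3
  exact isCoarsePD_of_slant_eq φ.1.2 (congrArg Subtype.val φ.2) a.1.2 (congrArg Subtype.val a.2)
    (neg_add_eq_zero.1 h4)

end Duality

/-! ## Homomorphisms out of the Baer--Specker group -/

section Specker

/-- Choose a coordinate `j i` where the image of the `i`-th unit vector is non-zero, and integers `N
i`, each dividing the next, with `N (i + 1) / N i` larger than the absolute value there. Two of the
uncountably many sequences with entries `0` or `N i` have the same image. If `i` is their first
difference, then `N (i + 1)` divides `± N i` times that non-zero entry, which is too small. -/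
theorem false_of_countable_range {ι : Type*} (f : (ℕ → ℤ) →+ (ι → ℤ))
    (hr : (Set.range f).Countable) (hf : ∀ i, f (Pi.single i 1) ≠ 0) : False := by
  have hj : ∀ i, ∃ j, f (Pi.single i 1) j ≠ 0 := fun i => Function.ne_iff.1 (hf i)
  choose j hj using hj
  let N : ℕ → ℤ := fun i => Nat.rec 1 (fun k x => x * (|f (Pi.single k 1) (j k)| + 1)) i
  have hN : ∀ i, N (i + 1) = N i * (|f (Pi.single i 1) (j i)| + 1) := fun i => rfl
  have hpos : ∀ i, 0 < N i := by
    intro i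
    induction i with
    | zero => exact one_pos
    | succ i ih => rw [hN]; positivity
  have hdvd : ∀ i k, i ≤ k → N i ∣ N k := by
    intro i k h
    induction k, h using Nat.le_induction with
    | base => exact dvd_rfl
    | succ k _ ih => rw [hN]; exact ih.mul_right _
  let x : (ℕ → Bool) → ℕ → ℤ := fun ε i => if ε i then N i else 0
  have hx : ¬ Function.Injective fun ε => f (x ε) := by
    intro hinj
    have h1 : (Set.range fun ε => f (x ε)).Countable :=
      hr.mono (by rintro _ ⟨ε, rfl⟩; exact ⟨x ε, rfl⟩)
    have h2 : Countable (ℕ → Bool) := by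
      rw [← Set.countable_univ_iff]
      rw [← Set.image_univ] at h1
      exact Set.countable_of_injective_of_countable_image hinj.injOn h1
    obtain ⟨g, hg⟩ := exists_surjective_nat (ℕ → Bool)
    obtain ⟨i, hi⟩ := hg fun k => !g k k
    simpa using congrFun hi i
  simp only [Function.Injective, not_forall] at hx
  obtain ⟨ε, ε', h, hne⟩ := hx
  have hex : ∃ i, ε i ≠ ε' i := Function.ne_iff.1 hne
  classical
  set i := Nat.find hex with hi
  have hi1 : ε i ≠ ε' i := Nat.find_spec hex
  have hi2 : ∀ k, k < i → ε k = ε' k := fun k hk => by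
    by_contra h'
    exact Nat.find_min hex hk h'
  have hd : ∀ k, i < k → N (i + 1) ∣ x ε k - x ε' k := by
    intro k hk
    have h1 : ∀ η : ℕ → Bool, N (i + 1) ∣ x η k := by
      intro η
      simp only [x]
      split_ifs
      · exact hdvd _ _ hk
      · exact dvd_zero _
    exact dvd_sub (h1 ε) (h1 ε')
  choose! w hw using hd
  obtain ⟨s, hs, hs'⟩ : ∃ s : ℤ, s ≠ 0 ∧ x ε i - x ε' i = s * N i ∧ |s| = 1 := by
    rcases h1 : ε i <;> rcases h2 : ε' i
    · exact absurd (h1.trans h2.symm) hi1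
    · exact ⟨-1, by norm_num, by simp [x, h1, h2], by norm_num⟩
    · exact ⟨1, by norm_num, by simp [x, h1, h2], by norm_num⟩
    · exact absurd (h1.trans h2.symm) hi1
  have e : x ε - x ε' = (s * N i) • (Pi.single i 1 : ℕ → ℤ) +
      N (i + 1) • (fun k => if i < k then w k else 0) := by
    funext k
    simp only [Pi.sub_apply, Pi.add_apply, Pi.smul_apply, smul_eq_mul]
    rcases lt_trichotomy k i with h1 | h1 | h1
    · rw [Pi.single_eq_of_ne h1.ne, if_neg h1.not_gt]
      simp [x, hi2 k h1]
    · subst h1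
      rw [if_neg (lt_irrefl _), hs'.1]
      simp
    · rw [Pi.single_eq_of_ne h1.ne', if_pos h1, hw k h1]
      simp
  have h1 := congrFun (congrArg f e) (j i)
  rw [map_sub, map_add, map_zsmul, map_zsmul, show f (x ε) = f (x ε') from h, sub_self] at h1
  simp only [Pi.add_apply, Pi.smul_apply, Pi.zero_apply, smul_eq_mul] at h1
  have h2 : N (i + 1) ∣ s * N i * f (Pi.single i 1) (j i) :=
    ⟨-f (fun k => if i < k then w k else 0) (j i), by linear_combination -h1⟩
  have h3 := Int.eq_zero_of_abs_lt_dvd h2 (by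
    rw [abs_mul, abs_mul, hs'.2, one_mul, abs_of_pos (hpos i), hN]
    exact mul_lt_mul_of_pos_left (lt_add_one _) (hpos i))
  exact (mul_ne_zero (mul_ne_zero hs (hpos i).ne') (hj i)) h3

theorem map_eq_zero_of_support {f : (ℕ → ℤ) →+ ℤ} (hf : ∀ i, f (Pi.single i 1) = 0) (N : ℕ)
    (x : ℕ → ℤ) (hx : ∀ k, N ≤ k → x k = 0) : f x = 0 := by
  induction N generalizing x with
  | zero => rw [show x = 0 from funext fun k => hx k (Nat.zero_le k), map_zero]
  | succ N ih =>
    have h := ih (x - x N • Pi.single N 1) fun k hk => by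
      rcases hk.eq_or_lt with rfl | h
      · simp
      · simp [hx k h, Pi.single_eq_of_ne h.ne']
    rwa [map_sub, map_zsmul, hf, smul_zero, sub_zero] at h

/-- The first `N` terms are killed and the remaining ones are divisible by `m ^ N`; so the value is
divisible by all powers of `m`. -/
theorem map_pow_mul_eq_zero {f : (ℕ → ℤ) →+ ℤ} (hf : ∀ i, f (Pi.single i 1) = 0) {m : ℕ}
    (hm : 1 < m) (a : ℕ → ℤ) : f (fun k => (m : ℤ) ^ k * a k) = 0 := by
  have h : ∀ N, (m : ℤ) ^ N ∣ f (fun k => (m : ℤ) ^ k * a k) := by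
    intro N
    have e : (fun k => (m : ℤ) ^ k * a k) = (fun k => if k < N then (m : ℤ) ^ k * a k else 0) +
        (m : ℤ) ^ N • fun k => if k < N then 0 else (m : ℤ) ^ (k - N) * a k := by
      funext k
      simp only [Pi.add_apply, Pi.smul_apply, smul_eq_mul]
      split_ifs with hk
      · simp
      · rw [← mul_assoc, ← pow_add, Nat.add_sub_of_le (not_lt.1 hk), zero_add]
    rw [e, map_add, map_zsmul, map_eq_zero_of_support hf N _ fun k hk => if_neg hk.not_gt, zero_add]
    exact ⟨_, rfl⟩
  set z := f (fun k => (m : ℤ) ^ k * a k)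
  -- The exponent `z.natAbs` suffices because `z.natAbs < m ^ z.natAbs`.
  refine Int.eq_zero_of_abs_lt_dvd (h z.natAbs) ?_
  rw [Int.abs_eq_natAbs]
  exact_mod_cast Nat.lt_pow_self hm

/-- Specker's argument: since `2 ^ k` and `3 ^ k` are coprime, every sequence is a sum of two
sequences of the kind treated in `map_pow_mul_eq_zero`. -/
theorem eq_zero_of_map_single {f : (ℕ → ℤ) →+ ℤ} (hf : ∀ i, f (Pi.single i 1) = 0)
    (x : ℕ → ℤ) : f x = 0 := by
  have h : ∀ k : ℕ, ∃ a b : ℤ, x k = ((2 : ℕ) : ℤ) ^ k * a + ((3 : ℕ) : ℤ) ^ k * b := by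
    intro k
    have h1 : IsCoprime ((2 : ℤ) ^ k) ((3 : ℤ) ^ k) := IsCoprime.pow ⟨-1, 1, by norm_num⟩
    obtain ⟨a, b, hab⟩ := h1
    exact ⟨x k * a, x k * b, by push_cast; linear_combination (-x k) * hab⟩
  choose a b hab using h
  rw [show x = (fun k => ((2 : ℕ) : ℤ) ^ k * a k) + fun k => ((3 : ℕ) : ℤ) ^ k * b k from
    funext hab, map_add, map_pow_mul_eq_zero hf (by norm_num), map_pow_mul_eq_zero hf (by norm_num),
    add_zero]

end Specker

/-! ## Automatic continuity of controlled homomorphisms -/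

section Continuity

variable {X : Type*} [MetricSpace X]

theorem delta_mem_coarseChain {m : ℤ} {σ : Simplex X} (h : (σ.1 : ℤ) = m) :
    delta σ ∈ CoarseChain X m := by
  obtain ⟨R, hR⟩ := exists_within_self σ
  refine mem_coarseChain (R := R) (fun ρ hρ => by rw [eq_of_delta_ne_zero hρ, h]) (fun x r => ?_)
    fun ρ hρ => by rw [eq_of_delta_ne_zero hρ]; exact hR
  exact (Set.finite_singleton σ).subset fun ρ hρ => eq_of_delta_ne_zero hρ.1

open Classical in
/-- The values of a homomorphism on single simplices. -/
noncomputable def kernel {m k : ℤ} (q : CoarseChain X m →+ Cochain X k) (σ τ : Simplex X) : ℤ :=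
  if h : (σ.1 : ℤ) = m then (q ⟨delta σ, delta_mem_coarseChain h⟩).1 τ else 0

theorem kernel_eq {m k : ℤ} (q : CoarseChain X m →+ Cochain X k) {σ : Simplex X}
    (h : (σ.1 : ℤ) = m) (τ : Simplex X) :
    kernel q σ τ = (q ⟨delta σ, delta_mem_coarseChain h⟩).1 τ := dif_pos h

theorem apply_eq_finsum_of_finite {m k : ℤ} (q : CoarseChain X m →+ Cochain X k)
    (a : CoarseChain X m) (ha : {σ | a.1 σ ≠ 0}.Finite) (τ : Simplex X) :
    (q a).1 τ = ∑ᶠ σ, a.1 σ * kernel q σ τ := by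
  have hdim : ∀ σ ∈ ha.toFinset, (σ.1 : ℤ) = m := fun σ hσ => a.2.1 σ (by simpa using hσ)
  have e : a = ∑ σ ∈ ha.toFinset.attach,
      a.1 σ.1 • (⟨delta σ.1, delta_mem_coarseChain (hdim σ.1 σ.2)⟩ : CoarseChain X m) := by
    refine Subtype.ext (funext fun ρ => ?_)
    rw [AddSubgroup.val_finsetSum, Finset.sum_apply]
    simp only [AddSubgroup.coe_zsmul, Pi.smul_apply, smul_eq_mul]
    rw [Finset.sum_attach ha.toFinset fun σ => a.1 σ * delta σ ρ]
    by_cases h0 : a.1 ρ = 0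
    · rw [h0, Finset.sum_eq_zero]
      intro σ hσ
      rw [delta_of_ne, mul_zero]
      rintro rfl
      exact (by simpa using hσ : a.1 ρ ≠ 0) h0
    · rw [Finset.sum_eq_single_of_mem ρ (by simpa using h0) fun σ _ hσ => by
        rw [delta_of_ne hσ.symm, mul_zero], delta_self, mul_one]
  rw [finsum_eq_finsetSum_of_support_subset (s := ha.toFinset) _ fun σ hσ => by
    rw [Set.Finite.coe_toFinset]; exact left_ne_zero_of_mul hσ]
  conv_lhs => rw [e]
  rw [map_sum, AddSubgroup.val_finsetSum, Finset.sum_apply,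
    ← Finset.sum_attach ha.toFinset]
  refine Finset.sum_congr rfl fun σ _ => ?_
  rw [map_zsmul, kernel_eq q (hdim σ.1 σ.2)]
  rfl

/-- The simplices with vertices in `Y`, of size at most `R` and dimension at most `n`. -/
def smallSimplices (Y : Set X) (R : ℝ) (n : ℕ) : Set (Simplex X) :=
  {σ | verts σ ⊆ Y ∧ Within R σ σ ∧ σ.1 ≤ n}

/-- Every ball meets `Y` in a finite set. -/
def LocFinite (Y : Set X) : Prop := ∀ (x : X) (r : ℝ), {y ∈ Y | dist y x ≤ r}.Finite

variable {Y : Set X} {R : ℝ} {n : ℕ}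

theorem finite_smallSimplices_near (hY : LocFinite Y) (x : X) (r : ℝ) :
    {σ ∈ smallSimplices Y R n | ∃ v ∈ verts σ, dist v x ≤ r}.Finite := by
  refine (finite_simplices (hY x (R + r)) n).subset ?_
  rintro σ ⟨⟨h1, h2, h3⟩, v, hv, hx⟩
  exact ⟨fun w hw => ⟨h1 hw, (dist_triangle _ v _).trans (add_le_add (h2 w hw v hv) hx)⟩, h3⟩

theorem mem_coarseChain_of_small (hY : LocFinite Y) {m : ℤ} {c : Simplex X → ℤ}
    (h : ∀ σ, c σ ≠ 0 → σ ∈ smallSimplices Y R n ∧ (σ.1 : ℤ) = m) : c ∈ CoarseChain X m :=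
  mem_coarseChain (R := R) (fun σ hσ => (h σ hσ).2)
    (fun x r => (finite_smallSimplices_near hY x r).subset fun σ hσ => ⟨(h σ hσ.1).1, hσ.2⟩)
    fun σ hσ => (h σ hσ).1.2.1

/-- Infinite linear combinations of distinct small simplices. -/
noncomputable def combination (hY : LocFinite Y) {m : ℤ} {s : ℕ → Simplex X}
    (hs : ∀ i, s i ∈ smallSimplices Y R n ∧ ((s i).1 : ℤ) = m) :
    (ℕ → ℤ) →+ CoarseChain X m :=
  AddMonoidHom.mk' (fun ε => ⟨Function.extend s ε 0, mem_coarseChain_of_small hY fun σ hσ => by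
    by_cases h : ∃ i, s i = σ
    · obtain ⟨i, rfl⟩ := h
      exact hs i
    · exact absurd (Function.extend_apply' _ _ _ h) hσ⟩) fun ε ε' => Subtype.ext <| by
    have h := Function.extend_add s ε ε' 0 0
    rw [add_zero] at h
    exact h

theorem combination_single (hY : LocFinite Y) {m : ℤ} {s : ℕ → Simplex X}
    (hs : ∀ i, s i ∈ smallSimplices Y R n ∧ ((s i).1 : ℤ) = m) (hinj : Function.Injective s)
    (i : ℕ) : combination hY hs (Pi.single i 1) =
      ⟨delta (s i), delta_mem_coarseChain (hs i).2⟩ := by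
  refine Subtype.ext (funext fun σ => ?_)
  change Function.extend s (Pi.single i 1) 0 σ = delta (s i) σ
  by_cases h : ∃ j, s j = σ
  · obtain ⟨j, rfl⟩ := h
    rw [hinj.extend_apply]
    by_cases hij : j = i
    · subst hij; simp
    · rw [Pi.single_eq_of_ne hij, delta_of_ne fun h' => hij (hinj h')]
  · rw [Function.extend_apply' _ _ _ h, delta_of_ne fun h' => h ⟨i, h'.symm⟩]
    rfl

theorem exists_of_combination_ne_zero (hY : LocFinite Y) {m : ℤ} {s : ℕ → Simplex X}
    (hs : ∀ i, s i ∈ smallSimplices Y R n ∧ ((s i).1 : ℤ) = m) {ε : ℕ → ℤ} {σ : Simplex X}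
    (h : (combination hY hs ε).1 σ ≠ 0) : ∃ i, s i = σ := by
  by_contra h'
  exact h (Function.extend_apply' _ _ _ h')

/-- Evaluation of cochains. -/
def evalHom {ι : Type*} (k : ℤ) (t : ι → Simplex X) : Cochain X k →+ (ι → ℤ) :=
  AddMonoidHom.mk' (fun φ i => φ.1 (t i)) fun _ _ => rfl

/-- Infinitely many such `σ` would give a homomorphism `ℤ^ℕ → ℤ` that is non-zero on all unit
vectors, although its range is countable. No control of supports is needed here. -/
theorem finite_kernel_left (hY : LocFinite Y) {m k : ℤ} (q : CoarseChain X m →+ Cochain X k)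
    (τ : Simplex X) : {σ ∈ smallSimplices Y R n | kernel q σ τ ≠ 0}.Finite := by
  by_contra hinf
  let e := Set.Infinite.natEmbedding _ hinf
  have hdim : ∀ i, ((e i).1.1 : ℤ) = m := fun i => by
    by_contra h
    exact (e i).2.2 (dif_neg h)
  have hs : ∀ i, (e i).1 ∈ smallSimplices Y R n ∧ ((e i).1.1 : ℤ) = m :=
    fun i => ⟨(e i).2.1, hdim i⟩
  refine false_of_countable_range
    (((evalHom k fun _ : Unit => τ).comp q).comp (combination hY hs)) (Set.to_countable _)
    fun i h => ?_
  refine (e i).2.2 ?_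
  rw [kernel_eq q (hdim i), ← combination_single hY hs (Subtype.val_injective.comp e.injective)]
  exact congrFun h ()

theorem finite_kernel_right (hY : LocFinite Y) {m k : ℤ} {q : CoarseChain X m →+ Cochain X k}
    (hq : ∀ a, NearSupp (q a).1 a.1) (σ : Simplex X) :
    {τ ∈ smallSimplices Y R n | kernel q σ τ ≠ 0}.Finite := by
  by_cases h : (σ.1 : ℤ) = m
  · obtain ⟨R', hR'⟩ := hq ⟨delta σ, delta_mem_coarseChain h⟩ R
    refine (finite_smallSimplices_near (R := R) (n := n) hY (σ.2 0) R').subset ?_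
    rintro τ ⟨hτ, h0⟩
    rw [kernel_eq q h] at h0
    obtain ⟨ρ, hρ, hw⟩ := hR' τ h0 hτ.2.1
    rw [eq_of_delta_ne_zero hρ] at hw
    exact ⟨hτ, τ.2 0, zero_mem_verts τ, hw _ (zero_mem_verts τ) _ (zero_mem_verts σ)⟩
  · refine Set.finite_empty.subset fun τ hτ => hτ.2 (dif_neg h)

theorem exists_within_pair (σ τ : Simplex X) : ∃ r, Within r σ τ := by
  obtain ⟨r, hr⟩ := ((finite_verts σ).prod (finite_verts τ)).image (fun p => dist p.1 p.2)
    |>.bddAbove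
  exact ⟨r, fun v hv w hw => hr ⟨(v, w), ⟨hv, hw⟩, rfl⟩⟩

/-- Far out pairs in the support of the kernel can be chosen far from finitely many given pairs. -/
theorem exists_far_pair (hY : LocFinite Y) {m k : ℤ} {q : CoarseChain X m →+ Cochain X k}
    (hq : ∀ a, NearSupp (q a).1 a.1)
    (hfar : ∀ r, ∃ σ ∈ smallSimplices Y R n, ∃ τ ∈ smallSimplices Y R n,
      kernel q σ τ ≠ 0 ∧ ¬ Within r σ τ)
    (s : Set (Simplex X × Simplex X)) (hs : s.Finite) (r : ℝ) :
    ∃ σ ∈ smallSimplices Y R n, ∃ τ ∈ smallSimplices Y R n, kernel q σ τ ≠ 0 ∧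
      ¬ Within r σ τ ∧ ∀ p ∈ s, p.1 ≠ σ ∧ ¬ Within r p.1 τ ∧ ¬ Within r σ p.2 := by
  set S := smallSimplices Y R n
  -- `E` contains every pair in the support of the kernel that violates one of the separation
  -- conditions. It is finite, so any pair farther apart than all members of `E` will do.
  let E : Set (Simplex X × Simplex X) :=
    ⋃ p ∈ s, (({p.1} : Set (Simplex X)) ×ˢ {τ ∈ S | kernel q p.1 τ ≠ 0}) ∪
      ((⋃ τ ∈ {τ ∈ S | Within r p.1 τ}, {σ ∈ S | kernel q σ τ ≠ 0} ×ˢ {τ}) ∪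
        ⋃ σ ∈ {σ ∈ S | Within r σ p.2}, {σ} ×ˢ {τ ∈ S | kernel q σ τ ≠ 0})
  have hE : E.Finite := by
    refine hs.biUnion fun p _ => Set.Finite.union ?_ (Set.Finite.union ?_ ?_)
    · exact (Set.finite_singleton _).prod (finite_kernel_right hY hq _)
    · refine Set.Finite.biUnion ?_ fun τ _ =>
        (finite_kernel_left hY q τ).prod (Set.finite_singleton _)
      exact (finite_smallSimplices_near hY (p.1.2 0) r).subset fun τ hτ => ⟨hτ.1, τ.2 0,
        zero_mem_verts τ, hτ.2.symm _ (zero_mem_verts _) _ (zero_mem_verts _)⟩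
    · refine Set.Finite.biUnion ?_ fun σ _ =>
        (Set.finite_singleton _).prod (finite_kernel_right hY hq σ)
      exact (finite_smallSimplices_near hY (p.2.2 0) r).subset fun τ hτ => ⟨hτ.1, τ.2 0,
        zero_mem_verts τ, hτ.2 _ (zero_mem_verts _) _ (zero_mem_verts _)⟩
  choose B hB using fun p : Simplex X × Simplex X => exists_within_pair p.1 p.2
  obtain ⟨M, hM⟩ := (hE.image B).bddAbove
  obtain ⟨σ, hσ, τ, hτ, h0, hw⟩ := hfar (max M r)
  have hE' : (σ, τ) ∉ E := fun h =>
    hw ((hB (σ, τ)).mono ((hM ⟨_, h, rfl⟩).trans (le_max_left _ _)))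
  refine ⟨σ, hσ, τ, hτ, h0, fun h => hw (h.mono (le_max_right _ _)), fun p hp => ⟨?_, ?_, ?_⟩⟩
  · rintro rfl
    exact hE' (Set.mem_biUnion hp (Or.inl ⟨rfl, hτ, h0⟩))
  · intro h
    exact hE' (Set.mem_biUnion hp (Or.inr (Or.inl
      (Set.mem_biUnion (x := τ) ⟨hτ, h⟩ ⟨⟨hσ, h0⟩, rfl⟩))))
  · intro h
    exact hE' (Set.mem_biUnion hp (Or.inr (Or.inr
      (Set.mem_biUnion (x := σ) ⟨hσ, h⟩ ⟨rfl, hτ, h0⟩))))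

/-- A controlled homomorphism has a controlled kernel. -/
theorem exists_kernel_within (hY : LocFinite Y) {m k : ℤ} {q : CoarseChain X m →+ Cochain X k}
    (hq : ∀ a, NearSupp (q a).1 a.1) (R : ℝ) (n : ℕ) :
    ∃ r, ∀ σ ∈ smallSimplices Y R n, ∀ τ ∈ smallSimplices Y R n,
      kernel q σ τ ≠ 0 → Within r σ τ := by
  by_contra! hfar
  -- Each chosen pair carries the radius by which it is separated from the earlier ones. The radii
  -- are strictly increasing integers, so the one with index `l` is at least `l`.
  obtain ⟨f, hP, hr⟩ := exists_seq_of_forall_finset_exists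
    (fun p : ℕ × Simplex X × Simplex X => p.2.1 ∈ smallSimplices Y R n ∧
      p.2.2 ∈ smallSimplices Y R n ∧ kernel q p.2.1 p.2.2 ≠ 0 ∧ ¬ Within p.1 p.2.1 p.2.2)
    (fun p p' => p.1 < p'.1 ∧ p.2.1 ≠ p'.2.1 ∧ ¬ Within p'.1 p.2.1 p'.2.2 ∧
      ¬ Within p'.1 p'.2.1 p.2.2) (fun s _ => by
    obtain ⟨σ, hσ, τ, hτ, h0, hw, h⟩ := exists_far_pair hY hq hfar 
      (Prod.snd '' (s : Set (ℕ × Simplex X × Simplex X))) (s.finite_toSet.image _) ((s.sup Prod.fst + 1 : ℕ) : ℝ)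
    exact ⟨(s.sup Prod.fst + 1, σ, τ), ⟨hσ, hτ, h0, hw⟩, fun p hp =>
      ⟨Nat.lt_succ_of_le (Finset.le_sup (f := Prod.fst) hp), h p.2 ⟨p, hp, rfl⟩⟩⟩)
  have hmono : StrictMono fun i => (f i).1 := fun i j hij => (hr i j hij).1
  have hinj : Function.Injective fun i => (f i).2.1 := by
    intro i j h
    rcases lt_trichotomy i j with hij | hij | hij
    · exact absurd h (hr i j hij).2.1
    · exact hij
    · exact absurd h.symm (hr j i hij).2.1
  have hdim : ∀ i, ((f i).2.1.1 : ℤ) = m := fun i => by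
    by_contra h
    exact (hP i).2.2.1 (dif_neg h)
  have hs : ∀ i, (f i).2.1 ∈ smallSimplices Y R n ∧ ((f i).2.1.1 : ℤ) = m :=
    fun i => ⟨(hP i).1, hdim i⟩
  refine false_of_countable_range
    (((evalHom k fun i => (f i).2.2).comp q).comp (combination hY hs)) ?_ fun i h => ?_
  -- For a fixed combination, a non-zero value at the `i`-th test simplex puts it within `R'` of
  -- some chosen `σ`. The separation allows this only for `i ≤ ⌈R'⌉₊`, so all values are finitely
  -- supported sequences, of which there are countably many.
  · refine (Set.countable_range fun g : ℕ →₀ ℤ => (⇑g : ℕ → ℤ)).mono ?_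
    rintro _ ⟨ε, rfl⟩
    obtain ⟨R', hR'⟩ := hq (combination hY hs ε) R
    have hfin : (Function.support (((evalHom k fun i => (f i).2.2).comp q).comp
        (combination hY hs) ε)).Finite := by
      refine (Set.finite_Iic ⌈R'⌉₊).subset fun i hi => ?_
      obtain ⟨ρ, hρ, hw⟩ := hR' _ hi (hP i).2.1.2.1
      obtain ⟨j, rfl⟩ := exists_of_combination_ne_zero hY hs hρ
      have key : ∀ l, i ≤ l → ¬ Within (f l).1 (f j).2.1 (f i).2.2 → i ≤ ⌈R'⌉₊ := by
        intro l hl h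
        by_contra! h'
        refine h (hw.symm.mono ((Nat.le_ceil R').trans ?_))
        exact_mod_cast h'.le.trans (hl.trans (hmono.id_le l))
      rcases lt_trichotomy i j with hij | hij | hij
      · exact key j hij.le (hr i j hij).2.2.2
      · subst hij
        exact key i le_rfl (hP i).2.2.2
      · exact key i le_rfl (hr j i hij).2.2.1
    exact ⟨Finsupp.ofSupportFinite _ hfin, rfl⟩
  · refine (hP i).2.2.1 ?_
    rw [kernel_eq q (hdim i), ← combination_single hY hs hinj]
    exact congrFun h i

/-- A homomorphism is determined by its kernel. -/
theorem apply_eq_finsum (hY : LocFinite Y) {m k : ℤ} (q : CoarseChain X m →+ Cochain X k)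
    (a : CoarseChain X m) (ha : ∀ σ, a.1 σ ≠ 0 → σ ∈ smallSimplices Y R n) (τ : Simplex X) :
    (q a).1 τ = ∑ᶠ σ, a.1 σ * kernel q σ τ := by
  classical
  -- `b` is the part of `a` seen by the kernel at `τ`, which is finite by `finite_kernel_left`; it
  -- remains to show that `q` of the rest vanishes at `τ`.
  let b : CoarseChain X m := ⟨fun σ => if kernel q σ τ = 0 then 0 else a.1 σ,
    CoarseChain.of_support a.2 fun σ h h' => h (by simp [h'])⟩
  -- The rest is cut into shells by the integer part of the distance to `τ`, the `i`-th one weighted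
  -- by `ε i`. Each shell is finite with zero kernel, so the resulting homomorphism on `ℤ^ℕ` kills
  -- the unit vectors; hence it kills the constant sequence `1`.
  let c (ε : ℕ → ℤ) : Simplex X → ℤ := fun σ =>
    ε ⌊dist (σ.2 0) (τ.2 0)⌋₊ * if kernel q σ τ = 0 then a.1 σ else 0
  have hc : ∀ ε, c ε ∈ CoarseChain X m := fun ε =>
    CoarseChain.of_support a.2 fun σ h h' => h (by simp [c, h'])
  let g : (ℕ → ℤ) →+ CoarseChain X m := AddMonoidHom.mk' (fun ε => ⟨c ε, hc ε⟩) fun ε ε' =>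
    Subtype.ext (funext fun σ => by
      change (ε _ + ε' _) * _ = ε _ * _ + ε' _ * _
      ring)
  have hg : ∀ i, (q (g (Pi.single i 1))).1 τ = 0 := by
    intro i
    rw [apply_eq_finsum_of_finite]
    · refine (finsum_congr fun σ => ?_).trans finsum_zero
      change _ * (if kernel q σ τ = 0 then a.1 σ else 0) * kernel q σ τ = 0
      split_ifs with h
      · rw [h, mul_zero]
      · rw [mul_zero, zero_mul]
    · refine (CoarseChain.finite_near a.2 (τ.2 0) (i + 1)).subset fun σ hσ => ?_
      have h1 := left_ne_zero_of_mul hσ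
      have h2 := right_ne_zero_of_mul hσ
      refine ⟨fun h => h2 (by simp [h]), σ.2 0, zero_mem_verts σ, ?_⟩
      have h3 : ⌊dist (σ.2 0) (τ.2 0)⌋₊ = i := by
        by_contra h
        exact h1 (Pi.single_eq_of_ne h _)
      rw [← h3]
      exact (Nat.lt_floor_add_one _).le
  have h0 := eq_zero_of_map_single
    (f := ((Pi.evalAddMonoidHom (fun _ : Unit => ℤ) ()).comp
      ((evalHom k fun _ : Unit => τ).comp q)).comp g) hg 1
  have h0' : (q (g 1)).1 τ = 0 := h0
  have e : a = b + g 1 := Subtype.ext (funext fun σ => by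
    change a.1 σ = (if kernel q σ τ = 0 then 0 else a.1 σ) +
      1 * if kernel q σ τ = 0 then a.1 σ else 0
    split_ifs <;> simp)
  have hb := apply_eq_finsum_of_finite q b ((finite_kernel_left (R := R) (n := n) hY q τ).subset
    fun σ hσ => by
      have hσ' : (if kernel q σ τ = 0 then 0 else a.1 σ) ≠ 0 := hσ
      split_ifs at hσ' with h
      · exact absurd rfl hσ'
      · exact ⟨ha σ hσ', h⟩) τ
  conv_lhs => rw [e]
  rw [map_add, AddSubgroup.coe_add, Pi.add_apply, h0', add_zero, hb]
  refine finsum_congr fun σ => ?_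
  change (if kernel q σ τ = 0 then 0 else a.1 σ) * _ = _
  split_ifs with h
  · rw [h, mul_zero, mul_zero]
  · rfl

end Continuity

/-! ## The orientation pair of a coarse Poincaré duality space -/

section Retraction

variable {X : Type*}

/-- The image of a simplex under a map. -/
def mapSimplex (r : X → X) (σ : Simplex X) : Simplex X := ⟨σ.1, r ∘ σ.2⟩

theorem coboundary_mapSimplex (r : X → X) (φ : Simplex X → ℤ) (σ : Simplex X) :
    coboundary (fun ρ => φ (mapSimplex r ρ)) σ = coboundary φ (mapSimplex r σ) := by
  obtain ⟨_ | k, s⟩ := σ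
  · rfl
  · rfl

theorem mapSimplex_of_eqOn {r : X → X} {σ : Simplex X} (h : ∀ v ∈ verts σ, r v = v) :
    mapSimplex r σ = σ :=
  congrArg (Sigma.mk σ.1) (funext fun i => h _ ⟨i, rfl⟩)

theorem verts_mapSimplex (r : X → X) (σ : Simplex X) : verts (mapSimplex r σ) = r '' verts σ :=
  Set.range_comp r σ.2

theorem coboundary_oneCochain : coboundary (oneCochain X) = 0 := by
  funext σ
  obtain ⟨_ | _ | k, s⟩ := σ
  · rfl
  · change ∑ i : Fin 2, (-1 : ℤ) ^ (i : ℕ) * oneCochain X (face i s) = 0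
    simp [Fin.sum_univ_two, oneCochain, face]
  · change ∑ i : Fin (k + 3), (-1 : ℤ) ^ (i : ℕ) * oneCochain X (face i s) = 0
    simp [oneCochain, face]

variable [MetricSpace X]

theorem within_mapSimplex {r : X → X} {R R₀ : ℝ} (hr : ∀ x, dist x (r x) ≤ R₀) {σ τ : Simplex X}
    (h : Within R σ τ) : Within (R₀ + R + R₀) (mapSimplex r σ) (mapSimplex r τ) := by
  rintro v hv w hw
  rw [verts_mapSimplex] at hv hw
  obtain ⟨x, hx, rfl⟩ := hv
  obtain ⟨y, hy, rfl⟩ := hw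
  have h1 := hr x
  rw [dist_comm] at h1
  exact (dist_triangle4 _ x y _).trans (add_le_add (add_le_add h1 (h x hx y hy)) (hr y))

theorem within_of_mapSimplex {r : X → X} {R R₀ : ℝ} (hr : ∀ x, dist x (r x) ≤ R₀)
    {σ τ : Simplex X} (h : Within R (mapSimplex r σ) (mapSimplex r τ)) :
    Within (R₀ + R + R₀) σ τ := by
  rintro v hv w hw
  rw [Within, verts_mapSimplex, verts_mapSimplex] at h
  have h1 := hr w
  rw [dist_comm] at h1
  exact (dist_triangle4 _ (r v) (r w) _).trans (add_le_add (add_le_add (hr v)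
    (h _ ⟨v, hv, rfl⟩ _ ⟨w, hw, rfl⟩)) h1)

/-- The vertices of a coarse chain. -/
def chainVerts (c : Simplex X → ℤ) : Set X := {x | ∃ σ, c σ ≠ 0 ∧ x ∈ verts σ}

theorem locFinite_chainVerts {k : ℤ} {c : Simplex X → ℤ} (hc : c ∈ CoarseChain X k) :
    LocFinite (chainVerts c) := by
  intro x r
  refine ((CoarseChain.finite_near hc x r).biUnion fun σ _ => finite_verts σ).subset ?_
  rintro y ⟨⟨σ, hσ, hy⟩, hyx⟩
  exact Set.mem_biUnion (x := σ) ⟨hσ, y, hy, hyx⟩ hy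

/-- A point is a `0`-simplex of size `0` in the support of `1`, so a single constant bounds its
distance to some simplex of `c`. -/
theorem exists_retraction {c : Simplex X → ℤ} (h : NearSupp (oneCochain X) c) :
    ∃ (r : X → X) (R₀ : ℝ), (∀ x, dist x (r x) ≤ R₀) ∧ (∀ x, r x ∈ chainVerts c) ∧
      ∀ x ∈ chainVerts c, r x = x := by
  obtain ⟨R₀, hR₀⟩ := h 0
  have key : ∀ x, ∃ y, dist x y ≤ R₀ ∧ y ∈ chainVerts c ∧ (x ∈ chainVerts c → y = x) := by
    intro x
    obtain ⟨ρ, hρ, hw⟩ := hR₀ ⟨0, fun _ => x⟩ (by simp [oneCochain]) (by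
      rintro _ ⟨i, rfl⟩ _ ⟨j, rfl⟩
      exact (dist_self x).le)
    by_cases hx : x ∈ chainVerts c
    · exact ⟨x, (dist_self x).le.trans hw.nonneg, hx, fun _ => rfl⟩
    · exact ⟨ρ.2 0, hw x ⟨0, rfl⟩ _ (zero_mem_verts ρ), ⟨ρ, hρ, zero_mem_verts ρ⟩,
        fun h' => absurd h' hx⟩
  choose r h1 h2 h3 using key
  exact ⟨r, R₀, h1, h2, h3⟩

end Retraction

/-! ### The fundamental cycle and the diagonal cocycle of a duality. -/

namespace CoarseDuality

variable {X : Type*} [MetricSpace X] {n : ℕ} (D : CoarseDuality X n)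

theorem boundary_p {k k' m m' : ℤ} (hk : k + 1 = k') (hm : m + 1 = m') (h : k + m' = n)
    (h' : k' + m = n) (φ : Cochain X k) :
    boundary (D.p k m' h φ).1 = (D.p k' m h' ⟨coboundary φ.1, coboundary_mem hk φ.2⟩).1 := by
  subst hk hm
  exact congrArg Subtype.val (D.p_comm k m h h' φ)

theorem coboundary_q {k k' m m' : ℤ} (hk : k + 1 = k') (hm : m + 1 = m') (h : k + m' = n)
    (h' : k' + m = n) (c : CoarseChain X m') :
    coboundary (D.q k m' h c).1 = (D.q k' m h' ⟨boundary c.1, boundary_mem hm c.2⟩).1 := by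
  subst hk hm
  exact congrArg Subtype.val (D.q_comm k m h h' c)

theorem nearSupp_q {k m : ℤ} (h : k + m = n) (a : CoarseChain X m) :
    NearSupp (D.q k m h a).1 a.1 := by
  by_cases ha : a.1 = 0
  · obtain rfl : a = 0 := Subtype.ext ha
    rw [map_zero]
    exact nearSupp_of_imp fun _ h => h
  · exact (D.supp_q k m h a).nearSupp ha

/-- The fundamental cycle: the image of the constant cochain `1` under `p`. -/
noncomputable def cycle : CoarseChain X n :=
  -- Degree `0` is written `-1 + 1` because `homotopy_F` is stated in degrees of the form `k + 1`.
  D.p (-1 + 1) n (by omega) ⟨oneCochain X, fun σ hσ => by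
    by_contra h
    exact hσ (if_neg (by simpa using h))⟩

theorem boundary_cycle : boundary D.cycle.1 = 0 := by
  rw [cycle, D.boundary_p (m := n - 1) (k' := 1) rfl (by omega) _ (by omega)]
  simp only [coboundary_oneCochain]
  exact congrArg Subtype.val (map_zero (D.p 1 (n - 1) _))

/-- In `q p (1) - 1 = d F(1) + F(d 1)` the first term vanishes because `F(1)` has degree `-1`, and
the second because `1` is a cocycle. -/
theorem q_cycle : (D.q (-1 + 1) n (by omega) D.cycle).1 = oneCochain X := by
  have h := D.homotopy_F (-1) n (by omega) ⟨oneCochain X, fun σ hσ => by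
    by_contra h
    exact hσ (if_neg (by simpa using h))⟩
  have h1 : ∀ φ : Cochain X (-1), φ = 0 := fun φ => Subtype.ext <| funext fun σ => by
    by_contra h
    have := φ.2 σ h
    omega
  have h2 : Cochain.d (X := X) (-1 + 1) (-1 + 1 + 1) rfl ⟨oneCochain X, fun σ hσ => by
    by_contra h
    exact hσ (if_neg (by simpa using h))⟩ = 0 := Subtype.ext coboundary_oneCochain
  rw [h2, h1 (D.F (-1) _), map_zero, map_zero, add_zero, sub_eq_zero] at h
  exact congrArg Subtype.val h

/-- The value of `q` on single simplices. -/
noncomputable def qKernel (σ τ : Simplex X) : ℤ :=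
  kernel (D.q (n - σ.1) σ.1 (sub_add_cancel _ _)) σ τ

theorem kernel_q {k m : ℤ} (h : k + m = n) {σ : Simplex X} (hσ : (σ.1 : ℤ) = m) (τ : Simplex X) :
    kernel (D.q k m h) σ τ = D.qKernel σ τ := by
  subst hσ
  obtain rfl : k = n - σ.1 := by omega
  rfl

theorem qKernel_dim {σ τ : Simplex X} (h : D.qKernel σ τ ≠ 0) : (σ.1 : ℤ) + τ.1 = n := by
  rw [qKernel, kernel_eq _ rfl] at h
  have := (D.q _ _ _ _).2 τ h
  omega

/-- This is the chain map property of `q` on the single simplex `σ`. Its boundary is a finite chain,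
so finite additivity and the adjointness of `∂` and `d` are enough. -/
theorem coboundary_qKernel (σ τ : Simplex X) :
    coboundary (fun ρ => D.qKernel ρ τ) σ = coboundary (D.qKernel σ) τ := by
  have hb : ∀ ρ, boundary (delta σ) ρ ≠ 0 → verts ρ ⊆ verts σ ∧ ρ.1 + 1 = σ.1 := by
    intro ρ hρ
    obtain ⟨i, x, hx⟩ := boundary_ne_zero hρ
    have e := eq_of_delta_ne_zero hx
    rw [← e]
    exact ⟨verts_subset_insertVertex i x ρ.2, rfl⟩
  have h := congrFun (D.coboundary_q (k := n - σ.1) (m := σ.1 - 1) rfl (sub_add_cancel _ _)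
    (sub_add_cancel _ _) (by omega) ⟨delta σ, delta_mem_coarseChain rfl⟩) τ
  have hfin : {ρ | boundary (delta σ) ρ ≠ 0}.Finite := (finite_simplices (finite_verts σ) σ.1).subset
    fun ρ hρ => ⟨(hb ρ hρ).1, by have := (hb ρ hρ).2; omega⟩
  rw [apply_eq_finsum_of_finite _ _ hfin] at h
  have e : D.qKernel σ = (D.q (n - σ.1) σ.1 (sub_add_cancel _ _)
      ⟨delta σ, delta_mem_coarseChain rfl⟩).1 := funext fun τ => kernel_eq _ rfl τ
  have e' : coboundary (fun ρ => D.qKernel ρ τ) σ =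
      ∑ᶠ ρ, delta σ ρ * coboundary (fun ρ => D.qKernel ρ τ) ρ := by
    rw [finsum_eq_single _ σ fun ρ hρ => by rw [delta_of_ne hρ, zero_mul], delta_self, one_mul]
  rw [e, h, e',
    ← finsum_boundary_mul ((Set.finite_singleton σ).subset fun ρ hρ => eq_of_delta_ne_zero hρ.1)]
  refine finsum_congr fun ρ => ?_
  by_cases h0 : boundary (delta σ) ρ = 0
  · simp [h0]
  · rw [D.kernel_q _ (by have := (hb ρ h0).2; omega)]

theorem exists_qKernel_within {Y : Set X} (hY : LocFinite Y) (R : ℝ) :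
    ∃ r, ∀ σ τ, verts σ ⊆ Y → verts τ ⊆ Y → Within R σ σ → Within R τ τ →
      D.qKernel σ τ ≠ 0 → Within r σ τ := by
  choose r hr using fun j : ℕ =>
    exists_kernel_within hY (D.nearSupp_q (k := n - j) (m := j) (sub_add_cancel _ _)) R n
  -- The dimensions of `σ` and `τ` add up to `n`, so a bound for each dimension up to `n` suffices.
  obtain ⟨M, hM⟩ := ((Finset.range (n + 1)).image r).exists_le
  refine ⟨M, fun σ τ hσ hτ hσR hτR h => ?_⟩
  have hd := D.qKernel_dim h
  exact (hr σ.1 σ ⟨hσ, hσR, by omega⟩ τ ⟨hτ, hτR, by omega⟩ h).mono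
    (hM _ (Finset.mem_image_of_mem r (Finset.mem_range.2 (by omega))))

/-- The diagonal cocycle. -/
noncomputable def diagonal (r : X → X) (s : Simplex X × Simplex X) : ℤ :=
  sgnQ n * (sgnQ s.1.1 * D.qKernel (mapSimplex r s.1) (mapSimplex r s.2))

theorem qKernel_of_diagonal {r : X → X} {s : Simplex X × Simplex X} (h : D.diagonal r s ≠ 0) :
    D.qKernel (mapSimplex r s.1) (mapSimplex r s.2) ≠ 0 :=
  right_ne_zero_of_mul (right_ne_zero_of_mul h)

/-- The kernel is controlled only over the locally finite set `Y`. As `r` maps into `Y` and moves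
points by at most `R₀`, the control carries over to `X`. -/
theorem diagonal_mem {Y : Set X} (hY : LocFinite Y) {r : X → X} {R₀ : ℝ}
    (hr : ∀ x, dist x (r x) ≤ R₀) (hrY : ∀ x, r x ∈ Y) : D.diagonal r ∈ TensorCochain X n := by
  refine mem_tensorCochain (fun s hs =>
    D.qKernel_dim (σ := mapSimplex r s.1) (τ := mapSimplex r s.2) (D.qKernel_of_diagonal hs)) fun R => ?_
  obtain ⟨M, hM⟩ := D.exists_qKernel_within hY (R₀ + R + R₀)
  have hv : ∀ σ, verts (mapSimplex r σ) ⊆ Y := by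
    intro σ
    rw [verts_mapSimplex]
    rintro _ ⟨x, -, rfl⟩
    exact hrY x
  exact ⟨_, fun α β h hα hβ => within_of_mapSimplex hr (hM _ _ (hv α) (hv β)
    (within_mapSimplex hr hα) (within_mapSimplex hr hβ) (D.qKernel_of_diagonal h))⟩

/-- By `coboundary_qKernel` the two partial coboundaries agree up to sign, and `sgnQ (k + 1) =
(-1)^k * sgnQ k` makes them cancel. -/
theorem tensorCoboundary_diagonal (r : X → X) : tensorCoboundary (D.diagonal r) = 0 := by
  funext ⟨σ, τ⟩
  have h := D.coboundary_qKernel (mapSimplex r σ) (mapSimplex r τ)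
  have h1 : coboundary (fun ρ => D.diagonal r (ρ, τ)) σ = sgnQ n * (sgnQ (σ.1 - 1) *
      coboundary (fun ρ => D.qKernel ρ (mapSimplex r τ)) (mapSimplex r σ)) := by
    rw [← coboundary_mapSimplex]
    obtain ⟨_ | k, s⟩ := σ
    · simp [coboundary]
    · simp only [coboundary, Finset.mul_sum]
      refine Finset.sum_congr rfl fun i _ => ?_
      simp only [diagonal, face, Nat.add_sub_cancel]
      ring
  have h2 : coboundary (fun ρ => D.diagonal r (σ, ρ)) τ = sgnQ n * (sgnQ σ.1 *
      coboundary (D.qKernel (mapSimplex r σ)) (mapSimplex r τ)) := by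
    rw [← coboundary_mapSimplex]
    obtain ⟨_ | k, s⟩ := τ
    · simp [coboundary]
    · simp only [coboundary, Finset.mul_sum]
      refine Finset.sum_congr rfl fun i _ => ?_
      simp only [diagonal]
      ring
  change coboundary (fun ρ => D.diagonal r (ρ, τ)) σ +
    (-1) ^ σ.1 * coboundary (fun ρ => D.diagonal r (σ, ρ)) τ = 0
  rw [h1, h2, h]
  obtain ⟨_ | k, s⟩ := σ
  · rw [← h]
    simp [mapSimplex, coboundary]
  · simp only [Nat.add_sub_cancel]
    rw [sgnQ_succ, sgnQ.eq_1 k, pow_succ]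
    ring

/-- As `r` fixes the vertices of the cycle, the slant product at `τ` is the sum of the kernel over
the cycle, evaluated at the image of `τ` under `r`. By `apply_eq_finsum` this is the value of `q` on
the cycle, namely that of the constant cochain `1`. -/
theorem slant_diagonal {r : X → X} (hr : ∀ x ∈ chainVerts D.cycle.1, r x = x) :
    slant (D.diagonal r) D.cycle.1 = oneCochain X := by
  funext τ
  obtain ⟨R, hR⟩ := CoarseChain.exists_within D.cycle.2
  have hdim : ∀ σ, D.cycle.1 σ ≠ 0 → (σ.1 : ℤ) = n := D.cycle.2.1
  have h := apply_eq_finsum (R := R) (n := n) (locFinite_chainVerts D.cycle.2)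
    (D.q (-1 + 1) n (by omega)) D.cycle
    (fun σ hσ => ⟨fun v hv => ⟨σ, hσ, hv⟩, hR σ hσ, by have := hdim σ hσ; omega⟩) (mapSimplex r τ)
  rw [q_cycle] at h
  refine Eq.trans (finsum_congr fun σ => ?_) h.symm
  by_cases h0 : D.cycle.1 σ = 0
  · simp [h0]
  · have e : σ.1 = n := by exact_mod_cast hdim σ h0
    rw [D.kernel_q _ (hdim σ h0), diagonal, e, ← mul_assoc (sgnQ n), sgnQ_mul_self, one_mul,
      mapSimplex_of_eqOn fun v hv => hr v ⟨σ, h0, hv⟩]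

theorem exists_isOrientationPair (D : CoarseDuality X n) : ∃ (U : TensorCohomology X n) (z : CoarseHomology X n),
    IsOrientationPair (n : ℤ) U z := by
  have h := D.nearSupp_q (k := -1 + 1) (m := n) (by omega) D.cycle
  rw [q_cycle] at h
  obtain ⟨r, R₀, hr, hrY, hid⟩ := exists_retraction h
  refine ⟨QuotientAddGroup.mk ⟨⟨D.diagonal r, D.diagonal_mem (locFinite_chainVerts D.cycle.2) hr
    hrY⟩, Subtype.ext (D.tensorCoboundary_diagonal r)⟩,
    QuotientAddGroup.mk ⟨D.cycle, Subtype.ext D.boundary_cycle⟩, ?_⟩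
  exact congrArg QuotientAddGroup.mk (Subtype.ext (Subtype.ext (D.slant_diagonal hid)))

end CoarseDuality

end CoarsePD

theorem theorem7p3 (X : Type*) [MetricSpace X] (n : ℕ) :
    CoarsePD.IsCoarsePD X n ↔
      ∃ (U : CoarsePD.TensorCohomology X n) (z : CoarsePD.CoarseHomology X n),
        CoarsePD.IsOrientationPair (n : ℤ) U z :=
  ⟨fun ⟨D⟩ => D.exists_isOrientationPair, fun ⟨_, _, h⟩ => CoarsePD.isCoarsePD_of_isOrientationPair h⟩
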